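/- Let $(M,g)$ be a smooth compact Riemannian manifold without boundary, $\dim M=m\in\{2,3\}$, with Levi-Civita connection $\nabla$; one-forms are identified with vector fields by means of $g$, and $|\cdot|$ is the pointwise length. Let $\Omega\subset M$ be a Lipschitz domain, i.e. an open connected set which near each boundary point is, in suitable smooth coordinates, the part above the graph of a Lipschitz function. Fix a finite smooth atlas of $M$ and a subordinate smooth partition of unity; for $\sigma\in\mathbb R$ let $H^{\sigma}(M,\Lambda^1TM)$ be the $L^2$-based Bessel potential space whose norm is the sum of the $H^\sigma(\mathbb R^m)$ norms of the localized components. Let $$H^{\sigma}(\Omega,\Lambda^1TM)=\{U|_\Omega: U\in H^{\sigma}(M,\Lambda^1TM)\}$$ with the quotient norm, and $$\widetilde H^{\sigma}(\Omega,\Lambda^1TM)=\{f\in H^{\sigma}(M,\Lambda^1TM): \operatorname{supp} f\subseteq\overline\Omega\}$$ with the norm of $H^\sigma(M,\Lambda^1TM)$. Let $\mathring E$ denote extension by zero from $\Omega$ to $M$, let $k,\beta\in\mathbb R$, and put $$\mathring{\mathcal I}(\mathbf v)=\mathring E\big(k|\mathbf v|\mathbf v+\beta\nabla_{\mathbf v}\mathbf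 v\big),$$ where, in local coordinates, $(\nabla_{\mathbf v}\mathbf w)^\ell=v^j\partial_jw^\ell+\Gamma^\ell_{rj}w^rv^j$ with weak derivatives $\partial_j w^\ell$ and the Christoffel symbols $\Gamma^\ell_{rj}$ of $g$. Then there are constants $C_1',C_1>0$, depending only on $\Omega,k,\beta$ (and on $(M,g)$ and the fixed choice of norms), such that for every $s\in[\tfrac12,1)$ the operator $\mathring{\mathcal I}$ is well defined from $H^{s+\frac12}(\Omega,\Lambda^1TM)$ to $\widetilde H^{s-\frac32}(\Omega,\Lambda^1TM)$ and $$\|\mathring{\mathcal I}(\mathbf u)\|_{\widetilde H^{s-\frac32}(\Omega,\Lambda^1TM)}\le C_1'\,\|\mathbf u\|^2_{H^{s+\frac12}(\Omega,\Lambda^1TM)},$$ $$\|\mathring{\mathcal I}(\mathbf v)-\mathring{\mathcal I}(\mathbf w)\|_{\widetilde H^{s-\frac32}(\Omega,\Lambda^1TM)}\le C_1\big(\|\mathbf v\|_{H^{s+\frac12}(\Omega,\Lambda^1TM)}+\|\mathbf w\|_{H^{s+\frac12}(\Omega,\Lambda^1TM)}\big)\|\mathbf v-\mathbf w\|_{H^{s+\frac12}(\Omega,\Lambda^1TM)}$$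 for all $\mathbf u,\mathbf v,\mathbf w\in H^{s+\frac12}(\Omega,\Lambda^1TM)$. -/

import Mathlib

open MeasureTheory TemperedDistribution
open scoped Manifold ContDiff ENNReal NNReal SchwartzMap

noncomputable section

namespace SobolevField

/-- Euclidean space `ℝᵐ`. -/
abbrev Euc (m : ℕ) : Type := EuclideanSpace ℝ (Fin m)

/-! ### Bessel potential spaces on `ℝᵐ` -/

/-- The tempered distribution `ψ ↦ ∫ ψ f` given by an integrable function `f`. -/
def regularDist {m : ℕ} {f : Euc m → ℂ} (hf : Integrable f) : 𝓢'(Euc m, ℂ) :=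
  Lp.toTemperedDistribution (hf.toL1 f)

/-- The regular distribution `f ∈ L¹(ℝᵐ)` belongs to the `L²`-based Bessel potential space
`H^σ(ℝᵐ)`, `σ ∈ ℝ`. -/
def MemHs {m : ℕ} (σ : ℝ) (f : Euc m → ℂ) : Prop :=
  ∃ hf : Integrable f, MemSobolev σ 2 (regularDist hf)

/-- The `H^σ(ℝᵐ)` norm of `f`: the `L²` norm of the (unique) function `h` that represents the
Bessel potential of order `σ` of `f`; it is `∞` if there is no such function. -/
def hsNorm {m : ℕ} (σ : ℝ) (f : Euc m → ℂ) : ℝ≥0∞ :=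
  ⨅ (h : Lp ℂ 2 (volume : Measure (Euc m)))
    (_ : ∃ hf : Integrable f, besselPotential (Euc m) ℂ σ (regularDist hf) = h), ‖h‖ₑ

/-! ### Weak partial derivatives in open subsets of `ℝᵐ` -/

/-- `d` is the weak partial derivative `∂f/∂xʲ` of `f` in the open set `W ⊆ ℝᵐ`. -/
def HasWeakPartial {m : ℕ} (W : Set (Euc m)) (j : Fin m) (f d : Euc m → ℝ) : Prop :=
  LocallyIntegrableOn f W ∧ LocallyIntegrableOn d W ∧
    ∀ ψ : Euc m → ℝ, ContDiff ℝ ∞ ψ → HasCompactSupport ψ → tsupport ψ ⊆ W →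
      ∫ x, f x * fderiv ℝ ψ x (EuclideanSpace.single j 1) = - ∫ x, d x * ψ x

section Manifold

variable {m : ℕ} {M : Type*} [TopologicalSpace M] [ChartedSpace (Euc m) M]

/-- Vector fields on `M` without any regularity. One-forms are identified with vector fields
by means of the Riemannian metric. -/
abbrev VField (m : ℕ) (M : Type*) [TopologicalSpace M] [ChartedSpace (Euc m) M] : Type _ :=
  (p : M) → TangentSpace 𝓘(ℝ, Euc m) p

/-- The smooth charts of `M`. -/
abbrev smoothCharts (m : ℕ) (M : Type*) [TopologicalSpace M] [ChartedSpace (Euc m) M] :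
    Set (OpenPartialHomeomorph M (Euc m)) :=
  IsManifold.maximalAtlas 𝓘(ℝ, Euc m) ∞ M

/-- The component `u^ℓ` of `u = u^ℓ ∂_ℓ` in the chart `φ`, as a function of the coordinates
`x ∈ φ.target`. -/
def comp (φ : OpenPartialHomeomorph M (Euc m)) (u : VField m M) (l : Fin m) (x : Euc m) : ℝ :=
  let y : Euc m := mfderiv 𝓘(ℝ, Euc m) 𝓘(ℝ, Euc m) φ (φ.symm x) (u (φ.symm x))
  y l

/-- The coordinate vector field `∂_j` of the chart `φ`, at the point with coordinates `x`. -/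
def coordVec (φ : OpenPartialHomeomorph M (Euc m)) (j : Fin m) (x : Euc m) :
    TangentSpace 𝓘(ℝ, Euc m) (φ.symm x) :=
  mfderiv 𝓘(ℝ, Euc m) 𝓘(ℝ, Euc m) φ.symm x (EuclideanSpace.single j (1 : ℝ) : Euc m)

/-- The property `P` holds at almost every point of `S ⊆ M`: in every smooth chart the exceptional
set is Lebesgue null. -/
def AEOn (m : ℕ) {M : Type*} [TopologicalSpace M] [ChartedSpace (Euc m) M]
    (S : Set M) (P : M → Prop) : Prop :=
  ∀ φ ∈ smoothCharts m M, ∀ᵐ x ∂(volume : Measure (Euc m)),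
    x ∈ φ.target → φ.symm x ∈ S → P (φ.symm x)

/-- `Ω` is a Lipschitz domain: open, connected, and near each boundary point there are
smooth coordinates in which `Ω` is the part above the graph of a Lipschitz function `h` of the
variables orthogonal to a direction `e` (so that the boundary is the graph of `h`). -/
def IsLipschitzDomain (m : ℕ) {M : Type*} [TopologicalSpace M] [ChartedSpace (Euc m) M]
    (Ω : Set M) : Prop :=
  IsOpen Ω ∧ IsConnected Ω ∧ ∀ p ∈ frontier Ω, ∃ φ ∈ smoothCharts m M, ∃ V : Set M,
    IsOpen V ∧ p ∈ V ∧ V ⊆ φ.source ∧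
    ∃ (e : Euc m) (h : Euc m → ℝ) (K : ℝ≥0), ‖e‖ = 1 ∧ LipschitzWith K h ∧
      (∀ (x : Euc m) (t : ℝ), h (x + t • e) = h x) ∧
      ∀ q ∈ V, (q ∈ Ω ↔ h (φ q) < inner ℝ (φ q) e)

/-! ### The Levi-Civita connection -/

section Metric

variable [IsManifold 𝓘(ℝ, Euc m) ∞ M]

/-- Smooth Riemannian metrics on `M`. -/
abbrev RMetric (m : ℕ) (M : Type*) [TopologicalSpace M] [ChartedSpace (Euc m) M]
    [IsManifold 𝓘(ℝ, Euc m) ∞ M] : Type _ :=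
  Bundle.ContMDiffRiemannianMetric 𝓘(ℝ, Euc m) ∞ (Euc m)
    (fun p : M ↦ TangentSpace 𝓘(ℝ, Euc m) p)

/-- The matrix `(g_{jk})` of the metric in the chart `φ`. -/
def gMat (g : RMetric m M) (φ : OpenPartialHomeomorph M (Euc m)) (x : Euc m) :
    Matrix (Fin m) (Fin m) ℝ :=
  Matrix.of fun j k ↦ g.inner (φ.symm x) (coordVec φ j x) (coordVec φ k x)

/-- `∂_i g_{jk}` in the chart `φ`. -/
def dg (g : RMetric m M) (φ : OpenPartialHomeomorph M (Euc m)) (i j k : Fin m) (x : Euc m) : ℝ :=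
  fderiv ℝ (fun y ↦ gMat g φ y j k) x (EuclideanSpace.single i 1)

/-- The Christoffel symbol of the second kind
`Γ^k_{lj} = ½ g^{kr} (∂_j g_{rl} + ∂_l g_{rj} - ∂_r g_{lj})` in the chart `φ`. -/
def christoffel (g : RMetric m M) (φ : OpenPartialHomeomorph M (Euc m)) (k l j : Fin m)
    (x : Euc m) : ℝ :=
  (1 / 2) * ∑ r, (gMat g φ x)⁻¹ k r * (dg g φ j r l x + dg g φ l r j x - dg g φ r l j x)

/-- `F = ∇_v w` in `Ω`, where `∇` is the Levi-Civita connection of `g`: in every smooth chart, `w`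
has weak partial derivatives `D j l = ∂_j w^l` in the part of the chart that lies in `Ω`, and
`F^l = v^j ∂_j w^l + Γ^l_{rj} w^r v^j` almost everywhere there. -/
def IsCovDeriv (g : RMetric m M) (Ω : Set M) (v w F : VField m M) : Prop :=
  ∀ φ ∈ smoothCharts m M, ∃ D : Fin m → Fin m → Euc m → ℝ,
    (∀ j l, HasWeakPartial (φ.target ∩ φ.symm ⁻¹' Ω) j (comp φ w l) (D j l)) ∧
    ∀ᵐ x ∂(volume : Measure (Euc m)), x ∈ φ.target ∩ φ.symm ⁻¹' Ω → ∀ l,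
      comp φ F l x = ∑ j, comp φ v j x * D j l x
        + ∑ r, ∑ j, christoffel g φ l r j x * comp φ w r x * comp φ v j x

/-- The pointwise length `|u|` of a vector field. -/
def len (g : RMetric m M) (u : VField m M) (p : M) : ℝ := √(g.inner p (u p) (u p))

open Classical in
/-- Extension by zero from `Ω` to `M`. -/
def zeroExt (Ω : Set M) (u : VField m M) : VField m M := fun p ↦ if p ∈ Ω then u p else 0

/-- `Y` is the zero extension of `k |v| v + β ∇_v v` from `Ω` to `M`. As `∇_v v` is determined up
to null sets, so is `Y`. -/
def IsNonlinearOp (g : RMetric m M) (k β : ℝ) (Ω : Set M) (v Y : VField m M) : Prop :=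
  ∃ F : VField m M, IsCovDeriv g Ω v v F ∧
    Y = zeroExt Ω (fun p ↦ (k * len g v p) • v p + β • F p)

end Metric

/-! ### Sobolev spaces of vector fields on `M` and in `Ω` -/

/-- A finite family of smooth charts that cover `M`, with a subordinate smooth partition of unity:
the data in the definition of the Sobolev norms. -/
structure NormData (m : ℕ) (M : Type*) [TopologicalSpace M] [ChartedSpace (Euc m) M] where
  N : ℕ
  chart : Fin N → OpenPartialHomeomorph M (Euc m)
  chart_mem : ∀ i, chart i ∈ smoothCharts m M
  χ : SmoothPartitionOfUnity (Fin N) 𝓘(ℝ, Euc m) M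
  subordinate : χ.IsSubordinate fun i ↦ (chart i).source

open Classical in
/-- The component `l` of `χ_i u` in the chart `i`, extended by zero to `ℝᵐ`. -/
def localRep (A : NormData m M) (u : VField m M) (i : Fin A.N) (l : Fin m) (x : Euc m) : ℂ :=
  if x ∈ (A.chart i).target then
    ((A.χ i ((A.chart i).symm x) * comp (A.chart i) u l x : ℝ) : ℂ) else 0

/-- The integrable vector field `u`, regarded as a distribution, belongs to `H^σ(M, Λ¹TM)`,
`σ ∈ ℝ`. -/
def MemH (A : NormData m M) (σ : ℝ) (u : VField m M) : Prop :=
  ∀ i l, MemHs σ (localRep A u i l)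

/-- The norm of `H^σ(M, Λ¹TM)`. -/
def normH (A : NormData m M) (σ : ℝ) (u : VField m M) : ℝ≥0∞ :=
  ∑ i, ∑ l, hsNorm σ (localRep A u i l)

/-- `u` belongs to `H^σ(Ω, Λ¹TM)`, the space of restrictions to `Ω` of elements of
`H^σ(M, Λ¹TM)` (used for `σ ≥ 0` only). Values of `u` outside `Ω` do not matter. -/
def MemHDom (A : NormData m M) (σ : ℝ) (Ω : Set M) (u : VField m M) : Prop :=
  ∃ U : VField m M, MemH A σ U ∧ AEOn m Ω fun p ↦ U p = u p

/-- The (quotient) norm of `H^σ(Ω, Λ¹TM)`: the infimum of the norms of all extensions. -/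
def normHDom (A : NormData m M) (σ : ℝ) (Ω : Set M) (u : VField m M) : ℝ≥0∞ :=
  ⨅ (U : VField m M) (_ : MemH A σ U ∧ AEOn m Ω fun p ↦ U p = u p), normH A σ U

/-- `u` belongs to `H̃^σ(Ω, Λ¹TM)`: it is in `H^σ(M, Λ¹TM)` and supported in the closure of `Ω`.
The norm of this space is the one of `H^σ(M, Λ¹TM)`. -/
def MemHTilde (A : NormData m M) (σ : ℝ) (Ω : Set M) (u : VField m M) : Prop :=
  MemH A σ u ∧ AEOn m (closure Ω)ᶜ fun p ↦ u p = 0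

end Manifold

end SobolevField

end

open SobolevField

/-!
Every `s ∈ [1/2, 1)` satisfies `s + 1/2 ≥ 1` and `s - 3/2 ≤ -1/2`, so only two embeddings are
needed, with constants that do not depend on the orders: for `σ ≥ 1` the components of a field of
class `H^σ` are in `L⁶` and have weak derivatives in `L²` (`exists_sobolev_bounds`), and for
`τ ≤ -1/2` an integrable function in `L^{3/2}` is in `H^τ` (`exists_hsNorm_le_eLpNorm`). This is
where the restriction to dimensions two and three enters. Hölder's inequality
`L⁶ · L² ⊂ L^{3/2}` on the compact supports of the partition of unity does the rest: the
nonlinearity is quadratic in `u` and its first derivatives, with at most one derivative in each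
term, and `|a| a - |b| b` is bounded by `(|a| + |b|) |a - b|` (`exists_abs_nonlin_sub_le`).

Both embeddings come from one inequality, `exists_eLpNorm_le_of_fourier_decay`: if
`|𝓕 f| ≤ ⟨ξ⟩^{-σ} |H|` with `H ∈ L²`, then `f ∈ L^q`. It follows by cutting `𝓕 f` at a frequency
that depends on the level `t` in the layer-cake formula for `‖f‖_q`: the low frequencies are at
most `t / 2` in the supremum norm, and the high ones are controlled in `L²` by Chebyshev's
inequality. The case `σ = 1`, `q = 6` is the first embedding; the case `σ = 1/2`, `q = 3` gives the
second one by duality.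

The norm data know the components only after localization and in the charts of a fixed atlas,
whereas the nonlinear operator refers to all smooth charts. The chain rule for weak derivatives
(`HasWeakPartial.comp_diffeo`) and the partition of unity carry the bounds over to every chart
(`exists_comp_bounds`). That `∇_u u` exists as a vector field (`exists_isCovDeriv`) amounts to the
transformation law of the Christoffel symbols (`christoffelVec_trans`), which is derived from the
Koszul formula and from the transformation law of the metric.

Finally, `v`, `w` and `v - w` may be extended to `M` independently of each other, since the weak
derivatives of all extensions agree almost everywhere on `Ω` (`AEOn.weakPartial_eq`). Hence the
estimate passes to the infimum over the extensions, that is, to the quotient norms. The quadratic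
bound is the Lipschitz bound with `w = 0`.
-/

noncomputable section

namespace SobolevField

open Set Metric
open scoped Topology

/-! ### Fourier transforms of square integrable functions -/

section Fourier
open FourierTransform
variable {E : Type*} [NormedAddCommGroup E] [InnerProductSpace ℝ E] [FiniteDimensional ℝ E]
  [MeasurableSpace E] [BorelSpace E]

/-- On `L¹ ∩ L²`, the inverse Fourier transform of `L²` is given by the integral. -/
theorem fourierInv_Lp_two_ae_eq (g : Lp ℂ 2 (volume : Measure E)) (hg : Integrable g) :
    (𝓕⁻ g : Lp ℂ 2 (volume : Measure E)) =ᵐ[volume] 𝓕⁻ (g : E → ℂ) := by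
  have hcont : Continuous (𝓕⁻ (g : E → ℂ)) :=
    VectorFourier.fourierIntegral_continuous Real.continuous_fourierChar
      (L := -innerₗ E) ((continuous_inner (𝕜 := ℝ) (E := E)).neg) hg
  refine ae_eq_of_integral_contDiff_smul_eq
    ((Lp.memLp _).locallyIntegrable (by norm_num)) hcont.locallyIntegrable ?_
  intro φ hφ hφc
  have hg₁ : HasCompactSupport (Complex.ofRealCLM ∘ φ) := hφc.comp_left rfl
  have hg₂ : ContDiff ℝ ∞ (Complex.ofRealCLM ∘ φ) := by fun_prop
  set ψ : 𝓢(E, ℂ) := hg₁.toSchwartzMap hg₂ with hψ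
  have h1 := congrArg (fun T : 𝓢'(E, ℂ) ↦ T ψ) (Lp.fourierInv_toTemperedDistribution_eq g)
  simp only [fourierInv_apply, Lp.toTemperedDistribution_apply] at h1
  have h2 : ∫ x, 𝓕⁻ (g : E → ℂ) x • ψ x = ∫ x, g x • (𝓕⁻ (ψ : E → ℂ)) x := by
    have := VectorFourier.integral_fourierIntegral_smul_eq_flip (μ := (volume : Measure E))
      (ν := (volume : Measure E)) (L := -innerₗ E) Real.continuous_fourierChar
      ((continuous_inner (𝕜 := ℝ) (E := E)).neg) hg ψ.integrable
    refine this.trans ?_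
    congr 1; ext x; congr 2
    ext a b; simp [real_inner_comm]
  have h3 : ∀ x, φ x • (𝓕⁻ g : Lp ℂ 2 (volume : Measure E)) x
      = ψ x • (𝓕⁻ g : Lp ℂ 2 (volume : Measure E)) x := by
    intro x; simp [hψ]
  have h4 : ∀ x, φ x • (𝓕⁻ (g : E → ℂ)) x = (𝓕⁻ (g : E → ℂ)) x • ψ x := by
    intro x; simp [hψ, mul_comm]
  simp only [h3, h4]
  rw [← h1, h2, SchwartzMap.fourierInv_coe]
  congr 1; ext x; simp [mul_comm]

theorem enorm_fourierInv_Lp_two_le (g : Lp ℂ 2 (volume : Measure E)) (hg : Integrable g) :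
    ∀ᵐ x, ‖(𝓕⁻ g : Lp ℂ 2 (volume : Measure E)) x‖ₑ ≤ ∫⁻ ξ, ‖g ξ‖ₑ := by
  filter_upwards [fourierInv_Lp_two_ae_eq g hg] with x hx
  rw [hx]
  refine (enorm_integral_le_lintegral_enorm _).trans_eq ?_
  congr 1; ext ξ; simp [← ofReal_norm, Circle.norm_smul]

/-- The integral of `‖ξ‖^{j - d}`, `d` the dimension, over a ball of radius `A` scales like `A^j`. -/
theorem lintegral_ball_le_of_homogeneous {d j : ℝ} (hd : d = Module.finrank ℝ E)
    (hE : 1 ≤ Module.finrank ℝ E) (hj : 0 < j) :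
    ∃ C : ℝ, 0 < C ∧ ∀ A : ℝ, 0 < A →
      ∫⁻ ξ in ball (0 : E) A, ENNReal.ofReal (‖ξ‖ ^ (j - d)) ≤ ENNReal.ofReal (C * A ^ j) := by
  have hint : IntegrableOn (fun ξ : E ↦ ‖ξ‖ ^ (j - d)) (ball 0 1) := by
    refine integrableOn_ball_of_norm_le_rpow hE (C := 1) (α := d - j) (by linarith) ?_ ?_
    · filter_upwards with x
      rw [Real.norm_of_nonneg (by positivity)]; simp
    · exact (measurable_norm.pow_const _).aestronglyMeasurable
  set I := ∫ ξ in ball (0 : E) 1, ‖ξ‖ ^ (j - d) with hI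
  have hI0 : 0 ≤ I := integral_nonneg fun _ ↦ by positivity
  have hI' : ∫⁻ ξ in ball (0 : E) 1, ENNReal.ofReal (‖ξ‖ ^ (j - d)) = ENNReal.ofReal I := by
    rw [hI, ofReal_integral_eq_lintegral_ofReal hint]
    exact ae_of_all _ fun _ ↦ by positivity
  -- `I + 1` rather than `I`, for a positive constant
  refine ⟨I + 1, by positivity, fun A hA ↦ ?_⟩
  have key : ∫⁻ ξ in ball (0 : E) A, ENNReal.ofReal (‖ξ‖ ^ (j - d))
      = ENNReal.ofReal (A ^ j) * ∫⁻ ξ in ball (0 : E) 1, ENNReal.ofReal (‖ξ‖ ^ (j - d)) := by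
    have hmap := Measure.map_addHaar_smul (volume : Measure E) (inv_ne_zero hA.ne')
    -- pull back along `ξ ↦ A⁻¹ ξ`
    have hm : Measurable fun ξ : E ↦ (ball (0 : E) 1).indicator
        (fun ξ ↦ ENNReal.ofReal (‖ξ‖ ^ (j - d))) ξ :=
      ((measurable_norm.pow_const _).ennreal_ofReal).indicator measurableSet_ball
    rw [← lintegral_indicator measurableSet_ball, ← lintegral_indicator measurableSet_ball]
    have h1 := lintegral_map (μ := (volume : Measure E)) hm (measurable_const_smul (A⁻¹ : ℝ))
    rw [hmap, lintegral_smul_measure] at h1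
    have h2 : ∀ ξ : E, (ball (0 : E) A).indicator (fun ξ ↦ ENNReal.ofReal (‖ξ‖ ^ (j - d))) ξ
        = ENNReal.ofReal (A ^ (j - d)) * (ball (0 : E) 1).indicator
          (fun ξ ↦ ENNReal.ofReal (‖ξ‖ ^ (j - d))) (A⁻¹ • ξ) := by
      intro ξ
      have : A⁻¹ • ξ ∈ ball (0 : E) 1 ↔ ξ ∈ ball (0 : E) A := by
        simp [norm_smul, abs_of_pos hA, inv_mul_lt_iff₀ hA]
      by_cases hx : ξ ∈ ball (0 : E) A
      · rw [indicator_of_mem hx, indicator_of_mem (this.2 hx), ← ENNReal.ofReal_mul (by positivity),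
          norm_smul, norm_inv, Real.norm_of_nonneg hA.le,
          Real.mul_rpow (by positivity) (by positivity), ← mul_assoc,
          ← Real.mul_rpow (by positivity) (by positivity), mul_inv_cancel₀ hA.ne']
        simp
      · rw [indicator_of_notMem hx, indicator_of_notMem (fun h ↦ hx (this.1 h))]; simp
    simp only [h2]
    rw [lintegral_const_mul' _ _ ENNReal.ofReal_ne_top, ← h1, smul_eq_mul, ← mul_assoc,
      ← ENNReal.ofReal_mul (by positivity)]
    congr 2
    rw [Real.rpow_sub hA, hd, Real.rpow_natCast]
    rw [abs_of_pos (by positivity)]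
    rw [inv_pow, inv_inv]
    field_simp
  rw [key, hI', ← ENNReal.ofReal_mul (by positivity)]
  apply ENNReal.ofReal_le_ofReal
  nlinarith [Real.rpow_pos_of_pos hA j]

/-- If `|𝓕 f| ≤ ⟨ξ⟩^{-σ} |H|` with `H ∈ L²`, then `f ∈ L^q`. In the layer-cake formula for
`∫ |f|^q`, the frequencies of `f` are cut at the radius `A(t)` for which Cauchy-Schwarz and the
assumption `hB` bound the part of frequency less than `A(t)` by `t / 2`. The part of frequency at
least `A(t)` is estimated by Chebyshev's inequality and Plancherel's theorem, and integrating over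
`t` first turns the resulting double integral into `∫ |ξ|^{2σ} |𝓕 f|²`, up to a constant. -/
theorem lintegral_rpow_le_of_fourier_decay {q σ j : ℝ} (hq : 3 ≤ q) (hj : j * q = 6)
    (hσ : 2 * σ = 3 - j) {C : ℝ} (hC : 0 < C)
    (hB : ∀ A : ℝ, 0 < A → ∫⁻ ξ in ball (0 : E) A, ENNReal.ofReal ((1 + ‖ξ‖ ^ 2) ^ (-σ))
      ≤ ENNReal.ofReal (C * A ^ j))
    (f H : Lp ℂ 2 (volume : Measure E))
    (hfH : ∀ᵐ ξ, ‖(𝓕 f : Lp ℂ 2 (volume : Measure E)) ξ‖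
      ≤ (1 + ‖ξ‖ ^ 2) ^ (-σ / 2) * ‖H ξ‖) :
    ∫⁻ x, ENNReal.ofReal (‖f x‖ ^ q) ≤
      ENNReal.ofReal (4 * q * (2 * √C) ^ (q - 2) * ‖H‖ ^ q) := by
  have hj0 : 0 < j := by
    by_contra h
    nlinarith
  set F : Lp ℂ 2 (volume : Measure E) := 𝓕 f with hF
  have hfF : f = 𝓕⁻ F := by rw [hF]; exact (FourierTransform.fourierInv_fourier_eq f).symm
  have hnorm2 : ∀ g : Lp ℂ 2 (volume : Measure E), ∫⁻ x, ‖g x‖ₑ ^ 2 = ENNReal.ofReal (‖g‖ ^ 2) := by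
    intro g
    rw [ENNReal.ofReal_pow (norm_nonneg _), ofReal_norm, Lp.enorm_def]
    rw [eLpNorm_eq_lintegral_rpow_enorm_toReal (by norm_num) (by norm_num)]
    rw [← ENNReal.rpow_natCast, ← ENNReal.rpow_mul]
    norm_num
  rcases (norm_nonneg H).eq_or_lt with hN | hN
  · have hH0 : H = 0 := norm_eq_zero.1 hN.symm
    have : F = 0 := by
      rw [Lp.eq_zero_iff_ae_eq_zero]
      filter_upwards [hfH, Lp.eq_zero_iff_ae_eq_zero.1 hH0] with ξ h1 h2
      simpa [h2] using h1
    have hf0 : f = 0 := by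
      rw [hfF, this]; exact (FourierTransform.fourierInv_zero (E := Lp ℂ 2 (volume : Measure E)))
    have : ∀ᵐ x, ENNReal.ofReal (‖f x‖ ^ q) = 0 := by
      filter_upwards [Lp.eq_zero_iff_ae_eq_zero.1 hf0] with x hx
      simp [hx, Real.zero_rpow (by linarith : q ≠ 0)]
    rw [lintegral_congr_ae this]; simp
  set N := ‖H‖ with hNdef
  -- the cut is at the radius `(κ t) ^ (q / 3)`, where `√C * A ^ (j / 2) * N = t / 2`
  set κ : ℝ := (2 * √C * N)⁻¹ with hκ
  have hsC : 0 < √C := Real.sqrt_pos.2 hC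
  have hκ0 : 0 < κ := by positivity
  have dist : ∀ t : ℝ, 0 < t → volume {x | t < ‖f x‖} ≤ ENNReal.ofReal (4 * t ^ (-2 : ℝ)) *
      ∫⁻ ξ, (ball (0 : E) ((κ * t) ^ (q / 3)))ᶜ.indicator (fun ξ ↦ ‖F ξ‖ₑ ^ 2) ξ := by
    intro t ht
    set A := (κ * t) ^ (q / 3) with hA
    have hA0 : 0 < A := by positivity
    have hS : MeasurableSet (ball (0 : E) A) := measurableSet_ball
    have m1 : MemLp ((ball (0 : E) A).indicator F) 2 := (Lp.memLp F).indicator hS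
    have m2 : MemLp ((ball (0 : E) A)ᶜ.indicator F) 2 := (Lp.memLp F).indicator hS.compl
    set F1 := m1.toLp
    set F2 := m2.toLp
    have hsum : F = F1 + F2 := by
      rw [← MemLp.toLp_add]
      rw [Lp.ext_iff]
      refine Filter.EventuallyEq.trans ?_ (MemLp.coeFn_toLp _).symm
      rw [indicator_self_add_compl]
    -- Cauchy-Schwarz for `⟨ξ⟩^{-σ} |H|` on the ball
    have hlow : ∫⁻ ξ, ‖F1 ξ‖ₑ ≤ ENNReal.ofReal (t / 2) := by
      have e1 : ∫⁻ ξ, ‖F1 ξ‖ₑ = ∫⁻ ξ in ball (0 : E) A, ‖F ξ‖ₑ := by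
        rw [← lintegral_indicator hS]
        refine lintegral_congr_ae ?_
        filter_upwards [m1.coeFn_toLp] with ξ h
        rw [h, enorm_indicator_eq_indicator_enorm]
      have e2 : ∫⁻ ξ in ball (0 : E) A, ‖F ξ‖ₑ ≤
          ∫⁻ ξ in ball (0 : E) A, ENNReal.ofReal ((1 + ‖ξ‖ ^ 2) ^ (-σ / 2)) * ‖H ξ‖ₑ := by
        refine lintegral_mono_ae (ae_restrict_of_ae ?_)
        filter_upwards [hfH] with ξ h
        rw [← ofReal_norm, ← ofReal_norm, ← ENNReal.ofReal_mul (by positivity)]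
        exact ENNReal.ofReal_le_ofReal h
      have e3 := ENNReal.lintegral_mul_le_Lp_mul_Lq (volume.restrict (ball (0 : E) A))
        Real.HolderConjugate.two_two
        (f := fun ξ : E ↦ ENNReal.ofReal ((1 + ‖ξ‖ ^ 2) ^ (-σ / 2))) (g := fun ξ ↦ ‖H ξ‖ₑ)
        (by fun_prop) (Lp.aestronglyMeasurable H).enorm.restrict
      have e4 : ∫⁻ ξ in ball (0 : E) A, (ENNReal.ofReal ((1 + ‖ξ‖ ^ 2) ^ (-σ / 2))) ^ (2 : ℝ)
          ≤ ENNReal.ofReal (C * A ^ j) := by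
        refine le_of_eq_of_le ?_ (hB A hA0)
        congr 1; ext ξ
        rw [ENNReal.ofReal_rpow_of_nonneg (by positivity) (by norm_num),
          ← Real.rpow_mul (by positivity)]
        congr 2; ring
      have e5 : ∫⁻ ξ in ball (0 : E) A, ‖H ξ‖ₑ ^ (2 : ℝ) ≤ ENNReal.ofReal (N ^ 2) := by
        rw [← hnorm2 H]
        refine (lintegral_mono' Measure.restrict_le_self le_rfl).trans_eq ?_
        simp
      refine e1.trans_le (e2.trans (e3.trans ?_))
      refine (mul_le_mul' (ENNReal.rpow_le_rpow e4 (by norm_num))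
        (ENNReal.rpow_le_rpow e5 (by norm_num))).trans ?_
      rw [ENNReal.ofReal_rpow_of_nonneg (by positivity) (by norm_num),
        ENNReal.ofReal_rpow_of_nonneg (by positivity) (by norm_num),
        ← ENNReal.ofReal_mul (by positivity)]
      apply ENNReal.ofReal_le_ofReal
      rw [← Real.sqrt_eq_rpow, ← Real.sqrt_eq_rpow, Real.sqrt_sq hN.le, Real.sqrt_mul hC.le]
      have : √(A ^ j) = κ * t := by
        rw [hA, ← Real.rpow_mul (by positivity), show q / 3 * j = 2 by linarith]
        simpa using Real.sqrt_sq (by positivity : 0 ≤ κ * t)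
      rw [this, hκ]
      apply le_of_eq
      field_simp
    have hF1int : Integrable F1 :=
      ⟨Lp.aestronglyMeasurable _, hlow.trans_lt ENNReal.ofReal_lt_top⟩
    have hsub : ∀ᵐ x, t < ‖f x‖ → t / 2 < ‖(𝓕⁻ F2 : Lp ℂ 2 (volume : Measure E)) x‖ := by
      have hf12 : f = 𝓕⁻ F1 + 𝓕⁻ F2 := by
        rw [hfF, hsum]; exact FourierTransform.fourierInv_add _ _
      filter_upwards [enorm_fourierInv_Lp_two_le F1 hF1int, Lp.coeFn_add (𝓕⁻ F1) (𝓕⁻ F2)]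
        with x h1 h2 h3
      rw [hf12, h2] at h3
      have h4 := h1.trans hlow
      rw [← ofReal_norm, ENNReal.ofReal_le_ofReal_iff (by positivity)] at h4
      have := norm_add_le ((𝓕⁻ F1 : Lp ℂ 2 (volume : Measure E)) x)
        ((𝓕⁻ F2 : Lp ℂ 2 (volume : Measure E)) x)
      simp only [Pi.add_apply] at h3
      linarith
    have hch : volume {x | t < ‖f x‖} ≤
        volume {x | ENNReal.ofReal ((t / 2) ^ 2) ≤ ‖(𝓕⁻ F2 : Lp ℂ 2 (volume : Measure E)) x‖ₑ ^ 2} := by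
      apply measure_mono_ae
      filter_upwards [hsub] with x hx h
      have := hx h
      change ENNReal.ofReal ((t / 2) ^ 2) ≤ _
      rw [← ofReal_norm, ENNReal.ofReal_pow (by positivity)]
      gcongr
    refine hch.trans ((meas_ge_le_lintegral_div
      ((Lp.aestronglyMeasurable _).enorm.pow_const 2) ?_ ENNReal.ofReal_ne_top).trans ?_)
    · simp only [ne_eq, ENNReal.ofReal_eq_zero, not_le]; positivity
    · rw [hnorm2, show ‖(𝓕⁻ F2 : Lp ℂ 2 (volume : Measure E))‖ = ‖F2‖ from
        (Lp.fourierTransformₗᵢ E ℂ).symm.norm_map F2, ← hnorm2, ENNReal.div_eq_inv_mul,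
        ← ENNReal.ofReal_inv_of_pos (by positivity)]
      refine mul_le_mul' (ENNReal.ofReal_le_ofReal ?_) ?_
      · apply le_of_eq; rw [Real.rpow_neg ht.le]; norm_num; field_simp; norm_num
      · apply le_of_eq
        refine lintegral_congr_ae ?_
        filter_upwards [m2.coeFn_toLp] with ξ h
        rw [h]
        by_cases hx : ξ ∈ (ball (0 : E) A)ᶜ
        · simp only [indicator_of_mem hx]
        · simp only [indicator_of_notMem hx]; simp
  rw [lintegral_rpow_eq_lintegral_meas_lt_mul volume (ae_of_all _ fun _ ↦ norm_nonneg _)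
    (Lp.aestronglyMeasurable f).norm.aemeasurable (by linarith)]
  have step : ∫⁻ t in Ioi (0 : ℝ), volume {a | t < ‖f a‖} * ENNReal.ofReal (t ^ (q - 1)) ≤
      ∫⁻ t in Ioi (0 : ℝ), ∫⁻ ξ, (if (κ * t) ^ (q / 3) ≤ ‖ξ‖ then
        ENNReal.ofReal (4 * t ^ (q - 3)) * ‖F ξ‖ₑ ^ 2 else 0) := by
    refine setLIntegral_mono' measurableSet_Ioi fun t (ht : 0 < t) ↦ ?_
    refine (mul_le_mul_left (dist t ht) _).trans_eq ?_
    rw [mul_right_comm, ← ENNReal.ofReal_mul (by positivity), mul_assoc 4,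
      ← Real.rpow_add ht, show (-2 : ℝ) + (q - 1) = q - 3 by ring,
      ← lintegral_const_mul' _ _ ENNReal.ofReal_ne_top]
    congr 1; ext ξ
    by_cases hx : (κ * t) ^ (q / 3) ≤ ‖ξ‖
    · rw [if_pos hx, indicator_of_mem (by simpa using hx)]
    · rw [if_neg hx, indicator_of_notMem (by simpa using hx), mul_zero]
  refine (mul_le_mul_right step _).trans ?_
  rw [lintegral_lintegral_swap]
  · have inner_le : ∀ᵐ ξ, ∫⁻ t in Ioi (0 : ℝ), (if (κ * t) ^ (q / 3) ≤ ‖ξ‖ then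
        ENNReal.ofReal (4 * t ^ (q - 3)) * ‖F ξ‖ₑ ^ 2 else 0) ≤
        ENNReal.ofReal (4 * κ⁻¹ ^ (q - 2)) * ‖H ξ‖ₑ ^ 2 := by
      filter_upwards [hfH] with ξ hξ
      set T : ℝ := κ⁻¹ * ‖ξ‖ ^ (3 / q) with hT
      have hT0 : 0 ≤ T := by positivity
      calc _ ≤ ∫⁻ t in Ioi (0 : ℝ), (Ioc (0 : ℝ) T).indicator
              (fun _ ↦ ENNReal.ofReal (4 * T ^ (q - 3)) * ‖F ξ‖ₑ ^ 2) t := by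
            refine setLIntegral_mono' measurableSet_Ioi fun t (ht : 0 < t) ↦ ?_
            split_ifs with h
            · have htT : t ≤ T := by
                have : κ * t ≤ ‖ξ‖ ^ (3 / q) := by
                  rw [show κ * t = ((κ * t) ^ (q / 3)) ^ (3 / q) by
                    rw [← Real.rpow_mul (by positivity)]
                    rw [show q / 3 * (3 / q) = 1 by field_simp, Real.rpow_one]]
                  exact Real.rpow_le_rpow (by positivity) h (by positivity)
                rw [hT, ← div_eq_inv_mul, le_div_iff₀ hκ0]; linarith
              rw [indicator_of_mem (show t ∈ Ioc 0 T from ⟨ht, htT⟩)]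
              gcongr
            · exact zero_le
        _ ≤ ENNReal.ofReal (4 * T ^ (q - 3)) * ‖F ξ‖ₑ ^ 2 * ENNReal.ofReal T := by
            refine (lintegral_mono' Measure.restrict_le_self le_rfl).trans ?_
            rw [lintegral_indicator measurableSet_Ioc]
            simp
        _ = ENNReal.ofReal (4 * T ^ (q - 2)) * ‖F ξ‖ₑ ^ 2 := by
            rw [mul_right_comm, ← ENNReal.ofReal_mul (by positivity), mul_assoc 4]
            congr 3
            rcases hT0.eq_or_lt with h0 | h0
            · rw [← h0, mul_zero, Real.zero_rpow (by linarith)]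
            · rw [show q - 2 = (q - 3) + 1 by ring, Real.rpow_add_one h0.ne']
        _ ≤ _ := by
            rw [← ofReal_norm, ← ofReal_norm, ← ENNReal.ofReal_pow (norm_nonneg _),
              ← ENNReal.ofReal_pow (norm_nonneg _), ← ENNReal.ofReal_mul (by positivity),
              ← ENNReal.ofReal_mul (by positivity)]
            apply ENNReal.ofReal_le_ofReal
            rw [hT, Real.mul_rpow (by positivity) (by positivity), ← Real.rpow_mul (by positivity)]
            have e : 3 / q * (q - 2) = 2 * σ := by
              have : j = 6 / q := by field_simp; linarith
              rw [hσ, this]; field_simp; ring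
            rw [e]
            have h1 : ‖ξ‖ ^ (2 * σ) * ‖F ξ‖ ^ 2 ≤ ‖H ξ‖ ^ 2 := by
              have hσ0 : 0 ≤ σ := by
                have : j ≤ 2 := by nlinarith
                linarith
              have h2 : ‖ξ‖ ^ (2 * σ) ≤ (1 + ‖ξ‖ ^ 2) ^ σ := by
                rw [Real.rpow_mul (norm_nonneg _)]
                refine Real.rpow_le_rpow (by positivity) ?_ hσ0
                rw [Real.rpow_two]; linarith
              calc ‖ξ‖ ^ (2 * σ) * ‖F ξ‖ ^ 2
                  ≤ (1 + ‖ξ‖ ^ 2) ^ σ * ((1 + ‖ξ‖ ^ 2) ^ (-σ / 2) * ‖H ξ‖) ^ 2 := by gcongr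
                _ = ‖H ξ‖ ^ 2 := by
                  rw [mul_pow, ← mul_assoc, ← Real.rpow_mul_natCast (by positivity),
                    ← Real.rpow_add (by positivity)]
                  norm_num
            calc _ = 4 * κ⁻¹ ^ (q - 2) * (‖ξ‖ ^ (2 * σ) * ‖F ξ‖ ^ 2) := by ring
              _ ≤ _ := by gcongr
    refine (mul_le_mul_right (lintegral_mono_ae inner_le) _).trans ?_
    rw [lintegral_const_mul' _ _ ENNReal.ofReal_ne_top, hnorm2,
      ← ENNReal.ofReal_mul (by positivity), ← ENNReal.ofReal_mul (by positivity)]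
    apply ENNReal.ofReal_le_ofReal
    apply le_of_eq
    rw [hκ, inv_inv, Real.mul_rpow (by positivity) hN.le,
      show N ^ q = N ^ (q - 2) * N ^ 2 by
        rw [← Real.rpow_natCast, ← Real.rpow_add hN]; norm_num]
    ring
  · have hS : MeasurableSet {p : ℝ × E | (κ * p.1) ^ (q / 3) ≤ ‖p.2‖} :=
      measurableSet_le (by fun_prop) (by fun_prop)
    refine AEMeasurable.congr (f := {p : ℝ × E | (κ * p.1) ^ (q / 3) ≤ ‖p.2‖}.indicator
      fun p ↦ ENNReal.ofReal (4 * p.1 ^ (q - 3)) * ‖F p.2‖ₑ ^ 2) (AEMeasurable.indicator ?_ hS)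
      (ae_of_all _ fun p ↦ rfl)
    refine AEMeasurable.mul (f := fun p : ℝ × E ↦ ENNReal.ofReal (4 * p.1 ^ (q - 3)))
      (by fun_prop) ?_
    exact ((Lp.aestronglyMeasurable F).enorm.pow_const 2).comp_quasiMeasurePreserving
      Measure.quasiMeasurePreserving_snd

end Fourier

/-! ### Sobolev embeddings on Euclidean space -/

theorem norm_ofReal_one_add_norm_sq_rpow_le_one {E : Type*} [NormedAddCommGroup E] {r : ℝ}
    (hr : r ≤ 0) (x : E) : ‖(((1 + ‖x‖ ^ 2) ^ r : ℝ) : ℂ)‖ ≤ 1 := by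
  rw [Complex.norm_real, Real.norm_of_nonneg (by positivity)]
  exact Real.rpow_le_one_of_one_le_of_nonpos (by simp) hr

section Fourier
open FourierTransform
variable {E : Type*} [NormedAddCommGroup E] [InnerProductSpace ℝ E] [FiniteDimensional ℝ E]
  [MeasurableSpace E] [BorelSpace E]

/-- A tempered distribution that is bounded for the norm of `L²` is a function in `L²`: its extension
to `L²` is represented by the Riesz theorem. The bilinear pairing of distributions differs from the
inner product by a conjugation, whence the `star` in the proof. -/
theorem exists_Lp_two_of_bound (T : 𝓢'(E, ℂ)) {C : ℝ} (hC : 0 ≤ C)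
    (hT : ∀ φ : 𝓢(E, ℂ), ‖T φ‖ ≤ C * ‖φ.toLp 2‖) :
    ∃ h : Lp ℂ 2 (volume : Measure E), T = h ∧ ‖h‖ ≤ C := by
  have hd := SchwartzMap.denseRange_toLpCLM (E := E) (F := ℂ) (μ := (volume : Measure E))
    (p := 2) ENNReal.ofNat_ne_top
  obtain ⟨e, he⟩ : ∃ e : 𝓢(E, ℂ) →ₗ[ℂ] Lp ℂ 2 (volume : Measure E), ∀ φ, e φ = φ.toLp 2 :=
    ⟨(SchwartzMap.toLpCLM ℂ ℂ 2 (volume : Measure E)).toLinearMap, fun _ ↦ rfl⟩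
  obtain ⟨T', hTT'⟩ : ∃ T' : 𝓢(E, ℂ) →ₗ[ℂ] ℂ, ∀ φ, T' φ = T φ :=
    ⟨{ toFun := T, map_add' := T.map_add, map_smul' := T.map_smul }, fun _ ↦ rfl⟩
  have hd' : DenseRange e := by
    convert! hd using 1
    funext φ
    exact he φ
  have hT' : ∀ φ, ‖T' φ‖ ≤ C * ‖e φ‖ := fun φ ↦ by rw [he, hTT']; exact hT φ
  obtain ⟨L, hL1, hL2⟩ : ∃ L : Lp ℂ 2 (volume : Measure E) →L[ℂ] ℂ, ‖L‖ ≤ C ∧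
      ∀ φ, L (e φ) = T' φ :=
    ⟨T'.extendOfNorm e, LinearMap.opNorm_extendOfNorm_le hd' hC hT',
      fun φ ↦ LinearMap.extendOfNorm_eq hd' ⟨C, hT'⟩ φ⟩
  set g := (InnerProductSpace.toDual ℂ (Lp ℂ 2 (volume : Measure E))).symm L with hg
  have hgn : ‖g‖ ≤ C := by
    rw [hg, LinearIsometryEquiv.norm_map]
    exact hL1
  refine ⟨star g, ?_, ?_⟩
  · ext φ
    have h1 : T φ = inner ℂ g (e φ) := by
      rw [hg, InnerProductSpace.toDual_symm_apply, hL2, hTT']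
    rw [h1, Lp.toTemperedDistribution_apply, L2.inner_def]
    refine integral_congr_ae ?_
    filter_upwards [Lp.coeFn_star g, SchwartzMap.coeFn_toLp φ 2 (volume : Measure E)] with x h2 h3
    rw [h2, he, h3]
    simp
  · refine le_trans (le_of_eq ?_) hgn
    rw [Lp.norm_def, Lp.norm_def]
    congr 1
    refine (eLpNorm_congr_ae (Lp.coeFn_star g)).trans ?_
    refine eLpNorm_congr_norm_ae (ae_of_all _ fun x ↦ ?_)
    simp

/-- A bounded Fourier multiplier acts on `L²`, consistently with its action on tempered
distributions. -/
theorem exists_fourierMultiplierCLM_Lp_two {a : E → ℂ} (ha : a.HasTemperateGrowth) {C : ℝ}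
    (hC : ∀ x, ‖a x‖ ≤ C) (h : Lp ℂ 2 (volume : Measure E)) :
    ∃ h' : Lp ℂ 2 (volume : Measure E), fourierMultiplierCLM ℂ a (h : 𝓢'(E, ℂ)) = h' ∧
      (∀ᵐ ξ, (𝓕 h' : Lp ℂ 2 (volume : Measure E)) ξ
        = a ξ * (𝓕 h : Lp ℂ 2 (volume : Measure E)) ξ) ∧ ‖h'‖ ≤ C * ‖h‖ := by
  set g' : BoundedContinuousFunction E ℂ :=
    BoundedContinuousFunction.ofNormedAddCommGroup a ha.1.continuous C hC
  have hm : MemLp a ⊤ (volume : Measure E) := g'.memLp_top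
  set F : Lp ℂ 2 (volume : Measure E) := hm.toLp _ • (𝓕 h : Lp ℂ 2 (volume : Measure E)) with hF
  have hFae : ∀ᵐ ξ, F ξ = a ξ * (𝓕 h : Lp ℂ 2 (volume : Measure E)) ξ := by
    filter_upwards [Lp.coeFn_lpSMul (r := 2) (hm.toLp _) (𝓕 h : Lp ℂ 2 (volume : Measure E)),
      hm.coeFn_toLp] with ξ h1 h2
    rw [hF, h1]
    simp [h2]
  refine ⟨𝓕⁻ F, ?_, ?_, ?_⟩
  · rw [TemperedDistribution.fourierMultiplierCLM_apply, Lp.fourier_toTemperedDistribution_eq,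
      ← Lp.toTemperedDistribution_smul_eq (q := 2) (r := 2) ha hm, Lp.fourierInv_toTemperedDistribution_eq]
  · rw [FourierTransform.fourier_fourierInv_eq F]
    exact hFae
  · have h1 : ‖(𝓕⁻ F : Lp ℂ 2 (volume : Measure E))‖ = ‖F‖ :=
      (Lp.fourierTransformₗᵢ E ℂ).symm.norm_map F
    rw [h1, ← Lp.norm_fourier_eq h]
    refine Lp.norm_le_mul_norm_of_ae_le_mul ?_
    filter_upwards [hFae] with ξ h2
    rw [h2, norm_mul]
    gcongr
    exact hC ξ

theorem toTemperedDistribution_Lp_two_injective {h h' : Lp ℂ 2 (volume : Measure E)}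
    (H : (h : 𝓢'(E, ℂ)) = h') : h = h' :=
  LinearMap.ker_eq_bot.1 (Lp.ker_toTemperedDistributionCLM_eq_bot (F := ℂ)
    (μ := (volume : Measure E)) (p := 2)) H

theorem ae_eq_of_integral_schwartz_eq {f f' : E → ℂ} (hf : LocallyIntegrable f)
    (hf' : LocallyIntegrable f') (H : ∀ φ : 𝓢(E, ℂ), ∫ x, φ x • f x = ∫ x, φ x • f' x) :
    ∀ᵐ x, f x = f' x := by
  refine ae_eq_of_integral_contDiff_smul_eq hf hf' fun φ hφ hφc ↦ ?_
  have hg₁ : HasCompactSupport (Complex.ofRealCLM ∘ φ) := hφc.comp_left rfl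
  have hg₂ : ContDiff ℝ ∞ (Complex.ofRealCLM ∘ φ) := by fun_prop
  simpa using H (hg₁.toSchwartzMap hg₂)

/-- In dimension two or three, `⟨ξ⟩^{-σ}` times an `L²` function is the Fourier transform of an
`L^q` function, where `q = 6 / j` and `2 σ = 3 - j`. -/
theorem exists_eLpNorm_le_of_fourier_decay (hE : Module.finrank ℝ E = 2 ∨ Module.finrank ℝ E = 3)
    {q σ j : ℝ} (hq : 3 ≤ q) (hj1 : 1 ≤ j) (hj : j * q = 6) (hσ : 2 * σ = 3 - j) :
    ∃ C : ℝ≥0, ∀ f H : Lp ℂ 2 (volume : Measure E),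
      (∀ᵐ ξ, ‖(𝓕 f : Lp ℂ 2 (volume : Measure E)) ξ‖ ≤ (1 + ‖ξ‖ ^ 2) ^ (-σ / 2) * ‖H ξ‖) →
      eLpNorm f (ENNReal.ofReal q) volume ≤ C * ‖H‖ₑ := by
  have hj2 : j ≤ 2 := by nlinarith
  obtain ⟨C, hC, hB⟩ := lintegral_ball_le_of_homogeneous (E := E) (j := j) rfl
    (by rcases hE with h | h <;> omega) (by linarith)
  -- `⟨ξ⟩^{-2σ} ≤ |ξ|^{j - d}`, since `2 σ = 3 - j ≥ d - j ≥ 0`, where `d ≤ 3` and `j ≤ 2 ≤ d`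
  have hB' : ∀ A : ℝ, 0 < A → ∫⁻ ξ in ball (0 : E) A, ENNReal.ofReal ((1 + ‖ξ‖ ^ 2) ^ (-σ))
      ≤ ENNReal.ofReal (C * A ^ j) := by
    intro A hA
    have : Nontrivial E := Module.nontrivial_of_finrank_pos (R := ℝ) (by rcases hE with h | h <;> omega)
    refine le_trans (lintegral_mono_ae ?_) (hB A hA)
    refine ae_restrict_of_ae ?_
    filter_upwards [Measure.ae_ne volume (0 : E)] with ξ hξ
    apply ENNReal.ofReal_le_ofReal
    have hξ' : 0 < ‖ξ‖ := norm_pos_iff.2 hξ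
    have h1 : (1 : ℝ) ≤ 1 + ‖ξ‖ ^ 2 := by simp
    have hd : (2 : ℝ) ≤ Module.finrank ℝ E ∧ (Module.finrank ℝ E : ℝ) ≤ 3 := by
      rcases hE with h | h <;> rw [h] <;> norm_num
    calc (1 + ‖ξ‖ ^ 2) ^ (-σ) ≤ (1 + ‖ξ‖ ^ 2) ^ ((j - Module.finrank ℝ E) / 2) := by
          exact Real.rpow_le_rpow_of_exponent_le h1 (by linarith)
      _ ≤ (‖ξ‖ ^ 2) ^ ((j - Module.finrank ℝ E) / 2) := by
          refine Real.rpow_le_rpow_of_nonpos (by positivity) (by linarith) (by linarith)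
      _ = _ := by
          rw [← Real.rpow_natCast, ← Real.rpow_mul hξ'.le]
          congr 1; push_cast; ring
  set K : ℝ := 4 * q * (2 * √C) ^ (q - 2) with hK
  have hK0 : 0 ≤ K := by positivity
  refine ⟨Real.toNNReal (K ^ (1 / q)), fun f H hfH ↦ ?_⟩
  have key := lintegral_rpow_le_of_fourier_decay hq hj hσ hC hB' f H hfH
  rw [eLpNorm_eq_lintegral_rpow_enorm_toReal (by simp; linarith) ENNReal.ofReal_ne_top,
    ENNReal.toReal_ofReal (by linarith)]
  have h1 : ∫⁻ x, ‖f x‖ₑ ^ q = ∫⁻ x, ENNReal.ofReal (‖f x‖ ^ q) := by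
    congr 1; ext x
    rw [← ofReal_norm, ENNReal.ofReal_rpow_of_nonneg (norm_nonneg _) (by linarith)]
  rw [h1]
  refine (ENNReal.rpow_le_rpow key (by positivity)).trans_eq ?_
  rw [← hK, ENNReal.ofReal_rpow_of_nonneg (by positivity) (by positivity),
    Real.mul_rpow hK0 (by positivity), ← Real.rpow_mul (norm_nonneg _),
    mul_one_div_cancel (by linarith : q ≠ 0), Real.rpow_one, ENNReal.ofReal_mul (by positivity),
    ofReal_norm]
  rfl
end Fourier

section Embedding
open FourierTransform
variable {m : ℕ}

theorem hsNorm_eq_of_besselPotential_eq {σ : ℝ} {f : Euc m → ℂ} (hf : Integrable f)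
    {h : Lp ℂ 2 (volume : Measure (Euc m))}
    (hh : besselPotential (Euc m) ℂ σ (regularDist hf) = h) : hsNorm σ f = ‖h‖ₑ := by
  refine le_antisymm (iInf₂_le h ⟨hf, hh⟩) (le_iInf₂ ?_)
  rintro h' ⟨_, hh'⟩
  rw [toTemperedDistribution_Lp_two_injective (hh.symm.trans hh')]

theorem regularDist_apply {f : Euc m → ℂ} (hf : Integrable f) (φ : 𝓢(Euc m, ℂ)) :
    regularDist hf φ = ∫ x, φ x * f x := by
  rw [regularDist, Lp.toTemperedDistribution_apply]
  refine integral_congr_ae ?_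
  filter_upwards [hf.coeFn_toL1] with x hx
  rw [hx, smul_eq_mul]

/-- Functions of class `H^σ`, `σ ≥ 1`, are square integrable and of class `L⁶`, and they have
square integrable weak derivatives. -/
theorem exists_sobolev_bounds (hm : m = 2 ∨ m = 3) :
    ∃ C : ℝ≥0, ∀ σ : ℝ, 1 ≤ σ → ∀ f : Euc m → ℝ, MemHs σ (fun x ↦ (f x : ℂ)) →
      hsNorm σ (fun x ↦ (f x : ℂ)) < ⊤ ∧ AEStronglyMeasurable f volume ∧
      eLpNorm f 2 volume ≤ C * hsNorm σ (fun x ↦ (f x : ℂ)) ∧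
      eLpNorm f 6 volume ≤ C * hsNorm σ (fun x ↦ (f x : ℂ)) ∧
      ∃ d : Fin m → Euc m → ℝ, ∀ j, AEStronglyMeasurable (d j) volume ∧
        eLpNorm (d j) 2 volume ≤ C * hsNorm σ (fun x ↦ (f x : ℂ)) ∧
        ∀ ψ : Euc m → ℝ, ContDiff ℝ ∞ ψ → HasCompactSupport ψ →
          ∫ x, f x * fderiv ℝ ψ x (EuclideanSpace.single j 1) = - ∫ x, d j x * ψ x := by
  obtain ⟨C6, hC6⟩ := exists_eLpNorm_le_of_fourier_decay (E := Euc m) (q := 6) (σ := 1) (j := 1)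
    (by simpa using hm) (by norm_num) (by norm_num) (by norm_num) (by norm_num)
  set C' : ℝ≥0 := Real.toNNReal (2 * Real.pi) with hC'
  refine ⟨1 + C6 + C', fun σ hσ f hf ↦ ?_⟩
  obtain ⟨hint, h, hh⟩ := hf
  rw [hsNorm_eq_of_besselPotential_eq hint hh]
  have hfr : AEStronglyMeasurable f volume := by
    have := hint.aestronglyMeasurable.re
    simpa using this
  -- `f = ⟨D⟩^{-σ} h`
  have hreg : regularDist hint = besselPotential (Euc m) ℂ (-σ) (h : 𝓢'(Euc m, ℂ)) :=
    ((besselPotential_neg_apply_eq_iff σ _ _).2 hh).symm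
  obtain ⟨f', hf'1, hf'2, hf'3⟩ := exists_fourierMultiplierCLM_Lp_two
    (E := Euc m) (a := fun x ↦ (((1 + ‖x‖ ^ 2) ^ (-σ / 2) : ℝ) : ℂ)) (by fun_prop) (C := 1)
    (norm_ofReal_one_add_norm_sq_rpow_le_one (by linarith)) h
  have hae : ∀ᵐ x, (f x : ℂ) = f' x := by
    refine ae_eq_of_integral_schwartz_eq hint.locallyIntegrable
      ((Lp.memLp _).locallyIntegrable (by norm_num)) fun φ ↦ ?_
    have := congrArg (fun T : 𝓢'(Euc m, ℂ) ↦ T φ) (hreg.trans hf'1)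
    simpa [regularDist_apply] using this
  have hnf : ∀ p, eLpNorm f p volume = eLpNorm f' p volume := by
    intro p
    refine eLpNorm_congr_norm_ae ?_
    filter_upwards [hae] with x hx
    rw [← hx, Complex.norm_real]
  have le1 : ∀ (c : ℝ≥0), c ≤ 1 + C6 + C' → (c : ℝ≥0∞) * ‖h‖ₑ ≤ ((1 + C6 + C' : ℝ≥0) : ℝ≥0∞) * ‖h‖ₑ := by
    intro c hc
    gcongr
  refine ⟨enorm_lt_top, hfr, ?_, ?_, ?_⟩
  · refine le_trans ?_ (le1 1 (by rw [add_assoc]; exact le_self_add))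
    rw [hnf, ← Lp.enorm_def, ENNReal.coe_one, one_mul, ← ofReal_norm, ← ofReal_norm]
    exact ENNReal.ofReal_le_ofReal (by linarith)
  · refine le_trans ?_ (le1 C6 (by rw [add_right_comm]; exact le_add_self))
    rw [hnf]
    have := hC6 f' (𝓕 h) ?_
    · rw [← ofReal_norm (𝓕 h : Lp ℂ 2 (volume : Measure (Euc m))), Lp.norm_fourier_eq,
        ofReal_norm] at this
      simpa using this
    · filter_upwards [hf'2] with ξ hξ
      rw [hξ, norm_mul, Complex.norm_real, Real.norm_of_nonneg (by positivity)]
      gcongr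
      simp
  · have hd : ∀ j : Fin m, ∃ d : Euc m → ℝ, AEStronglyMeasurable d volume ∧
        eLpNorm d 2 volume ≤ C' * ‖h‖ₑ ∧
        ∀ ψ : Euc m → ℝ, ContDiff ℝ ∞ ψ → HasCompactSupport ψ →
          ∫ x, f x * fderiv ℝ ψ x (EuclideanSpace.single j 1) = - ∫ x, d x * ψ x := by
      intro j
      set ej : Euc m := EuclideanSpace.single j 1 with hej
      obtain ⟨d, hd1, -, hd3⟩ := exists_fourierMultiplierCLM_Lp_two
        (E := Euc m) (a := fun x ↦ (2 * Real.pi * Complex.I) •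
          (Complex.ofReal (inner ℝ x ej) * (((1 + ‖x‖ ^ 2) ^ (-σ / 2) : ℝ) : ℂ)))
        (by fun_prop) (C := 2 * Real.pi) (by
          intro x
          rw [norm_smul, norm_mul, norm_mul, norm_mul, Complex.norm_real, Complex.norm_real,
            Complex.norm_real, Complex.norm_I, Real.norm_of_nonneg Real.pi_pos.le,
            Real.norm_of_nonneg (r := (1 + ‖x‖ ^ 2) ^ (-σ / 2)) (by positivity)]
          have h1 : ‖(inner ℝ x ej : ℝ)‖ ≤ ‖x‖ := by
            refine (norm_inner_le_norm x ej).trans ?_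
            simp [hej]
          have h2 : (1 + ‖x‖ ^ 2) ^ (-σ / 2) ≤ (1 + ‖x‖ ^ 2) ^ (-(1 / 2) : ℝ) :=
            Real.rpow_le_rpow_of_exponent_le (by simp) (by linarith)
          have h3 : ‖x‖ * (1 + ‖x‖ ^ 2) ^ (-(1 / 2) : ℝ) ≤ 1 := by
            rw [Real.rpow_neg (by positivity), ← Real.sqrt_eq_rpow, ← div_eq_mul_inv,
              div_le_one (by positivity)]
            exact Real.le_sqrt_of_sq_le (by linarith)
          have h4 : ‖(inner ℝ x ej : ℝ)‖ * (1 + ‖x‖ ^ 2) ^ (-σ / 2) ≤ 1 :=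
            (mul_le_mul h1 h2 (by positivity) (by positivity)).trans h3
          simp only [Complex.norm_ofNat, mul_one]
          nlinarith [Real.pi_pos]) h
      refine ⟨fun x ↦ (d x).re, (Lp.aestronglyMeasurable d).re, ?_, ?_⟩
      · refine (eLpNorm_mono (g := d) fun x ↦ ?_).trans ?_
        · exact Complex.abs_re_le_norm _
        · rw [← Lp.enorm_def, ← ofReal_norm, ← ofReal_norm h, hC']
          refine (ENNReal.ofReal_le_ofReal hd3).trans_eq ?_
          rw [ENNReal.ofReal_mul (by positivity)]; rfl
      · intro ψ hψ hψc
        have hg₁ : HasCompactSupport (Complex.ofRealCLM ∘ ψ) := hψc.comp_left rfl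
        have hg₂ : ContDiff ℝ ∞ (Complex.ofRealCLM ∘ ψ) := by fun_prop
        set Ψ : 𝓢(Euc m, ℂ) := hg₁.toSchwartzMap hg₂ with hΨ
        have e1 : LineDeriv.lineDerivOp ej (regularDist hint) = (d : 𝓢'(Euc m, ℂ)) := by
          rw [TemperedDistribution.lineDeriv_eq_fourierMultiplierCLM, hreg, besselPotential,
            fourierMultiplierCLM_fourierMultiplierCLM_apply (by fun_prop) (by fun_prop), ← hd1]
          have := fourierMultiplierCLM_smul (F := ℂ) (E := Euc m) (g := fun x ↦
            Complex.ofReal (inner ℝ x ej) * (((1 + ‖x‖ ^ 2) ^ (-σ / 2) : ℝ) : ℂ)) (by fun_prop)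
            (2 * Real.pi * Complex.I)
          have h2 := congrArg (fun T : 𝓢'(Euc m, ℂ) →L[ℂ] 𝓢'(Euc m, ℂ) ↦ T h) this
          refine (Eq.trans ?_ h2.symm)
          simp only [smul_apply]
          congr 2
          refine congrArg (fun a ↦ fourierMultiplierCLM ℂ a) ?_
          funext x
          simp [mul_comm]
        have e2 := congrArg (fun T : 𝓢'(Euc m, ℂ) ↦ T Ψ) e1
        simp only [TemperedDistribution.lineDerivOp_apply_apply, map_neg, regularDist_apply,
          Lp.toTemperedDistribution_apply] at e2
        have e3 : ∀ x, (LineDeriv.lineDerivOp ej Ψ : 𝓢(Euc m, ℂ)) x = ((fderiv ℝ ψ x ej : ℝ) : ℂ) := by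
          intro x
          rw [SchwartzMap.lineDerivOp_apply_eq_fderiv]
          have h1 : HasFDerivAt ψ (fderiv ℝ ψ x) x :=
            (hψ.differentiable (by simp) x).hasFDerivAt
          have h2 : HasFDerivAt (Ψ : Euc m → ℂ) (Complex.ofRealCLM ∘L fderiv ℝ ψ x) x :=
            Complex.ofRealCLM.hasFDerivAt.comp x h1
          rw [h2.fderiv]; rfl
        simp only [e3] at e2
        have e4 : ∀ x, Ψ x = ((ψ x : ℝ) : ℂ) := fun _ ↦ rfl
        simp only [e4, ← Complex.ofReal_mul, smul_eq_mul] at e2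
        rw [integral_complex_ofReal] at e2
        have e5 := congrArg Complex.re e2
        have e6 : Integrable (fun x ↦ ((ψ x : ℝ) : ℂ) * d x) := by
          have h1 : MemLp (fun x ↦ ((ψ x : ℝ) : ℂ)) 2 volume := Ψ.memLp 2 volume
          exact h1.integrable_mul (Lp.memLp d)
        have e7 := integral_re e6
        simp only [RCLike.re_eq_complex_re] at e7
        rw [← e7] at e5
        simp only [Complex.neg_re, Complex.ofReal_re, Complex.re_ofReal_mul] at e5
        simp only [mul_comm (f _), mul_comm _ (ψ _)]
        linarith
    choose d hd using hd
    refine ⟨d, fun j ↦ ⟨(hd j).1, (hd j).2.1.trans (le1 C' le_add_self), (hd j).2.2⟩⟩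

/-- `L^{3/2} ⊂ H^{-1/2}` in dimension two and three, by duality from `H^{1/2} ⊂ L³`. -/
theorem exists_hsNorm_le_eLpNorm (hm : m = 2 ∨ m = 3) :
    ∃ C : ℝ≥0, ∀ τ : ℝ, τ ≤ -1 / 2 → ∀ f : Euc m → ℂ, Integrable f →
      MemLp f (ENNReal.ofReal (3 / 2)) volume →
      MemHs τ f ∧ hsNorm τ f ≤ C * eLpNorm f (ENNReal.ofReal (3 / 2)) volume := by
  obtain ⟨C, hC⟩ := exists_eLpNorm_le_of_fourier_decay (E := Euc m) (q := 3) (σ := 1 / 2) (j := 2)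
    (by simpa using hm) (by norm_num) (by norm_num) (by norm_num) (by norm_num)
  refine ⟨C, fun τ hτ f hf hfp ↦ ?_⟩
  set P := eLpNorm f (ENNReal.ofReal (3 / 2)) volume with hP
  set a : Euc m → ℂ := fun x ↦ (((1 + ‖x‖ ^ 2) ^ (τ / 2) : ℝ) : ℂ) with ha
  have haT : a.HasTemperateGrowth := by fun_prop
  have bound : ∀ φ : 𝓢(Euc m, ℂ), ‖besselPotential (Euc m) ℂ τ (regularDist hf) φ‖ ≤
      (C * P).toReal * ‖φ.toLp 2‖ := by
    intro φ
    set ψ : 𝓢(Euc m, ℂ) := 𝓕 (SchwartzMap.smulLeftCLM ℂ a (𝓕⁻ φ)) with hψ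
    have h1 : besselPotential (Euc m) ℂ τ (regularDist hf) φ = ∫ x, ψ x * f x := by
      rw [besselPotential, fourierMultiplierCLM_apply_apply, regularDist_apply]
    have h2 : eLpNorm ψ (ENNReal.ofReal 3) volume ≤ C * ‖φ.toLp 2‖ₑ := by
      have := hC (ψ.toLp 2) ((𝓕 φ).toLp 2) ?_
      · have hn : ‖(𝓕 φ).toLp 2 (volume : Measure (Euc m))‖ₑ = ‖φ.toLp 2 (volume : Measure (Euc m))‖ₑ := by
          rw [← SchwartzMap.toLp_fourier_eq, ← ofReal_norm, Lp.norm_fourier_eq, ofReal_norm]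
        rw [hn] at this
        rwa [eLpNorm_congr_ae (ψ.coeFn_toLp 2 volume)] at this
      · rw [SchwartzMap.toLp_fourier_eq]
        filter_upwards [(𝓕 ψ).coeFn_toLp 2 volume, (𝓕 φ).coeFn_toLp 2 volume] with ξ e1 e2
        rw [e1, e2]
        have e3 : (𝓕 ψ) ξ = a (-ξ) * (𝓕 φ) ξ := by
          have e4 : (𝓕 ψ) ξ = (𝓕⁻ ψ) (-ξ) := by
            rw [SchwartzMap.fourier_coe, SchwartzMap.fourierInv_coe, Real.fourierInv_eq_fourier_neg,
              neg_neg]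
          have e5 : (𝓕 φ) ξ = (𝓕⁻ φ) (-ξ) := by
            rw [SchwartzMap.fourier_coe, SchwartzMap.fourierInv_coe, Real.fourierInv_eq_fourier_neg,
              neg_neg]
          rw [e4, e5, hψ, FourierTransform.fourierInv_fourier_eq, SchwartzMap.smulLeftCLM_apply_apply haT,
            smul_eq_mul]
        rw [e3, norm_mul, ha]
        beta_reduce
        rw [norm_neg, Complex.norm_real, Real.norm_of_nonneg (by positivity)]
        gcongr
        · simp
        · linarith
    have hh : ENNReal.HolderConjugate (ENNReal.ofReal 3) (ENNReal.ofReal (3 / 2)) := by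
      have : Real.HolderConjugate 3 (3 / 2) := by
        rw [Real.holderConjugate_iff]; norm_num
      exact this.ennrealOfReal
    have h3 : ‖∫ x, ψ x * f x‖ₑ ≤ (C * P) * ‖φ.toLp 2‖ₑ := by
      refine (enorm_integral_le_lintegral_enorm _).trans ?_
      rw [← eLpNorm_one_eq_lintegral_enorm]
      refine (eLpNorm_smul_le_mul_eLpNorm (p := ENNReal.ofReal 3) (q := ENNReal.ofReal (3 / 2))
        (r := 1) hfp.1 ψ.continuous.aestronglyMeasurable).trans ?_
      refine (mul_le_mul_left h2 _).trans_eq ?_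
      rw [← hP]; ring
    rw [h1, ← ENNReal.toReal_ofReal (norm_nonneg (∫ x, ψ x * f x)), ofReal_norm,
      ← ENNReal.toReal_ofReal (norm_nonneg (φ.toLp 2 volume)), ofReal_norm, ← ENNReal.toReal_mul]
    refine ENNReal.toReal_mono ?_ h3
    exact ENNReal.mul_ne_top (ENNReal.mul_ne_top ENNReal.coe_ne_top hfp.2.ne) enorm_ne_top
  obtain ⟨h, hh1, hh2⟩ := exists_Lp_two_of_bound _ ENNReal.toReal_nonneg bound
  refine ⟨⟨hf, h, hh1⟩, ?_⟩
  rw [hsNorm_eq_of_besselPotential_eq hf hh1, ← ofReal_norm]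
  exact (ENNReal.ofReal_le_ofReal hh2).trans ENNReal.ofReal_toReal_le

end Embedding

/-! ### Weak derivatives on open sets -/

section WeakPartial
variable {m : ℕ}

theorem contDiff_mul_of_tsupport_subset {W : Set (Euc m)} (hW : IsOpen W) {a ψ : Euc m → ℝ}
    (ha : ContDiffOn ℝ ∞ a W) (hψ : ContDiff ℝ ∞ ψ) (hs : tsupport ψ ⊆ W) :
    ContDiff ℝ ∞ (fun x ↦ a x * ψ x) := by
  rw [contDiff_iff_contDiffAt]
  intro x
  by_cases hx : x ∈ tsupport ψ
  · exact (ha.contDiffAt (hW.mem_nhds (hs hx))).mul hψ.contDiffAt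
  · have h0 : ψ =ᶠ[𝓝 x] 0 := notMem_tsupport_iff_eventuallyEq.1 hx
    refine (contDiffAt_const (c := (0 : ℝ))).congr_of_eventuallyEq ?_
    filter_upwards [h0] with y hy
    simp [hy]

/-- A function that is smooth on an open set and vanishes off a compact subset of it extends by zero
to a test function. -/
theorem contDiff_indicator_of_isCompact {W K : Set (Euc m)} (hW : IsOpen W) (hK : IsCompact K)
    (hKW : K ⊆ W) {p : Euc m → ℝ} (hp : ContDiffOn ℝ ∞ p W) (h0 : ∀ x ∈ W, x ∉ K → p x = 0) :
    ContDiff ℝ ∞ (W.indicator p) ∧ HasCompactSupport (W.indicator p) ∧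
      tsupport (W.indicator p) ⊆ K := by
  have hz : ∀ x, x ∉ K → W.indicator p x = 0 := by
    intro x hx
    by_cases hxW : x ∈ W
    · rw [indicator_of_mem hxW, h0 x hxW hx]
    · rw [indicator_of_notMem hxW]
  have hs : tsupport (W.indicator p) ⊆ K :=
    closure_minimal (fun x hx ↦ by_contra fun h ↦ hx (hz x h)) hK.isClosed
  refine ⟨?_, hK.of_isClosed_subset (isClosed_tsupport _) hs, hs⟩
  rw [contDiff_iff_contDiffAt]
  intro x
  by_cases hx : x ∈ K
  · have hxW := hW.mem_nhds (hKW hx)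
    refine (hp.contDiffAt hxW).congr_of_eventuallyEq ?_
    filter_upwards [hxW] with y hy
    rw [indicator_of_mem hy]
  · refine (contDiffAt_const (c := (0 : ℝ))).congr_of_eventuallyEq ?_
    filter_upwards [hK.isClosed.isOpen_compl.mem_nhds hx] with y hy
    exact hz y hy

theorem integrable_mul_of_locallyIntegrableOn {W : Set (Euc m)} {f φ : Euc m → ℝ}
    (hf : LocallyIntegrableOn f W) (hφ : Continuous φ) (hc : HasCompactSupport φ)
    (hs : tsupport φ ⊆ W) : Integrable (fun x ↦ f x * φ x) := by
  have h1 : IntegrableOn (fun x ↦ φ x * f x) (tsupport φ) :=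
    (hf.integrableOn_compact_subset hs hc).continuousOn_mul hφ.continuousOn hc
  refine (integrableOn_iff_integrable_of_support_subset ?_).1 (h1.congr (ae_of_all _ fun x ↦ mul_comm _ _))
  intro x hx
  exact subset_tsupport _ (right_ne_zero_of_mul hx)

namespace HasWeakPartial

variable {W : Set (Euc m)} {j : Fin m} {f d : Euc m → ℝ}

theorem mono {W' : Set (Euc m)} (h : HasWeakPartial W j f d) (hW : W' ⊆ W) :
    HasWeakPartial W' j f d :=
  ⟨h.1.mono_set hW, h.2.1.mono_set hW, fun ψ h1 h2 h3 ↦ h.2.2 ψ h1 h2 (h3.trans hW)⟩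

theorem integral_mul_congr_of_ae {f g ψ : Euc m → ℝ} (hfg : ∀ᵐ x, x ∈ W → f x = g x)
    (hs : tsupport ψ ⊆ W) : ∫ x, f x * ψ x = ∫ x, g x * ψ x := by
  refine integral_congr_ae ?_
  filter_upwards [hfg] with x hx
  by_cases h : x ∈ tsupport ψ
  · rw [hx (hs h)]
  · simp [image_eq_zero_of_notMem_tsupport h]

theorem locallyIntegrableOn_congr_ae {f g : Euc m → ℝ} (hW : IsOpen W) (hf : LocallyIntegrableOn f W)
    (hfg : ∀ᵐ x, x ∈ W → f x = g x) : LocallyIntegrableOn g W := by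
  rw [locallyIntegrableOn_iff hW.isLocallyClosed] at hf ⊢
  intro K hK hKc
  refine (hf K hK hKc).congr ?_
  rw [Filter.EventuallyEq, ae_restrict_iff' hKc.measurableSet]
  filter_upwards [hfg] with x hx hxK using hx (hK hxK)

theorem congr_ae {f' d' : Euc m → ℝ} (h : HasWeakPartial W j f d) (hW : IsOpen W)
    (hf : ∀ᵐ x, x ∈ W → f x = f' x) (hd : ∀ᵐ x, x ∈ W → d x = d' x) :
    HasWeakPartial W j f' d' := by
  refine ⟨locallyIntegrableOn_congr_ae hW h.1 hf, locallyIntegrableOn_congr_ae hW h.2.1 hd,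
    fun ψ h1 h2 h3 ↦ ?_⟩
  rw [← integral_mul_congr_of_ae hf ((tsupport_fderiv_apply_subset ℝ _).trans h3),
    ← integral_mul_congr_of_ae hd h3, h.2.2 ψ h1 h2 h3]

theorem continuous_fderiv_apply {ψ : Euc m → ℝ} (hψ : ContDiff ℝ ∞ ψ) (v : Euc m) :
    Continuous fun x ↦ fderiv ℝ ψ x v :=
  (hψ.continuous_fderiv (by simp)).clm_apply continuous_const

theorem hasCompactSupport_fderiv_apply {ψ : Euc m → ℝ} (hψ : HasCompactSupport ψ) (v : Euc m) :
    HasCompactSupport fun x ↦ fderiv ℝ ψ x v :=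
  hψ.of_isClosed_subset (isClosed_tsupport _) (tsupport_fderiv_apply_subset ℝ v)

theorem add {f' d' : Euc m → ℝ} (h : HasWeakPartial W j f d) (h' : HasWeakPartial W j f' d') :
    HasWeakPartial W j (fun x ↦ f x + f' x) (fun x ↦ d x + d' x) := by
  refine ⟨h.1.add h'.1, h.2.1.add h'.2.1, fun ψ h1 h2 h3 ↦ ?_⟩
  have hs := (tsupport_fderiv_apply_subset ℝ (EuclideanSpace.single j 1)).trans h3
  have hc := continuous_fderiv_apply h1 (EuclideanSpace.single j 1)
  have hk := hasCompactSupport_fderiv_apply h2 (EuclideanSpace.single j 1)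
  simp only [add_mul]
  rw [integral_add (integrable_mul_of_locallyIntegrableOn h.1 hc hk hs)
    (integrable_mul_of_locallyIntegrableOn h'.1 hc hk hs),
    integral_add (integrable_mul_of_locallyIntegrableOn h.2.1 h1.continuous h2 h3)
    (integrable_mul_of_locallyIntegrableOn h'.2.1 h1.continuous h2 h3), h.2.2 ψ h1 h2 h3,
    h'.2.2 ψ h1 h2 h3]
  ring

theorem zero : HasWeakPartial W j (fun _ ↦ 0) (fun _ ↦ 0) :=
  ⟨locallyIntegrableOn_zero, locallyIntegrableOn_zero, fun ψ _ _ _ ↦ by simp⟩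

theorem sum {ι : Type*} (s : Finset ι) {f d : ι → Euc m → ℝ}
    (h : ∀ i ∈ s, HasWeakPartial W j (f i) (d i)) :
    HasWeakPartial W j (fun x ↦ ∑ i ∈ s, f i x) (fun x ↦ ∑ i ∈ s, d i x) := by
  classical
  induction s using Finset.induction_on with
  | empty => simpa using zero
  | insert i s hi ih =>
    simp only [Finset.sum_insert hi]
    exact (h i (Finset.mem_insert_self i s)).add (ih fun k hk ↦ h k (Finset.mem_insert_of_mem hk))

theorem neg (h : HasWeakPartial W j f d) : HasWeakPartial W j (fun x ↦ - f x) (fun x ↦ - d x) := by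
  refine ⟨h.1.neg, h.2.1.neg, fun ψ h1 h2 h3 ↦ ?_⟩
  simp only [neg_mul, integral_neg, h.2.2 ψ h1 h2 h3]

theorem sub {f' d' : Euc m → ℝ} (h : HasWeakPartial W j f d) (h' : HasWeakPartial W j f' d') :
    HasWeakPartial W j (fun x ↦ f x - f' x) (fun x ↦ d x - d' x) := by
  simpa only [sub_eq_add_neg] using h.add h'.neg

theorem contDiffOn_fderiv_apply (hW : IsOpen W) {a : Euc m → ℝ} (ha : ContDiffOn ℝ ∞ a W)
    (v : Euc m) : ContDiffOn ℝ ∞ (fun x ↦ fderiv ℝ a x v) W :=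
  (ha.fderiv_of_isOpen hW (by simp)).clm_apply contDiffOn_const

theorem locallyIntegrableOn_continuousOn_mul (hW : IsOpen W) {a g : Euc m → ℝ}
    (ha : ContinuousOn a W) (hg : LocallyIntegrableOn g W) :
    LocallyIntegrableOn (fun x ↦ a x * g x) W := by
  rw [locallyIntegrableOn_iff hW.isLocallyClosed] at hg ⊢
  exact fun K hK hKc ↦ (hg K hK hKc).continuousOn_mul (ha.mono hK) hKc

/-- The product rule. -/
theorem contDiffOn_mul (h : HasWeakPartial W j f d) (hW : IsOpen W) {a : Euc m → ℝ}
    (ha : ContDiffOn ℝ ∞ a W) :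
    HasWeakPartial W j (fun x ↦ a x * f x)
      (fun x ↦ a x * d x + fderiv ℝ a x (EuclideanSpace.single j 1) * f x) := by
  set e : Euc m := EuclideanSpace.single j 1
  have ha' := contDiffOn_fderiv_apply hW ha e
  have l1 := locallyIntegrableOn_continuousOn_mul hW ha.continuousOn h.1
  have l2 := locallyIntegrableOn_continuousOn_mul hW ha.continuousOn h.2.1
  have l3 := locallyIntegrableOn_continuousOn_mul hW ha'.continuousOn h.1
  refine ⟨l1, l2.add l3, fun ψ h1 h2 h3 ↦ ?_⟩
  have hs := (tsupport_fderiv_apply_subset ℝ e).trans h3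
  have hc := continuous_fderiv_apply h1 e
  have hk := hasCompactSupport_fderiv_apply h2 e
  have hst : tsupport (fun x ↦ a x * ψ x) ⊆ tsupport ψ :=
    closure_mono fun x hx ↦ right_ne_zero_of_mul hx
  have key := h.2.2 (fun x ↦ a x * ψ x) (contDiff_mul_of_tsupport_subset hW ha h1 h3)
    (h2.of_isClosed_subset (isClosed_tsupport _) hst) (hst.trans h3)
  have hder : ∀ x, f x * fderiv ℝ (fun x ↦ a x * ψ x) x e =
      a x * f x * fderiv ℝ ψ x e + fderiv ℝ a x e * f x * ψ x := by
    intro x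
    by_cases hx : x ∈ tsupport ψ
    · have d1 : DifferentiableAt ℝ a x :=
        (ha.contDiffAt (hW.mem_nhds (h3 hx))).differentiableAt (by simp)
      have d2 : DifferentiableAt ℝ ψ x := h1.differentiable (by simp) x
      rw [fderiv_fun_mul d1 d2]
      simp
      ring
    · have e1 : ψ x = 0 := image_eq_zero_of_notMem_tsupport hx
      have e2 : fderiv ℝ ψ x e = 0 :=
        image_eq_zero_of_notMem_tsupport (f := fun x ↦ fderiv ℝ ψ x e)
          fun h ↦ hx (tsupport_fderiv_apply_subset ℝ e h)
      have e3 : fderiv ℝ (fun x ↦ a x * ψ x) x e = 0 :=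
        image_eq_zero_of_notMem_tsupport (f := fun x ↦ fderiv ℝ (fun x ↦ a x * ψ x) x e)
          fun h ↦ hx (hst (tsupport_fderiv_apply_subset ℝ e h))
      rw [e1, e2, e3]; simp
  change ∫ x, f x * fderiv ℝ (fun x ↦ a x * ψ x) x e = _ at key
  simp only [hder] at key
  rw [integral_add (integrable_mul_of_locallyIntegrableOn l1 hc hk hs)
    (integrable_mul_of_locallyIntegrableOn l3 h1.continuous h2 h3)] at key
  simp only [add_mul]
  rw [integral_add (integrable_mul_of_locallyIntegrableOn l2 h1.continuous h2 h3)
    (integrable_mul_of_locallyIntegrableOn l3 h1.continuous h2 h3)]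
  have : ∀ x, d x * (a x * ψ x) = a x * d x * ψ x := fun x ↦ by ring
  simp only [this] at key
  linarith

/-- Weak derivatives are unique. -/
theorem ae_eq (hW : IsOpen W) {d' : Euc m → ℝ} (h : HasWeakPartial W j f d)
    (h' : HasWeakPartial W j f d') : ∀ᵐ x, x ∈ W → d x = d' x := by
  have := hW.ae_eq_zero_of_integral_contDiff_smul_eq_zero (h.2.1.sub h'.2.1)
    (fun ψ h1 h2 h3 ↦ ?_)
  · filter_upwards [this] with x hx hxW
    exact sub_eq_zero.1 (hx hxW)
  · have e : ∀ x, ψ x • (d - d') x = d x * ψ x - d' x * ψ x := fun x ↦ by simp; ring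
    simp only [e]
    rw [integral_sub (integrable_mul_of_locallyIntegrableOn h.2.1 h1.continuous h2 h3)
      (integrable_mul_of_locallyIntegrableOn h'.2.1 h1.continuous h2 h3)]
    have a1 := h.2.2 ψ h1 h2 h3
    have a2 := h'.2.2 ψ h1 h2 h3
    linarith

/-- If the functions vanish off a relatively closed subset `S` of `W` and `d` is the weak derivative
of `f` near `S`, then it is the weak derivative of `f` on `W`. Test functions are multiplied by a
cut-off function that is one near `S`. -/
theorem extend_zero {W' S : Set (Euc m)} (hW : IsOpen W) (hW' : IsOpen W') (hSW' : S ⊆ W')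
    (hS : ∀ K, IsCompact K → K ⊆ W → IsCompact (K ∩ S))
    (h : HasWeakPartial W' j f d) (hf : ∀ x ∈ W, x ∉ S → f x = 0) (hd : ∀ x ∈ W, x ∉ S → d x = 0) :
    HasWeakPartial W j f d := by
  have loc : ∀ g : Euc m → ℝ, LocallyIntegrableOn g W' → (∀ x ∈ W, x ∉ S → g x = 0) →
      LocallyIntegrableOn g W := by
    intro g hg h0
    rw [locallyIntegrableOn_iff hW.isLocallyClosed]
    intro K hK hKc
    have h1 : IntegrableOn g (K ∩ S) :=
      hg.integrableOn_compact_subset (inter_subset_right.trans hSW') (hS K hKc hK)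
    exact h1.of_forall_sdiff_eq_zero hKc.measurableSet
      fun x hx ↦ h0 x (hK hx.1) fun hxS ↦ hx.2 ⟨hx.1, hxS⟩
  refine ⟨loc f h.1 hf, loc d h.2.1 hd, fun ψ h1 h2 h3 ↦ ?_⟩
  have hKS := hS (tsupport ψ) h2 h3
  obtain ⟨η, hη1, hη2, hη3, hη4⟩ : ∃ η : Euc m → ℝ, ContDiff ℝ ∞ η ∧ HasCompactSupport η ∧
      tsupport η ⊆ W' ∧ ∀ x ∈ tsupport ψ ∩ S, η =ᶠ[𝓝 x] 1 := by
    obtain ⟨L, hL, hQL, hLW⟩ := exists_compact_between hKS hW' (inter_subset_right.trans hSW')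
    obtain ⟨η, h1, h2, -⟩ := exists_contMDiffMap_one_nhds_of_subset_interior (n := (⊤ : ℕ∞))
      𝓘(ℝ, Euc m) hKS.isClosed hQL
    have hs : tsupport η ⊆ L :=
      closure_minimal (fun x hx ↦ by_contra fun h ↦ hx (h2 x h)) hL.isClosed
    refine ⟨η, η.contMDiff.contDiff, hL.of_isClosed_subset (isClosed_tsupport _) hs,
      hs.trans hLW, fun x hx ↦ ?_⟩
    exact h1.filter_mono (nhds_le_nhdsSet hx)
  have hst : tsupport (fun x ↦ η x * ψ x) ⊆ tsupport η ∩ tsupport ψ :=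
    subset_inter (closure_mono fun x hx ↦ left_ne_zero_of_mul hx)
      (closure_mono fun x hx ↦ right_ne_zero_of_mul hx)
  have key := h.2.2 (fun x ↦ η x * ψ x) (hη1.mul h1) (h2.of_isClosed_subset (isClosed_tsupport _)
    (hst.trans inter_subset_right)) ((hst.trans inter_subset_left).trans hη3)
  have e1 : ∀ x, d x * (η x * ψ x) = d x * ψ x := by
    intro x
    by_cases hx : x ∈ tsupport ψ
    · by_cases hxS : x ∈ S
      · rw [(hη4 x ⟨hx, hxS⟩).self_of_nhds]; simp
      · rw [hd x (h3 hx) hxS]; simp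
    · rw [image_eq_zero_of_notMem_tsupport hx]; simp
  have e2 : ∀ x, f x * fderiv ℝ (fun x ↦ η x * ψ x) x (EuclideanSpace.single j 1) =
      f x * fderiv ℝ ψ x (EuclideanSpace.single j 1) := by
    intro x
    by_cases hx : x ∈ tsupport ψ
    · by_cases hxS : x ∈ S
      · have : (fun x ↦ η x * ψ x) =ᶠ[𝓝 x] ψ := by
          filter_upwards [hη4 x ⟨hx, hxS⟩] with y hy
          simp [hy]
        rw [this.fderiv_eq]
      · rw [hf x (h3 hx) hxS]; simp
    · have h5 := image_eq_zero_of_notMem_tsupport (f := fun x ↦ fderiv ℝ ψ x (EuclideanSpace.single j 1))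
        fun h ↦ hx (tsupport_fderiv_apply_subset ℝ _ h)
      have h6 := image_eq_zero_of_notMem_tsupport
        (f := fun x ↦ fderiv ℝ (fun x ↦ η x * ψ x) x (EuclideanSpace.single j 1))
        fun h ↦ hx ((hst.trans inter_subset_right) (tsupport_fderiv_apply_subset ℝ _ h))
      rw [h5, h6]
  simpa only [e1, e2] using key

end HasWeakPartial
end WeakPartial

/-! ### Weak derivatives under changes of variables -/

section ChangeOfVariables
variable {m : ℕ}

/-- `T` is a smooth diffeomorphism of the open set `W` onto the open set `V`, with inverse `S`. -/
structure IsDiffeoOn (T S : Euc m → Euc m) (W V : Set (Euc m)) : Prop where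
  isOpen_source : IsOpen W
  isOpen_target : IsOpen V
  contDiffOn : ContDiffOn ℝ ∞ T W
  contDiffOn_symm : ContDiffOn ℝ ∞ S V
  mapsTo : MapsTo T W V
  mapsTo_symm : MapsTo S V W
  left_inv : ∀ x ∈ W, S (T x) = x
  right_inv : ∀ y ∈ V, T (S y) = y

theorem locallyIntegrableOn_finsetSum {ι : Type*} {W : Set (Euc m)} (hW : IsOpen W) (s : Finset ι)
    {f : ι → Euc m → ℝ} (hf : ∀ i ∈ s, LocallyIntegrableOn (f i) W) :
    LocallyIntegrableOn (fun x ↦ ∑ i ∈ s, f i x) W := by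
  rw [locallyIntegrableOn_iff hW.isLocallyClosed]
  exact fun K hK hKc ↦ integrable_finsetSum s fun i hi ↦
    (hf i hi).integrableOn_compact_subset hK hKc

namespace IsDiffeoOn

variable {T S : Euc m → Euc m} {W V : Set (Euc m)}

theorem symm (h : IsDiffeoOn T S W V) : IsDiffeoOn S T V W :=
  ⟨h.2, h.1, h.4, h.3, h.6, h.5, h.8, h.7⟩

theorem injOn (h : IsDiffeoOn T S W V) : InjOn T W := fun x hx y hy hxy ↦ by
  rw [← h.left_inv x hx, ← h.left_inv y hy, hxy]

theorem image_eq (h : IsDiffeoOn T S W V) : T '' W = V :=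
  Subset.antisymm h.mapsTo.image_subset fun y hy ↦ ⟨S y, h.mapsTo_symm hy, h.right_inv y hy⟩

theorem differentiableAt (h : IsDiffeoOn T S W V) {x : Euc m} (hx : x ∈ W) :
    DifferentiableAt ℝ T x :=
  (h.contDiffOn.contDiffAt (h.isOpen_source.mem_nhds hx)).differentiableAt (by simp)

theorem hasFDerivAt (h : IsDiffeoOn T S W V) {x : Euc m} (hx : x ∈ W) :
    HasFDerivAt T (fderiv ℝ T x) x := (h.differentiableAt hx).hasFDerivAt

theorem fderiv_comp_fderiv (h : IsDiffeoOn T S W V) {x : Euc m} (hx : x ∈ W) :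
    fderiv ℝ S (T x) ∘L fderiv ℝ T x = ContinuousLinearMap.id ℝ _ := by
  have h1 : HasFDerivAt (S ∘ T) (fderiv ℝ S (T x) ∘L fderiv ℝ T x) x :=
    (h.symm.hasFDerivAt (h.mapsTo hx)).comp x (h.hasFDerivAt hx)
  have h2 : HasFDerivAt (S ∘ T) (ContinuousLinearMap.id ℝ _) x := by
    refine (hasFDerivAt_id x).congr_of_eventuallyEq ?_
    filter_upwards [h.isOpen_source.mem_nhds hx] with y hy
    exact h.left_inv y hy
  exact h1.unique h2

theorem det_ne_zero (h : IsDiffeoOn T S W V) {x : Euc m} (hx : x ∈ W) :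
    (fderiv ℝ T x).det ≠ 0 := by
  intro h0
  have h1 := congrArg (fun A : Euc m →L[ℝ] Euc m ↦ A.det) (h.fderiv_comp_fderiv hx)
  simp only [ContinuousLinearMap.det] at h1 h0
  rw [ContinuousLinearMap.toLinearMap_comp, LinearMap.det_comp, h0] at h1
  simp at h1

theorem contDiffOn_fderiv (h : IsDiffeoOn T S W V) : ContDiffOn ℝ ∞ (fun x ↦ fderiv ℝ T x) W :=
  h.contDiffOn.fderiv_of_isOpen h.isOpen_source (by simp)

theorem contDiffOn_partial (h : IsDiffeoOn T S W V) (v : Euc m) (r : Fin m) :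
    ContDiffOn ℝ ∞ (fun x ↦ (fderiv ℝ T x v) r) W :=
  (EuclideanSpace.proj (𝕜 := ℝ) r).contDiff.comp_contDiffOn
    (h.contDiffOn_fderiv.clm_apply contDiffOn_const)

theorem contDiffOn_abs_det (h : IsDiffeoOn T S W V) :
    ContDiffOn ℝ ∞ (fun x ↦ |(fderiv ℝ T x).det|) W := by
  have h1 : ContDiffOn ℝ ∞ (fun x ↦ (fderiv ℝ T x).det) W := by
    have : ∀ x, (fderiv ℝ T x).det = (Matrix.of fun i j ↦
        (fderiv ℝ T x (EuclideanSpace.single j 1)) i).det := by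
      intro x
      rw [ContinuousLinearMap.det, ← LinearMap.det_toMatrix (EuclideanSpace.basisFun (Fin m) ℝ).toBasis]
      congr 1
    simp only [this, Matrix.det_apply]
    refine ContDiffOn.sum fun σ _ ↦ ContDiffOn.const_smul _ ?_
    exact contDiffOn_prod fun i _ ↦ h.contDiffOn_partial _ _
  intro x hx
  exact ((h1 x hx).contDiffAt (h.isOpen_source.mem_nhds hx) |>.abs (h.det_ne_zero hx)).contDiffWithinAt

theorem integral_comp_eq (h : IsDiffeoOn T S W V) (g : Euc m → ℝ) :
    ∫ y in V, g y = ∫ x in W, |(fderiv ℝ T x).det| * g (T x) := by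
  rw [← h.image_eq, integral_image_eq_integral_abs_det_fderiv_smul volume
    h.isOpen_source.measurableSet (fun x hx ↦ (h.hasFDerivAt hx).hasFDerivWithinAt) h.injOn]
  simp

theorem continuousOn_inv_abs_det (h : IsDiffeoOn T S W V) :
    ContinuousOn (fun x ↦ |(fderiv ℝ T x).det|⁻¹) W :=
  h.contDiffOn_abs_det.continuousOn.inv₀ fun _ hx ↦ abs_ne_zero.2 (h.det_ne_zero hx)

theorem locallyIntegrableOn_comp (h : IsDiffeoOn T S W V) {g : Euc m → ℝ}
    (hg : LocallyIntegrableOn g V) : LocallyIntegrableOn (fun x ↦ g (T x)) W := by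
  rw [locallyIntegrableOn_iff h.isOpen_source.isLocallyClosed]
  intro K hK hKc
  have h1 : IntegrableOn g (T '' K) := hg.integrableOn_compact_subset
    ((image_mono hK).trans h.image_eq.subset) (hKc.image_of_continuousOn (h.contDiffOn.continuousOn.mono hK))
  rw [integrableOn_image_iff_integrableOn_abs_det_fderiv_smul volume hKc.measurableSet
    (fun x hx ↦ (h.hasFDerivAt (hK hx)).hasFDerivWithinAt) (h.injOn.mono hK)] at h1
  refine (h1.continuousOn_mul (h.continuousOn_inv_abs_det.mono hK) hKc).congr_fun ?_ hKc.measurableSet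
  intro x hx
  simp only [smul_eq_mul]
  rw [inv_mul_cancel_left₀ (abs_ne_zero.2 (h.det_ne_zero (hK hx)))]

/-- On a compact set, composition with a diffeomorphism is bounded in `L^p`. -/
theorem exists_eLpNorm_comp_le (h : IsDiffeoOn T S W V) {K : Set (Euc m)} (hKc : IsCompact K)
    (hK : K ⊆ W) {p : ℝ≥0∞} (hp0 : p ≠ 0) (hp : p ≠ ⊤) :
    ∃ C : ℝ≥0, ∀ g : Euc m → ℝ,
      eLpNorm (fun x ↦ g (T x)) p (volume.restrict K) ≤ C * eLpNorm g p (volume.restrict (T '' K)) := by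
  obtain ⟨c, hc⟩ : ∃ c : ℝ, ∀ x ∈ K, |(fderiv ℝ T x).det|⁻¹ ≤ c := by
    obtain ⟨c, hc⟩ := hKc.exists_bound_of_continuousOn (h.continuousOn_inv_abs_det.mono hK)
    exact ⟨c, fun x hx ↦ (le_abs_self _).trans (hc x hx)⟩
  have hp' : 0 < p.toReal := ENNReal.toReal_pos hp0 hp
  refine ⟨(Real.toNNReal c) ^ (1 / p.toReal), fun g ↦ ?_⟩
  rw [eLpNorm_eq_lintegral_rpow_enorm_toReal hp0 hp, eLpNorm_eq_lintegral_rpow_enorm_toReal hp0 hp,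
    lintegral_image_eq_lintegral_abs_det_fderiv_mul volume hKc.measurableSet
      (fun x hx ↦ (h.hasFDerivAt (hK hx)).hasFDerivWithinAt) (h.injOn.mono hK),
    ENNReal.coe_rpow_of_nonneg _ (by positivity), ← ENNReal.mul_rpow_of_nonneg _ _ (by positivity),
    ← lintegral_const_mul' _ _ ENNReal.coe_ne_top]
  refine ENNReal.rpow_le_rpow ?_ (by positivity)
  refine setLIntegral_mono' hKc.measurableSet fun x hx ↦ ?_
  rw [← mul_assoc]
  have h1 : (1 : ℝ≥0∞) ≤ (Real.toNNReal c : ℝ≥0∞) * ENNReal.ofReal |(fderiv ℝ T x).det| := by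
    change 1 ≤ ENNReal.ofReal c * _
    have h2 := abs_pos.2 (h.det_ne_zero (hK hx))
    rw [← ENNReal.ofReal_mul' h2.le, ← ENNReal.ofReal_one]
    apply ENNReal.ofReal_le_ofReal
    have := hc x hx
    rwa [inv_le_iff_one_le_mul₀ h2] at this
  calc _ = 1 * ‖g (T x)‖ₑ ^ p.toReal := (one_mul _).symm
    _ ≤ _ := by gcongr

end IsDiffeoOn

theorem setIntegral_mul_eq {W : Set (Euc m)} {f φ : Euc m → ℝ}
    (hs : tsupport φ ⊆ W) : ∫ x in W, f x * φ x = ∫ x, f x * φ x := by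
  refine setIntegral_eq_integral_of_forall_compl_eq_zero fun x hx ↦ ?_
  rw [image_eq_zero_of_notMem_tsupport fun h ↦ hx (hs h), mul_zero]

theorem integral_mul_fderiv_eq_neg {u v : Euc m → ℝ} (hu : ContDiff ℝ ∞ u) (hv : ContDiff ℝ ∞ v)
    (hvc : HasCompactSupport v) (e : Euc m) :
    ∫ x, u x * fderiv ℝ v x e = - ∫ x, fderiv ℝ u x e * v x := by
  have c1 := HasWeakPartial.continuous_fderiv_apply hu e
  have c2 := HasWeakPartial.continuous_fderiv_apply hv e
  have s2 := HasWeakPartial.hasCompactSupport_fderiv_apply hvc e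
  refine integral_mul_fderiv_eq_neg_fderiv_mul_of_integrable ?_ ?_ ?_
    (fun x _ ↦ hu.differentiable (by simp) x) (fun x _ ↦ hv.differentiable (by simp) x)
  · exact (c1.mul hv.continuous).integrable_of_hasCompactSupport hvc.mul_left
  · exact (hu.continuous.mul c2).integrable_of_hasCompactSupport s2.mul_left
  · exact (hu.continuous.mul hv.continuous).integrable_of_hasCompactSupport hvc.mul_left

theorem fderiv_apply_eq_sum {h : Euc m → ℝ} {x : Euc m} (v : Euc m) :
    fderiv ℝ h x v = ∑ r, fderiv ℝ h x (EuclideanSpace.single r 1) * v r := by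
  conv_lhs => rw [← (EuclideanSpace.basisFun (Fin m) ℝ).sum_repr v]
  simp [mul_comm]

/-- The chain rule for weak derivatives. The Piola identity, which says that
`Q = (∂_j ψ ∘ S) |det DS|` is the divergence of the field `P` below, follows by duality from the
classical chain rule for test functions. -/
theorem HasWeakPartial.comp_diffeo {T S : Euc m → Euc m} {W V : Set (Euc m)}
    (H : IsDiffeoOn T S W V) {f : Euc m → ℝ} {d : Fin m → Euc m → ℝ}
    (h : ∀ r, HasWeakPartial V r f (d r)) (j : Fin m) :
    HasWeakPartial W j (fun x ↦ f (T x))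
      (fun x ↦ ∑ r, (fderiv ℝ T x (EuclideanSpace.single j 1)) r * d r (T x)) := by
  set e : Euc m := EuclideanSpace.single j 1 with he
  have hWm := H.isOpen_source.measurableSet
  have hVm := H.isOpen_target.measurableSet
  have li : ∀ r, LocallyIntegrableOn (fun x ↦ (fderiv ℝ T x e) r * d r (T x)) W := fun r ↦
    locallyIntegrableOn_continuousOn_mul H.isOpen_source (H.contDiffOn_partial e r).continuousOn
      (H.locallyIntegrableOn_comp (h r).2.1)
  by_cases hm : m = 0
  · subst hm; exact j.elim0
  have hf : LocallyIntegrableOn f V := (h ⟨0, Nat.pos_of_ne_zero hm⟩).1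
  refine ⟨H.locallyIntegrableOn_comp hf, ?_, fun ψ h1 h2 h3 ↦ ?_⟩
  · exact locallyIntegrableOn_finsetSum H.isOpen_source _ fun r _ ↦ li r
  set J : Euc m → ℝ := fun y ↦ |(fderiv ℝ S y).det| with hJ
  set K := T '' tsupport ψ with hKdef
  have hKc : IsCompact K := IsCompact.image_of_continuousOn h2 (H.contDiffOn.continuousOn.mono h3)
  have hKV : K ⊆ V := (image_mono h3).trans H.image_eq.subset
  have hSK : ∀ y ∈ V, y ∉ K → S y ∉ tsupport ψ := fun y hy hyK hS ↦
    hyK ⟨S y, hS, H.right_inv y hy⟩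
  set p : Fin m → Euc m → ℝ := fun r y ↦ (fderiv ℝ T (S y) e) r * ψ (S y) * J y with hp
  have hpK : ∀ r, ∀ y ∈ V, y ∉ K → p r y = 0 := fun r y hy hyK ↦ by
    simp [hp, image_eq_zero_of_notMem_tsupport (hSK y hy hyK)]
  have hpV : ∀ r, ContDiffOn ℝ ∞ (p r) V := fun r ↦
    (((H.contDiffOn_partial e r).comp H.contDiffOn_symm H.mapsTo_symm).mul
      (h1.comp_contDiffOn H.contDiffOn_symm)).mul H.symm.contDiffOn_abs_det
  have hP := fun r ↦ contDiff_indicator_of_isCompact H.isOpen_target hKc hKV (hpV r) (hpK r)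
  set P : Fin m → Euc m → ℝ := fun r ↦ V.indicator (p r) with hPdef
  set q : Euc m → ℝ := fun y ↦ fderiv ℝ ψ (S y) e * J y with hq
  have hqK : ∀ y ∈ V, y ∉ K → q y = 0 := fun y hy hyK ↦ by
    have := image_eq_zero_of_notMem_tsupport (f := fun x ↦ fderiv ℝ ψ x e)
      (fun hh ↦ hSK y hy hyK (tsupport_fderiv_apply_subset ℝ e hh))
    simp only [hq, this, zero_mul]
  have hqV : ContDiffOn ℝ ∞ q V :=
    ((contDiffOn_fderiv_apply isOpen_univ h1.contDiffOn e).comp (t := univ) H.contDiffOn_symm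
      (fun _ _ ↦ mem_univ _)).mul H.symm.contDiffOn_abs_det
  obtain ⟨hQ1, hQ2, hQ3⟩ := contDiff_indicator_of_isCompact H.isOpen_target hKc hKV hqV hqK
  set Q : Euc m → ℝ := V.indicator q with hQdef
  -- transport of integrals against `P` and `Q`
  have trP : ∀ r (u : Euc m → ℝ), ∫ y, u y * P r y =
      ∫ x in W, ((fderiv ℝ T x e) r * u (T x)) * ψ x := by
    intro r u
    rw [← setIntegral_mul_eq ((hP r).2.2.trans hKV), H.symm.integral_comp_eq
      (fun x ↦ ((fderiv ℝ T x e) r * u (T x)) * ψ x)]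
    refine setIntegral_congr_fun hVm fun y hy ↦ ?_
    simp only [indicator_of_mem hy, hp, H.right_inv y hy]
    ring
  have trQ : ∀ u : Euc m → ℝ, ∫ y, u y * Q y = ∫ x in W, u (T x) * fderiv ℝ ψ x e := by
    intro u
    rw [← setIntegral_mul_eq (hQ3.trans hKV), H.symm.integral_comp_eq
      (fun x ↦ u (T x) * fderiv ℝ ψ x e)]
    refine setIntegral_congr_fun hVm fun y hy ↦ ?_
    simp only [hQdef, indicator_of_mem hy, hq, H.right_inv y hy]
    ring
  -- the divergence of `P` is `Q`, as seen by testing with `u` and integrating by parts in `W`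
  have piola : ∀ᵐ y, y ∈ V → Q y - ∑ r, fderiv ℝ (P r) y (EuclideanSpace.single r 1) = 0 := by
    have hcont : Continuous fun y ↦ Q y - ∑ r, fderiv ℝ (P r) y (EuclideanSpace.single r 1) :=
      hQ1.continuous.sub (continuous_finsetSum _ fun r _ ↦ continuous_fderiv_apply (hP r).1 _)
    refine H.isOpen_target.ae_eq_zero_of_integral_contDiff_smul_eq_zero
      (hcont.locallyIntegrable.locallyIntegrableOn V) fun u hu1 hu2 hu3 ↦ ?_
    have i1 : Integrable fun y ↦ u y * Q y :=
      (hu1.continuous.mul hQ1.continuous).integrable_of_hasCompactSupport hu2.mul_right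
    have i2 : ∀ r, Integrable fun y ↦ u y * fderiv ℝ (P r) y (EuclideanSpace.single r 1) := fun r ↦
      (hu1.continuous.mul (continuous_fderiv_apply (hP r).1 _)).integrable_of_hasCompactSupport
        hu2.mul_right
    simp only [smul_eq_mul, mul_sub, Finset.mul_sum]
    rw [integral_sub i1 (integrable_finsetSum _ fun r _ ↦ i2 r), integral_finsetSum _ fun r _ ↦ i2 r,
      sub_eq_zero]
    have hKu : IsCompact (S '' tsupport u) :=
      IsCompact.image_of_continuousOn hu2 (H.contDiffOn_symm.continuousOn.mono hu3)
    have hKuW : S '' tsupport u ⊆ W := (image_mono hu3).trans H.symm.image_eq.subset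
    obtain ⟨hw1, hw2, hw3⟩ := contDiff_indicator_of_isCompact H.isOpen_source hKu hKuW
      (p := fun x ↦ u (T x)) (hu1.comp_contDiffOn H.contDiffOn) (fun x hx hxK ↦ by
        refine image_eq_zero_of_notMem_tsupport fun hh ↦ hxK ⟨T x, hh, H.left_inv x hx⟩)
    set w := W.indicator fun x ↦ u (T x)
    have hwW : ∀ x ∈ W, fderiv ℝ w x e
        = ∑ r, (fderiv ℝ T x e) r * fderiv ℝ u (T x) (EuclideanSpace.single r 1) := by
      intro x hx
      have h4 : w =ᶠ[𝓝 x] u ∘ T := by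
        filter_upwards [H.isOpen_source.mem_nhds hx] with y hy
        exact indicator_of_mem hy _
      rw [h4.fderiv_eq, fderiv_comp x (hu1.differentiable (by simp) _) (H.differentiableAt hx),
        ContinuousLinearMap.comp_apply, fderiv_apply_eq_sum]
      simp only [mul_comm]
    calc ∫ y, u y * Q y = ∫ x in W, u (T x) * fderiv ℝ ψ x e := trQ u
      _ = ∫ x in W, w x * fderiv ℝ ψ x e := by
          refine setIntegral_congr_fun hWm fun x hx ↦ ?_
          simp only [w, indicator_of_mem hx]
      _ = ∫ x, w x * fderiv ℝ ψ x e :=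
          setIntegral_mul_eq ((tsupport_fderiv_apply_subset ℝ e).trans h3)
      _ = - ∫ x, fderiv ℝ w x e * ψ x := integral_mul_fderiv_eq_neg hw1 h1 h2 e
      _ = - ∫ x in W, fderiv ℝ w x e * ψ x := by rw [setIntegral_mul_eq h3]
      _ = - ∫ x in W, ∑ r, ((fderiv ℝ T x e) r * fderiv ℝ u (T x) (EuclideanSpace.single r 1)) * ψ x := by
          congr 1
          refine setIntegral_congr_fun hWm fun x hx ↦ ?_
          simp only [hwW x hx, Finset.sum_mul]
      _ = - ∑ r, ∫ x in W, ((fderiv ℝ T x e) r * fderiv ℝ u (T x) (EuclideanSpace.single r 1)) * ψ x := by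
          rw [integral_finsetSum]
          intro r _
          refine (integrable_mul_of_locallyIntegrableOn (W := W) ?_ h1.continuous h2 h3).integrableOn
          exact locallyIntegrableOn_continuousOn_mul H.isOpen_source
            (H.contDiffOn_partial e r).continuousOn (H.locallyIntegrableOn_comp
              ((continuous_fderiv_apply hu1 _).locallyIntegrable.locallyIntegrableOn V))
      _ = ∑ r, ∫ y, u y * fderiv ℝ (P r) y (EuclideanSpace.single r 1) := by
          rw [← Finset.sum_neg_distrib]
          refine Finset.sum_congr rfl fun r _ ↦ ?_
          rw [integral_mul_fderiv_eq_neg hu1 (hP r).1 (hP r).2.1, trP r]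
  rw [← setIntegral_mul_eq ((tsupport_fderiv_apply_subset ℝ e).trans h3),
    ← setIntegral_mul_eq h3]
  calc ∫ x in W, f (T x) * fderiv ℝ ψ x e = ∫ y, f y * Q y := (trQ f).symm
    _ = ∫ y, ∑ r, f y * fderiv ℝ (P r) y (EuclideanSpace.single r 1) := by
        refine integral_congr_ae ?_
        filter_upwards [piola] with y hy
        by_cases hyV : y ∈ V
        · rw [← Finset.mul_sum, ← sub_eq_zero.1 (hy hyV)]
        · have e1 : Q y = 0 := indicator_of_notMem hyV _
          have e2 : ∀ r, fderiv ℝ (P r) y (EuclideanSpace.single r 1) = 0 := fun r ↦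
            image_eq_zero_of_notMem_tsupport (f := fun y ↦ fderiv ℝ (P r) y (EuclideanSpace.single r 1))
              fun hh ↦ hyV (hKV ((hP r).2.2 (tsupport_fderiv_apply_subset ℝ _ hh)))
          simp [e1, e2]
    _ = ∑ r, ∫ y, f y * fderiv ℝ (P r) y (EuclideanSpace.single r 1) := by
        refine integral_finsetSum _ fun r _ ↦ ?_
        exact integrable_mul_of_locallyIntegrableOn hf (continuous_fderiv_apply (hP r).1 _)
          (hasCompactSupport_fderiv_apply (hP r).2.1 _)
          ((tsupport_fderiv_apply_subset ℝ _).trans ((hP r).2.2.trans hKV))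
    _ = ∑ r, - ∫ x in W, ((fderiv ℝ T x e) r * d r (T x)) * ψ x := by
        refine Finset.sum_congr rfl fun r _ ↦ ?_
        rw [(h r).2.2 (P r) (hP r).1 (hP r).2.1 ((hP r).2.2.trans hKV), trP r]
    _ = - ∫ x in W, (∑ r, (fderiv ℝ T x e) r * d r (T x)) * ψ x := by
        simp only [Finset.sum_mul]
        rw [integral_finsetSum, Finset.sum_neg_distrib]
        intro r _
        exact (integrable_mul_of_locallyIntegrableOn (li r) h1.continuous h2 h3).integrableOn

end ChangeOfVariables

/-! ### Vector fields and the metric in charts -/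

section Charts

theorem contMDiff_const_section {E : Type*} [NormedAddCommGroup E] [NormedSpace ℝ E] (a : E) :
    ContMDiff 𝓘(ℝ, E) 𝓘(ℝ, E).tangent ∞
      (fun x : E ↦ (⟨x, a⟩ : TangentBundle 𝓘(ℝ, E) E)) :=
  contMDiff_vectorSpace_iff_contDiff.2 contDiff_const

variable {m : ℕ} {M : Type*} [TopologicalSpace M] [ChartedSpace (Euc m) M]

theorem mdifferentiable_of_mem_smoothCharts {φ : OpenPartialHomeomorph M (Euc m)}
    (hφ : φ ∈ smoothCharts m M) :
    φ.MDifferentiable 𝓘(ℝ, Euc m) 𝓘(ℝ, Euc m) :=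
  ⟨(contMDiffOn_of_mem_maximalAtlas hφ).mdifferentiableOn (by simp),
    (contMDiffOn_symm_of_mem_maximalAtlas hφ).mdifferentiableOn (by simp)⟩

/-- The transition map from the chart `φ` to the chart `φ'`. -/
def trans (φ φ' : OpenPartialHomeomorph M (Euc m)) (x : Euc m) : Euc m := φ' (φ.symm x)

/-- The part of the chart `φ` that is covered by the chart `φ'`, in coordinates. -/
def overlap (φ φ' : OpenPartialHomeomorph M (Euc m)) : Set (Euc m) :=
  φ.target ∩ φ.symm ⁻¹' φ'.source

theorem isDiffeoOn_trans {φ φ' : OpenPartialHomeomorph M (Euc m)}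
    (hφ : φ ∈ smoothCharts m M) (hφ' : φ' ∈ smoothCharts m M) :
    IsDiffeoOn (trans φ φ') (trans φ' φ) (overlap φ φ') (overlap φ' φ) := by
  have key : ∀ {φ φ' : OpenPartialHomeomorph M (Euc m)}, φ ∈ smoothCharts m M →
      φ' ∈ smoothCharts m M → ContDiffOn ℝ ∞ (trans φ φ') (overlap φ φ') := by
    intro φ φ' hφ hφ'
    rw [← contMDiffOn_iff_contDiffOn]
    exact (contMDiffOn_of_mem_maximalAtlas hφ').comp
      ((contMDiffOn_symm_of_mem_maximalAtlas hφ).mono inter_subset_left) inter_subset_right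
  refine ⟨φ.symm.isOpen_inter_preimage φ'.open_source, φ'.symm.isOpen_inter_preimage φ.open_source,
    key hφ hφ', key hφ' hφ, ?_, ?_, ?_, ?_⟩
  · exact fun x hx ↦ ⟨φ'.map_source hx.2, by
      simp only [mem_preimage, trans, φ'.left_inv hx.2]; exact φ.map_target hx.1⟩
  · exact fun x hx ↦ ⟨φ.map_source hx.2, by
      simp only [mem_preimage, trans, φ.left_inv hx.2]; exact φ'.map_target hx.1⟩
  · exact fun x hx ↦ by simp only [trans, φ'.left_inv hx.2, φ.right_inv hx.1]
  · exact fun x hx ↦ by simp only [trans, φ.left_inv hx.2, φ'.right_inv hx.1]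

/-- The components of a vector field in the chart `φ`, as a vector. -/
def compVec (φ : OpenPartialHomeomorph M (Euc m)) (u : VField m M) (x : Euc m) : Euc m :=
  mfderiv 𝓘(ℝ, Euc m) 𝓘(ℝ, Euc m) φ (φ.symm x) (u (φ.symm x))

theorem compVec_apply (φ : OpenPartialHomeomorph M (Euc m)) (u : VField m M) (x : Euc m)
    (l : Fin m) : compVec φ u x l = comp φ u l x := rfl

theorem compVec_chart {φ : OpenPartialHomeomorph M (Euc m)} (u : VField m M) {p : M}
    (hp : p ∈ φ.source) :
    compVec φ u (φ p) = mfderiv 𝓘(ℝ, Euc m) 𝓘(ℝ, Euc m) φ p (u p) := by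
  have : ∀ q, q = p → (mfderiv 𝓘(ℝ, Euc m) 𝓘(ℝ, Euc m) φ q (u q) : Euc m)
      = (mfderiv 𝓘(ℝ, Euc m) 𝓘(ℝ, Euc m) φ p (u p) : Euc m) := by rintro _ rfl; rfl
  exact this _ (φ.left_inv hp)

theorem mfderiv_symm_compVec {φ : OpenPartialHomeomorph M (Euc m)} (hφ : φ ∈ smoothCharts m M)
    (u : VField m M) {x : Euc m} (hx : x ∈ φ.target) :
    mfderiv 𝓘(ℝ, Euc m) 𝓘(ℝ, Euc m) φ.symm x (compVec φ u x) = u (φ.symm x) := by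
  have h := (mdifferentiable_of_mem_smoothCharts hφ).symm_comp_deriv (φ.map_target hx)
  have h2 := congrArg (fun A : Euc m →L[ℝ] Euc m ↦ A (u (φ.symm x))) h
  have : ∀ z, z = x → (mfderiv 𝓘(ℝ, Euc m) 𝓘(ℝ, Euc m) φ.symm z
      (mfderiv 𝓘(ℝ, Euc m) 𝓘(ℝ, Euc m) φ (φ.symm x) (u (φ.symm x)) : Euc m) : Euc m)
      = (mfderiv 𝓘(ℝ, Euc m) 𝓘(ℝ, Euc m) φ.symm x (compVec φ u x) : Euc m) := by
    rintro _ rfl; rfl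
  exact (this _ (φ.right_inv hx)).symm.trans h2

theorem mfderiv_mfderiv_symm {φ : OpenPartialHomeomorph M (Euc m)} (hφ : φ ∈ smoothCharts m M)
    {x : Euc m} (hx : x ∈ φ.target) (a : Euc m) :
    (mfderiv 𝓘(ℝ, Euc m) 𝓘(ℝ, Euc m) φ (φ.symm x)
      (mfderiv 𝓘(ℝ, Euc m) 𝓘(ℝ, Euc m) φ.symm x a) : Euc m) = a :=
  congrArg (fun A : Euc m →L[ℝ] Euc m ↦ A a)
    ((mdifferentiable_of_mem_smoothCharts hφ).comp_symm_deriv hx)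

theorem mfderiv_mfderiv_symm_trans {φ φ' : OpenPartialHomeomorph M (Euc m)}
    (hφ : φ ∈ smoothCharts m M) (hφ' : φ' ∈ smoothCharts m M) {x : Euc m}
    (hx : x ∈ overlap φ φ') (a : Euc m) :
    (mfderiv 𝓘(ℝ, Euc m) 𝓘(ℝ, Euc m) φ' (φ.symm x)
      (mfderiv 𝓘(ℝ, Euc m) 𝓘(ℝ, Euc m) φ.symm x a) : Euc m) = fderiv ℝ (trans φ φ') x a := by
  have h := mfderiv_comp x ((mdifferentiable_of_mem_smoothCharts hφ').mdifferentiableAt hx.2)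
    ((mdifferentiable_of_mem_smoothCharts hφ).mdifferentiableAt_symm hx.1)
  rw [mfderiv_eq_fderiv] at h
  exact (congrArg (fun A : Euc m →L[ℝ] Euc m ↦ A a) h).symm

/-- The transformation law of vector fields. -/
theorem compVec_trans {φ φ' : OpenPartialHomeomorph M (Euc m)} (hφ : φ ∈ smoothCharts m M)
    (hφ' : φ' ∈ smoothCharts m M) (u : VField m M) {x : Euc m} (hx : x ∈ overlap φ φ') :
    compVec φ' u (trans φ φ' x) = fderiv ℝ (trans φ φ') x (compVec φ u x) := by
  rw [← mfderiv_mfderiv_symm_trans hφ hφ' hx, mfderiv_symm_compVec hφ u hx.1]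
  exact compVec_chart u hx.2

variable [IsManifold 𝓘(ℝ, Euc m) ∞ M]

/-- The metric in the chart `φ`, as a bilinear form. -/
def metricForm (g : RMetric m M) (φ : OpenPartialHomeomorph M (Euc m)) (x : Euc m) :
    Euc m →L[ℝ] Euc m →L[ℝ] ℝ :=
  ContinuousLinearMap.bilinearComp (E := Euc m) (F := Euc m) (E' := Euc m) (F' := Euc m)
    (g.inner (φ.symm x))
    (mfderiv 𝓘(ℝ, Euc m) 𝓘(ℝ, Euc m) φ.symm x) (mfderiv 𝓘(ℝ, Euc m) 𝓘(ℝ, Euc m) φ.symm x)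

theorem metricForm_apply (g : RMetric m M) (φ : OpenPartialHomeomorph M (Euc m)) (x a b : Euc m) :
    metricForm g φ x a b = g.inner (φ.symm x)
      (mfderiv 𝓘(ℝ, Euc m) 𝓘(ℝ, Euc m) φ.symm x a)
      (mfderiv 𝓘(ℝ, Euc m) 𝓘(ℝ, Euc m) φ.symm x b) := rfl

theorem gMat_apply (g : RMetric m M) (φ : OpenPartialHomeomorph M (Euc m)) (x : Euc m)
    (j k : Fin m) : gMat g φ x j k =
      metricForm g φ x (EuclideanSpace.single j 1) (EuclideanSpace.single k 1) := rfl

theorem inner_eq_metricForm (g : RMetric m M) {φ : OpenPartialHomeomorph M (Euc m)}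
    (hφ : φ ∈ smoothCharts m M) (u v : VField m M) {x : Euc m} (hx : x ∈ φ.target) :
    g.inner (φ.symm x) (u (φ.symm x)) (v (φ.symm x))
      = metricForm g φ x (compVec φ u x) (compVec φ v x) := by
  rw [metricForm_apply, mfderiv_symm_compVec hφ u hx, mfderiv_symm_compVec hφ v hx]

theorem metricForm_trans (g : RMetric m M) {φ φ' : OpenPartialHomeomorph M (Euc m)}
    (hφ : φ ∈ smoothCharts m M) (hφ' : φ' ∈ smoothCharts m M) {x : Euc m}
    (hx : x ∈ overlap φ φ') (a b : Euc m) :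
    metricForm g φ x a b = metricForm g φ' (trans φ φ' x)
      (fderiv ℝ (trans φ φ') x a) (fderiv ℝ (trans φ φ') x b) := by
  rw [← mfderiv_mfderiv_symm_trans hφ hφ' hx a, ← mfderiv_mfderiv_symm_trans hφ hφ' hx b]
  have h : ∀ (p : M) (hp : p ∈ φ'.source) (v w : TangentSpace 𝓘(ℝ, Euc m) p),
      g.inner p v w = metricForm g φ' (φ' p) (mfderiv 𝓘(ℝ, Euc m) 𝓘(ℝ, Euc m) φ' p v)
        (mfderiv 𝓘(ℝ, Euc m) 𝓘(ℝ, Euc m) φ' p w) := by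
    intro p hp v w
    have h1 := (mdifferentiable_of_mem_smoothCharts hφ').symm_comp_deriv hp
    have hv := congrArg (fun A : Euc m →L[ℝ] Euc m ↦ A v) h1
    have hw := congrArg (fun A : Euc m →L[ℝ] Euc m ↦ A w) h1
    have h2 : ∀ q, q = p → ∀ v' w' : Euc m, v' = v → w' = w →
        g.inner p v w = g.inner q v' w' := by rintro _ rfl _ _ rfl rfl; rfl
    exact h2 _ (φ'.left_inv hp) _ _ hv hw
  exact h _ hx.2 _ _

theorem metricForm_symm (g : RMetric m M) (φ : OpenPartialHomeomorph M (Euc m)) (x a b : Euc m) :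
    metricForm g φ x a b = metricForm g φ x b a := g.symm _ _ _

theorem metricForm_pos (g : RMetric m M) {φ : OpenPartialHomeomorph M (Euc m)}
    (hφ : φ ∈ smoothCharts m M) {x : Euc m} (hx : x ∈ φ.target) {a : Euc m} (ha : a ≠ 0) :
    0 < metricForm g φ x a a := by
  refine g.pos _ _ fun h0 ↦ ha ?_
  rw [← mfderiv_mfderiv_symm hφ hx a]
  have h1 : (mfderiv 𝓘(ℝ, Euc m) 𝓘(ℝ, Euc m) φ.symm x a : Euc m) = (0 : Euc m) := h0
  have h2 := congrArg (mfderiv 𝓘(ℝ, Euc m) 𝓘(ℝ, Euc m) φ (φ.symm x) : Euc m →L[ℝ] Euc m) h1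
  exact h2.trans (ContinuousLinearMap.map_zero _)

theorem contDiffOn_metricForm (g : RMetric m M) {φ : OpenPartialHomeomorph M (Euc m)}
    (hφ : φ ∈ smoothCharts m M) : ContDiffOn ℝ ∞ (metricForm g φ) φ.target := by
  rw [contDiffOn_clm_apply]
  intro a
  rw [contDiffOn_clm_apply]
  intro b
  rw [← contMDiffOn_iff_contDiffOn]
  have hsec : ∀ a : Euc m, ContMDiffOn 𝓘(ℝ, Euc m) 𝓘(ℝ, Euc m).tangent ∞
      (fun x ↦ (⟨φ.symm x, mfderiv 𝓘(ℝ, Euc m) 𝓘(ℝ, Euc m) φ.symm x a⟩ :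
        TangentBundle 𝓘(ℝ, Euc m) M)) φ.target := by
    intro a
    have h1 := (contMDiffOn_symm_of_mem_maximalAtlas hφ).contMDiffOn_tangentMapWithin
      (m := ∞) (by simp) φ.open_target.uniqueMDiffOn
    have h2 : ContMDiff 𝓘(ℝ, Euc m) 𝓘(ℝ, Euc m).tangent ∞
        (fun x : Euc m ↦ (⟨x, a⟩ : TangentBundle 𝓘(ℝ, Euc m) (Euc m))) := by
      exact contMDiff_const_section a
    refine (h1.comp h2.contMDiffOn (fun x hx ↦ hx)).congr fun x hx ↦ ?_
    simp only [Function.comp, tangentMapWithin, mfderivWithin_of_isOpen φ.open_target hx]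
  intro x hx
  have : ContMDiffWithinAt 𝓘(ℝ, Euc m) (𝓘(ℝ, Euc m).prod 𝓘(ℝ)) ∞
      (fun x ↦ Bundle.TotalSpace.mk' ℝ (E := Bundle.Trivial M ℝ) (φ.symm x)
        (g.inner (φ.symm x) (mfderiv 𝓘(ℝ, Euc m) 𝓘(ℝ, Euc m) φ.symm x a)
          (mfderiv 𝓘(ℝ, Euc m) 𝓘(ℝ, Euc m) φ.symm x b))) φ.target x := by
    apply ContMDiffWithinAt.clm_bundle_apply₂ (F₁ := Euc m) (F₂ := Euc m)
    · exact ContMDiffAt.comp_contMDiffWithinAt x g.contMDiff.contMDiffAt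
        (contMDiffOn_symm_of_mem_maximalAtlas hφ x hx)
    · exact hsec a x hx
    · exact hsec b x hx
  simp only [Bundle.contMDiffWithinAt_totalSpace] at this
  exact this.2

end Charts

/-! ### The Christoffel symbols under changes of charts -/

section Christoffel

theorem map_eq_sum_smul_single {m : ℕ} {F : Type*} [NormedAddCommGroup F] [NormedSpace ℝ F]
    (f : Euc m →L[ℝ] F) (a : Euc m) : f a = ∑ i, a i • f (EuclideanSpace.single i 1) := by
  conv_lhs => rw [← (EuclideanSpace.basisFun (Fin m) ℝ).sum_repr a]
  simp

variable {m : ℕ} {M : Type*} [TopologicalSpace M] [ChartedSpace (Euc m) M]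
  [IsManifold 𝓘(ℝ, Euc m) ∞ M]

theorem differentiableAt_metricForm (g : RMetric m M) {φ : OpenPartialHomeomorph M (Euc m)}
    (hφ : φ ∈ smoothCharts m M) {x : Euc m} (hx : x ∈ φ.target) :
    DifferentiableAt ℝ (metricForm g φ) x :=
  ((contDiffOn_metricForm g hφ).contDiffAt (φ.open_target.mem_nhds hx)).differentiableAt (by simp)

theorem dg_eq_fderiv_metricForm (g : RMetric m M) {φ : OpenPartialHomeomorph M (Euc m)}
    (hφ : φ ∈ smoothCharts m M) {x : Euc m} (hx : x ∈ φ.target) (i j k : Fin m) :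
    dg g φ i j k x = fderiv ℝ (metricForm g φ) x (EuclideanSpace.single i 1)
      (EuclideanSpace.single j 1) (EuclideanSpace.single k 1) := by
  have h := (differentiableAt_metricForm g hφ hx).hasFDerivAt
  have h1 := (h.clm_apply (hasFDerivAt_const (EuclideanSpace.single j (1 : ℝ)) x)).clm_apply
    (hasFDerivAt_const (EuclideanSpace.single k (1 : ℝ)) x)
  have h2 : fderiv ℝ (fun y ↦ gMat g φ y j k) x = _ := h1.fderiv
  rw [dg, h2]
  simp

/-- The matrix of the metric is invertible. -/
theorem isUnit_det_gMat (g : RMetric m M) {φ : OpenPartialHomeomorph M (Euc m)}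
    (hφ : φ ∈ smoothCharts m M) {x : Euc m} (hx : x ∈ φ.target) : IsUnit (gMat g φ x).det := by
  rw [isUnit_iff_ne_zero]
  intro h0
  obtain ⟨v, hv, hv0⟩ := Matrix.exists_mulVec_eq_zero_iff.2 h0
  have hne : WithLp.toLp 2 v ≠ (0 : Euc m) := fun h ↦ hv (by simpa using h)
  have hpos := metricForm_pos g hφ hx hne
  have : metricForm g φ x (WithLp.toLp 2 v) (WithLp.toLp 2 v)
      = ∑ j, v j * (gMat g φ x).mulVec v j := by
    rw [map_eq_sum_smul_single (metricForm g φ x)]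
    simp only [sum_apply, smul_apply, smul_eq_mul]
    refine Finset.sum_congr rfl fun j _ ↦ ?_
    rw [map_eq_sum_smul_single (metricForm g φ x _)]
    simp only [Matrix.mulVec, dotProduct, gMat_apply, smul_eq_mul, mul_comm]
  rw [this, hv0] at hpos
  simp at hpos

/-- The Christoffel symbols as a bilinear map: `Γ(a, b)^k = Γ^k_{rj} a^r b^j`. -/
def christoffelVec (g : RMetric m M) (φ : OpenPartialHomeomorph M (Euc m)) (x a b : Euc m) :
    Euc m :=
  WithLp.toLp 2 fun k ↦ ∑ r, ∑ j, christoffel g φ k r j x * a r * b j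

theorem christoffelVec_apply (g : RMetric m M) (φ : OpenPartialHomeomorph M (Euc m))
    (x a b : Euc m) (k : Fin m) :
    christoffelVec g φ x a b k = ∑ r, ∑ j, christoffel g φ k r j x * a r * b j := rfl

theorem metricForm_christoffel_single (g : RMetric m M) {φ : OpenPartialHomeomorph M (Euc m)}
    (hφ : φ ∈ smoothCharts m M) {x : Euc m} (hx : x ∈ φ.target) (q r j : Fin m) :
    ∑ k, christoffel g φ k r j x * gMat g φ x q k
      = (1 / 2) * (dg g φ j q r x + dg g φ r q j x - dg g φ q r j x) := by
  set K : Fin m → ℝ := fun i ↦ dg g φ j i r x + dg g φ r i j x - dg g φ i r j x with hK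
  have h := congrFun (Matrix.mulVec_mulVec K (gMat g φ x) (gMat g φ x)⁻¹) q
  rw [Matrix.mul_nonsing_inv _ (isUnit_det_gMat g hφ hx), Matrix.one_mulVec] at h
  have h3 : (1 / 2) * K q = (1 / 2) * ∑ k, gMat g φ x q k * ∑ i, (gMat g φ x)⁻¹ k i * K i := by
    rw [← h]; rfl
  simp only [hK] at h3
  rw [h3, Finset.mul_sum]
  refine Finset.sum_congr rfl fun k _ ↦ ?_
  rw [christoffel]; ring

/-- The Koszul formula. -/
theorem metricForm_christoffelVec (g : RMetric m M) {φ : OpenPartialHomeomorph M (Euc m)}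
    (hφ : φ ∈ smoothCharts m M) {x : Euc m} (hx : x ∈ φ.target) (a b c : Euc m) :
    2 * metricForm g φ x c (christoffelVec g φ x a b)
      = fderiv ℝ (metricForm g φ) x b c a + fderiv ℝ (metricForm g φ) x a c b
        - fderiv ℝ (metricForm g φ) x c a b := by
  have tri : ∀ u v w : Euc m, fderiv ℝ (metricForm g φ) x u v w
      = ∑ i, ∑ j, ∑ k, u i * v j * w k * dg g φ i j k x := by
    intro u v w
    rw [map_eq_sum_smul_single (fderiv ℝ (metricForm g φ) x) u]
    simp only [sum_apply, smul_apply, smul_eq_mul]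
    refine Finset.sum_congr rfl fun i _ ↦ ?_
    rw [map_eq_sum_smul_single (fderiv ℝ (metricForm g φ) x _) v]
    simp only [sum_apply, smul_apply, smul_eq_mul,
      Finset.mul_sum]
    refine Finset.sum_congr rfl fun j _ ↦ ?_
    rw [map_eq_sum_smul_single (fderiv ℝ (metricForm g φ) x _ _) w]
    simp only [smul_eq_mul, Finset.mul_sum]
    refine Finset.sum_congr rfl fun k _ ↦ ?_
    rw [dg_eq_fderiv_metricForm g hφ hx]; ring
  have h1 : metricForm g φ x c (christoffelVec g φ x a b)
      = ∑ q, ∑ r, ∑ j, c q * a r * b j *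
        ((1 / 2) * (dg g φ j q r x + dg g φ r q j x - dg g φ q r j x)) := by
    rw [map_eq_sum_smul_single (metricForm g φ x) c]
    simp only [sum_apply, smul_apply, smul_eq_mul]
    refine Finset.sum_congr rfl fun q _ ↦ ?_
    rw [map_eq_sum_smul_single (metricForm g φ x _) (christoffelVec g φ x a b)]
    simp only [smul_eq_mul, ← gMat_apply, christoffelVec_apply, Finset.sum_mul, Finset.mul_sum]
    rw [Finset.sum_comm]
    refine Finset.sum_congr rfl fun r _ ↦ ?_
    rw [Finset.sum_comm]
    refine Finset.sum_congr rfl fun j _ ↦ ?_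
    rw [← metricForm_christoffel_single g hφ hx, Finset.mul_sum]
    exact Finset.sum_congr rfl fun k _ ↦ by ring
  have e1 : fderiv ℝ (metricForm g φ) x b c a
      = ∑ q, ∑ r, ∑ j, c q * a r * b j * dg g φ j q r x := by
    rw [tri, Finset.sum_comm]
    refine Finset.sum_congr rfl fun q _ ↦ ?_
    rw [Finset.sum_comm]
    exact Finset.sum_congr rfl fun r _ ↦ Finset.sum_congr rfl fun j _ ↦ by ring
  have e2 : fderiv ℝ (metricForm g φ) x a c b
      = ∑ q, ∑ r, ∑ j, c q * a r * b j * dg g φ r q j x := by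
    rw [tri, Finset.sum_comm]
    exact Finset.sum_congr rfl fun q _ ↦ Finset.sum_congr rfl fun r _ ↦
      Finset.sum_congr rfl fun j _ ↦ by ring
  rw [h1, e1, e2, tri]
  simp only [Finset.mul_sum, ← Finset.sum_add_distrib, ← Finset.sum_sub_distrib]
  exact Finset.sum_congr rfl fun q _ ↦ Finset.sum_congr rfl fun r _ ↦
      Finset.sum_congr rfl fun j _ ↦ by ring

/-- The derivative of the transformation law of the metric. -/
theorem fderiv_metricForm_trans (g : RMetric m M) {φ φ' : OpenPartialHomeomorph M (Euc m)}
    (hφ : φ ∈ smoothCharts m M) (hφ' : φ' ∈ smoothCharts m M) {x : Euc m}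
    (hx : x ∈ overlap φ φ') (v a b : Euc m) :
    fderiv ℝ (metricForm g φ) x v a b
      = fderiv ℝ (metricForm g φ') (trans φ φ' x) (fderiv ℝ (trans φ φ') x v)
          (fderiv ℝ (trans φ φ') x a) (fderiv ℝ (trans φ φ') x b)
        + metricForm g φ' (trans φ φ' x) (fderiv ℝ (fderiv ℝ (trans φ φ')) x v a)
          (fderiv ℝ (trans φ φ') x b)
        + metricForm g φ' (trans φ φ' x) (fderiv ℝ (trans φ φ') x a)
          (fderiv ℝ (fderiv ℝ (trans φ φ')) x v b) := by
  have H := isDiffeoOn_trans hφ hφ'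
  have hT := H.hasFDerivAt hx
  have hJ : HasFDerivAt (fderiv ℝ (trans φ φ')) (fderiv ℝ (fderiv ℝ (trans φ φ')) x) x :=
    ((H.contDiffOn_fderiv.contDiffAt (H.isOpen_source.mem_nhds hx)).differentiableAt
      (by simp)).hasFDerivAt
  have hB := (differentiableAt_metricForm g hφ hx.1).hasFDerivAt
  have hB' : HasFDerivAt (fun y ↦ metricForm g φ' (trans φ φ' y)) _ x :=
    HasFDerivAt.comp (g := metricForm g φ') x
      (differentiableAt_metricForm g hφ' (H.mapsTo hx).1).hasFDerivAt hT
  have l1 := ((hB.clm_apply (hasFDerivAt_const a x)).clm_apply (hasFDerivAt_const b x))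
  have l2 := ((hB'.clm_apply (hJ.clm_apply (hasFDerivAt_const a x))).clm_apply
    (hJ.clm_apply (hasFDerivAt_const b x)))
  have l3 := l2.congr_of_eventuallyEq (f₁ := fun y ↦ metricForm g φ y a b) (by
    filter_upwards [H.isOpen_source.mem_nhds hx] with y hy
    exact metricForm_trans g hφ hφ' hy a b)
  have := congrArg (fun A : Euc m →L[ℝ] ℝ ↦ A v) (l1.unique l3)
  simp at this
  rw [this]; ring

/-- The transformation law of the Christoffel symbols. -/
theorem christoffelVec_trans (g : RMetric m M) {φ φ' : OpenPartialHomeomorph M (Euc m)}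
    (hφ : φ ∈ smoothCharts m M) (hφ' : φ' ∈ smoothCharts m M) {x : Euc m}
    (hx : x ∈ overlap φ φ') (a b : Euc m) :
    fderiv ℝ (trans φ φ') x (christoffelVec g φ x a b)
      = christoffelVec g φ' (trans φ φ' x) (fderiv ℝ (trans φ φ') x a)
          (fderiv ℝ (trans φ φ') x b) + fderiv ℝ (fderiv ℝ (trans φ φ')) x a b := by
  have H := isDiffeoOn_trans hφ hφ'
  have hsymm : ∀ v w, fderiv ℝ (fderiv ℝ (trans φ φ')) x v w
      = fderiv ℝ (fderiv ℝ (trans φ φ')) x w v := by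
    have hc := H.contDiffOn.contDiffAt (H.isOpen_source.mem_nhds hx)
    exact fun v w ↦ (hc.isSymmSndFDerivAt (by
      rw [minSmoothness_of_isRCLikeNormedField]
      exact WithTop.coe_le_coe.2 (le_top : (2 : ℕ∞) ≤ ⊤))).eq v w
  set J := fderiv ℝ (trans φ φ') x with hJ
  set P := fderiv ℝ (fderiv ℝ (trans φ φ')) x with hP
  -- by the Koszul formula in both charts, the difference `z` of the two sides is orthogonal to all
  -- vectors
  set z := J (christoffelVec g φ x a b)
    - (christoffelVec g φ' (trans φ φ' x) (J a) (J b) + P a b) with hz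
  have key : ∀ c, metricForm g φ' (trans φ φ' x) (J c) z = 0 := by
    intro c
    have k1 := metricForm_christoffelVec g hφ hx.1 a b c
    have k2 := metricForm_christoffelVec g hφ' (H.mapsTo hx).1 (J a) (J b) (J c)
    rw [metricForm_trans g hφ hφ' hx, fderiv_metricForm_trans g hφ hφ' hx,
      fderiv_metricForm_trans g hφ hφ' hx, fderiv_metricForm_trans g hφ hφ' hx,
      ← hJ, ← hP, hsymm c a, hsymm b a, hsymm c b,
      metricForm_symm g φ' _ (P b c) (J a)] at k1
    rw [hz, map_sub, map_add]
    linarith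
  have hzJ : J (fderiv ℝ (trans φ' φ) (trans φ φ' x) z) = z := by
    have h := H.symm.fderiv_comp_fderiv (H.mapsTo hx)
    rw [H.left_inv x hx] at h
    exact congrArg (fun A : Euc m →L[ℝ] Euc m ↦ A z) h
  have h0 := key (fderiv ℝ (trans φ' φ) (trans φ φ' x) z)
  rw [hzJ] at h0
  by_contra hne
  have : z ≠ 0 := fun h ↦ hne (sub_eq_zero.1 h)
  exact (metricForm_pos g hφ' (H.mapsTo hx).1 this).ne' h0

theorem continuousOn_gMat (g : RMetric m M) {φ : OpenPartialHomeomorph M (Euc m)}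
    (hφ : φ ∈ smoothCharts m M) (j k : Fin m) :
    ContinuousOn (fun x ↦ gMat g φ x j k) φ.target :=
  ((contDiffOn_metricForm g hφ).continuousOn.clm_apply continuousOn_const).clm_apply
    continuousOn_const

theorem continuousOn_christoffel (g : RMetric m M) {φ : OpenPartialHomeomorph M (Euc m)}
    (hφ : φ ∈ smoothCharts m M) (k l j : Fin m) :
    ContinuousOn (christoffel g φ k l j) φ.target := by
  have hdg : ∀ i j k, ContinuousOn (dg g φ i j k) φ.target := fun i j k ↦
    (((((contDiffOn_metricForm g hφ).fderiv_of_isOpen (m := ∞) φ.open_target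
      (by simp)).continuousOn.clm_apply continuousOn_const).clm_apply
        continuousOn_const).clm_apply continuousOn_const).congr
      fun x hx ↦ dg_eq_fderiv_metricForm g hφ hx i j k
  have hG : ContinuousOn (gMat g φ) φ.target :=
    continuousOn_pi.2 fun j ↦ continuousOn_pi.2 fun k ↦ continuousOn_gMat g hφ j k
  have hinv : ContinuousOn (fun x ↦ (gMat g φ x)⁻¹) φ.target := by
    intro x hx
    exact (continuousAt_matrix_inv _ (by
      rw [Ring.inverse_eq_inv']
      exact continuousAt_inv₀ (isUnit_det_gMat g hφ hx).ne_zero)).comp_continuousWithinAt (hG x hx)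
  refine continuousOn_const.mul (continuousOn_finsetSum _ fun r _ ↦ ?_)
  exact (continuousOn_pi.1 (continuousOn_pi.1 hinv k) r).mul
    (((hdg j r l).add (hdg l r j)).sub (hdg r l j))

end Christoffel

/-! ### Pull-back of weakly differentiable functions -/

section Pullback
variable {m : ℕ}

/-- Bounds for sums of products of continuous functions and functions composed with a
diffeomorphism. -/
theorem IsDiffeoOn.exists_eLpNorm_sum_mul_comp_le {T S : Euc m → Euc m} {W V K : Set (Euc m)}
    (H : IsDiffeoOn T S W V) (hKc : IsCompact K) (hK : K ⊆ W) {ι : Type*} [Fintype ι]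
    {a : ι → Euc m → ℝ} (ha : ∀ i, ContinuousOn (a i) W) {p : ℝ≥0∞} (hp1 : 1 ≤ p) (hp : p ≠ ⊤) :
    ∃ C : ℝ≥0, ∀ (f : ι → Euc m → ℝ) (N : ℝ≥0∞), (∀ i, LocallyIntegrableOn (f i) V) →
      (∀ i, eLpNorm (f i) p volume ≤ N) →
      eLpNorm (fun x ↦ ∑ i, a i x * f i (T x)) p (volume.restrict K) ≤ C * N := by
  obtain ⟨C, hC⟩ := H.exists_eLpNorm_comp_le hKc hK (p := p) (by positivity) hp
  choose B hB using fun i ↦ hKc.exists_bound_of_continuousOn ((ha i).mono hK)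
  refine ⟨∑ i, (B i).toNNReal * C, fun f N hf hN ↦ ?_⟩
  have hloc : ∀ i, LocallyIntegrableOn (fun x ↦ a i x * f i (T x)) W := fun i ↦
    HasWeakPartial.locallyIntegrableOn_continuousOn_mul H.isOpen_source (ha i)
      (H.locallyIntegrableOn_comp (hf i))
  have hsum : (fun x ↦ ∑ i, a i x * f i (T x)) = ∑ i, fun x ↦ a i x * f i (T x) := by
    ext x; simp
  rw [hsum]
  refine (eLpNorm_sum_le (fun i _ ↦
    ((hloc i).integrableOn_compact_subset hK hKc).aestronglyMeasurable) hp1).trans ?_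
  rw [ENNReal.ofNNReal_finsetSum, Finset.sum_mul]
  refine Finset.sum_le_sum fun i _ ↦ ?_
  rw [ENNReal.coe_mul, mul_assoc]
  have h1 : eLpNorm (fun x ↦ a i x * f i (T x)) p (volume.restrict K)
      ≤ ENNReal.ofReal (B i) * eLpNorm (fun x ↦ f i (T x)) p (volume.restrict K) := by
    refine eLpNorm_le_mul_eLpNorm_of_ae_le_mul ?_ p
    filter_upwards [ae_restrict_mem hKc.measurableSet] with x hx
    rw [norm_mul]
    exact mul_le_mul_of_nonneg_right (hB i x hx) (norm_nonneg _)
  refine h1.trans (mul_le_mul le_rfl ((hC _).trans ?_) zero_le zero_le)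
  exact mul_le_mul le_rfl ((eLpNorm_mono_measure _ Measure.restrict_le_self).trans (hN i))
    zero_le zero_le

/-- Bounds on compact sets for the pull-back of weakly differentiable functions under a
diffeomorphism onto a part of an open set, and for its weak derivatives. -/
theorem IsDiffeoOn.exists_weakPartial_pullback {T S : Euc m → Euc m} {W V W₀ S₀ K : Set (Euc m)}
    (H : IsDiffeoOn T S W V) (hW₀ : IsOpen W₀) (hSW : S₀ ⊆ W)
    (hS₀ : ∀ K, IsCompact K → K ⊆ W₀ → IsCompact (K ∩ S₀))
    {a : Fin m → Euc m → ℝ} (ha : ∀ k, ContDiffOn ℝ ∞ (a k) W)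
    (hKc : IsCompact K) (hK : K ⊆ W₀) :
    ∃ C : ℝ≥0, ∀ (f : Fin m → Euc m → ℝ) (d : Fin m → Fin m → Euc m → ℝ) (N : ℝ≥0∞),
      (∀ k j, HasWeakPartial univ j (f k) (d k j)) →
      (∀ k, ∀ x ∈ W, x ∉ S₀ → f k (T x) = 0) → (∀ k j, ∀ x ∈ W, x ∉ S₀ → d k j (T x) = 0) →
      (∀ k, eLpNorm (f k) 6 volume ≤ N) → (∀ k, eLpNorm (f k) 2 volume ≤ N) →
      (∀ k j, eLpNorm (d k j) 2 volume ≤ N) →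
      ∃ D : Fin m → Euc m → ℝ,
        (∀ j, HasWeakPartial W₀ j (S₀.indicator fun x ↦ ∑ k, a k x * f k (T x)) (D j)) ∧
        eLpNorm (S₀.indicator fun x ↦ ∑ k, a k x * f k (T x)) 6 (volume.restrict K) ≤ C * N ∧
        eLpNorm (S₀.indicator fun x ↦ ∑ k, a k x * f k (T x)) 2 (volume.restrict K) ≤ C * N ∧
        ∀ j, eLpNorm (D j) 2 (volume.restrict K) ≤ C * N := by
  classical
  have hKS : IsCompact (K ∩ S₀) := hS₀ K hKc hK
  have hKW : K ∩ S₀ ⊆ W := inter_subset_right.trans hSW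
  have hac : ∀ k, ContinuousOn (a k) W := fun k ↦ (ha k).continuousOn
  obtain ⟨C6, hC6⟩ := H.exists_eLpNorm_sum_mul_comp_le hKS hKW hac (p := 6) (by norm_num) (by simp)
  obtain ⟨C2, hC2⟩ := H.exists_eLpNorm_sum_mul_comp_le hKS hKW hac (p := 2) (by norm_num) (by simp)
  choose C3 hC3 using fun j : Fin m ↦ H.exists_eLpNorm_sum_mul_comp_le hKS hKW
    (ι := Fin m × Fin m)
    (a := fun i x ↦ a i.1 x * (fderiv ℝ T x (EuclideanSpace.single j 1)) i.2)
    (fun i ↦ (hac i.1).mul (H.contDiffOn_partial _ _).continuousOn) (p := 2)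
    (by norm_num) (by simp)
  choose C4 hC4 using fun j : Fin m ↦ H.exists_eLpNorm_sum_mul_comp_le hKS hKW
    (a := fun k x ↦ fderiv ℝ (a k) x (EuclideanSpace.single j 1))
    (fun k ↦ (HasWeakPartial.contDiffOn_fderiv_apply H.isOpen_source (ha k) _).continuousOn)
    (p := 2) (by norm_num) (by simp)
  refine ⟨C6 + C2 + ∑ j, (C3 j + C4 j), fun f d N hfd hf0 hd0 hf6 hf2 hd2 ↦ ?_⟩
  have hfV : ∀ k, LocallyIntegrableOn (f k) V := fun k ↦ by
    rcases isEmpty_or_nonempty (Fin m) with h | ⟨⟨j⟩⟩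
    · exact h.elim k
    · exact (hfd k j).1.mono_set (subset_univ _)
  have hdV : ∀ k j, LocallyIntegrableOn (d k j) V := fun k j ↦
    (hfd k j).2.1.mono_set (subset_univ _)
  set D : Fin m → Euc m → ℝ := fun j x ↦ ∑ k, (a k x *
    (∑ r, (fderiv ℝ T x (EuclideanSpace.single j 1)) r * d k r (T x))
      + fderiv ℝ (a k) x (EuclideanSpace.single j 1) * f k (T x)) with hD
  have hwp : ∀ j, HasWeakPartial W j (fun x ↦ ∑ k, a k x * f k (T x)) (D j) := fun j ↦
    HasWeakPartial.sum _ fun k _ ↦ (HasWeakPartial.comp_diffeo H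
      (fun r ↦ (hfd k r).mono (subset_univ V)) j).contDiffOn_mul H.isOpen_source (ha k)
  have hFz : ∀ x ∈ W, x ∉ S₀ → ∑ k, a k x * f k (T x) = 0 := fun x hx hxS ↦
    Finset.sum_eq_zero fun k _ ↦ by rw [hf0 k x hx hxS, mul_zero]
  have hDz : ∀ j, ∀ x ∈ W, x ∉ S₀ → D j x = 0 := fun j x hx hxS ↦
    Finset.sum_eq_zero fun k _ ↦ by simp [hf0 k x hx hxS, hd0 k _ x hx hxS]
  have hind : ∀ (F : Euc m → ℝ) (p : ℝ≥0∞), eLpNorm (S₀.indicator F) p (volume.restrict K)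
      ≤ eLpNorm F p (volume.restrict (K ∩ S₀)) := by
    intro F p
    have : eLpNorm (S₀.indicator F) p (volume.restrict K)
        = eLpNorm ((K ∩ S₀).indicator F) p (volume.restrict K) := by
      refine eLpNorm_congr_ae ?_
      filter_upwards [ae_restrict_mem hKc.measurableSet] with x hx
      by_cases hxS : x ∈ S₀
      · rw [indicator_of_mem hxS, indicator_of_mem (mem_inter hx hxS)]
      · rw [indicator_of_notMem hxS, indicator_of_notMem (fun h ↦ hxS h.2 : x ∉ K ∩ S₀)]
    rw [this, eLpNorm_indicator_eq_eLpNorm_restrict hKS.measurableSet,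
      Measure.restrict_restrict hKS.measurableSet]
    exact eLpNorm_mono_measure _ (Measure.restrict_mono inter_subset_left le_rfl)
  have mono : ∀ {c : ℝ≥0}, c ≤ C6 + C2 + ∑ j, (C3 j + C4 j) →
      (c : ℝ≥0∞) * N ≤ (C6 + C2 + ∑ j, (C3 j + C4 j) : ℝ≥0) * N := fun h ↦
    mul_le_mul (ENNReal.coe_le_coe.2 h) le_rfl zero_le zero_le
  refine ⟨fun j ↦ S₀.indicator (D j), fun j ↦ ?_, ?_, ?_, fun j ↦ ?_⟩
  · refine HasWeakPartial.extend_zero hW₀ H.isOpen_source hSW hS₀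
      ((hwp j).congr_ae H.isOpen_source ?_ ?_) (fun x _ hx ↦ indicator_of_notMem hx _)
      (fun x _ hx ↦ indicator_of_notMem hx _)
    · refine ae_of_all _ fun x hx ↦ ?_
      by_cases hxS : x ∈ S₀
      · rw [indicator_of_mem hxS]
      · rw [indicator_of_notMem hxS, hFz x hx hxS]
    · refine ae_of_all _ fun x hx ↦ ?_
      change D j x = S₀.indicator (D j) x
      by_cases hxS : x ∈ S₀
      · rw [indicator_of_mem hxS]
      · rw [indicator_of_notMem hxS, hDz j x hx hxS]
  · exact (hind _ _).trans ((hC6 f N hfV hf6).trans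
      (mono (le_add_of_le_of_nonneg (le_add_of_nonneg_right zero_le) zero_le)))
  · exact (hind _ _).trans ((hC2 f N hfV hf2).trans
      (mono (le_add_of_le_of_nonneg (le_add_of_nonneg_left zero_le) zero_le)))
  · refine (hind _ _).trans ?_
    have hsplit : D j = (fun x ↦ ∑ i : Fin m × Fin m,
        (a i.1 x * (fderiv ℝ T x (EuclideanSpace.single j 1)) i.2) * d i.1 i.2 (T x))
        + fun x ↦ ∑ k, fderiv ℝ (a k) x (EuclideanSpace.single j 1) * f k (T x) := by
      ext x
      simp only [hD, Pi.add_apply, Fintype.sum_prod_type, Finset.sum_add_distrib, Finset.mul_sum,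
        mul_assoc]
    have hm1 : LocallyIntegrableOn (fun x ↦ ∑ i : Fin m × Fin m,
        (a i.1 x * (fderiv ℝ T x (EuclideanSpace.single j 1)) i.2) * d i.1 i.2 (T x)) W :=
      locallyIntegrableOn_finsetSum H.isOpen_source _ fun i _ ↦
        HasWeakPartial.locallyIntegrableOn_continuousOn_mul H.isOpen_source
          ((hac i.1).mul (H.contDiffOn_partial _ _).continuousOn)
          (H.locallyIntegrableOn_comp (hdV _ _))
    have hm2 : LocallyIntegrableOn (fun x ↦ ∑ k,
        fderiv ℝ (a k) x (EuclideanSpace.single j 1) * f k (T x)) W :=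
      locallyIntegrableOn_finsetSum H.isOpen_source _ fun k _ ↦
        HasWeakPartial.locallyIntegrableOn_continuousOn_mul H.isOpen_source
          (HasWeakPartial.contDiffOn_fderiv_apply H.isOpen_source (ha k) _).continuousOn
          (H.locallyIntegrableOn_comp (hfV _))
    rw [hsplit]
    refine (eLpNorm_add_le (hm1.integrableOn_compact_subset hKW hKS).aestronglyMeasurable
      (hm2.integrableOn_compact_subset hKW hKS).aestronglyMeasurable (by norm_num)).trans ?_
    refine (add_le_add (hC3 j (fun i ↦ d i.1 i.2) N (fun i ↦ hdV _ _) fun i ↦ hd2 _ _)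
      (hC4 j f N hfV hf2)).trans ?_
    rw [← add_mul, ← ENNReal.coe_add]
    refine mono (le_add_of_nonneg_of_le zero_le ?_)
    exact Finset.single_le_sum (f := fun j ↦ C3 j + C4 j) (fun _ _ ↦ zero_le) (Finset.mem_univ j)

end Pullback

/-! ### The components of a vector field of class `H^σ` in a chart -/

section Components
variable {m : ℕ} {M : Type*} [TopologicalSpace M] [ChartedSpace (Euc m) M]

/-- The function underlying `localRep`, with real values. -/
def localReal (A : NormData m M) (u : VField m M) (i : Fin A.N) (l : Fin m) : Euc m → ℝ :=
  (A.chart i).target.indicator fun x ↦ A.χ i ((A.chart i).symm x) * comp (A.chart i) u l x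

theorem localRep_eq (A : NormData m M) (u : VField m M) (i : Fin A.N) (l : Fin m) :
    localRep A u i l = fun x ↦ (localReal A u i l x : ℂ) := by
  ext x
  rw [localRep, localReal]
  split_ifs with h
  · rw [indicator_of_mem h]
  · rw [indicator_of_notMem h, Complex.ofReal_zero]

/-- The support of the `i`-th function of the partition of unity, in coordinates. -/
def suppSet (A : NormData m M) (i : Fin A.N) : Set (Euc m) :=
  A.chart i '' tsupport (A.χ i)

theorem isCompact_suppSet [CompactSpace M] (A : NormData m M) (i : Fin A.N) :
    IsCompact (suppSet A i) :=
  (isClosed_tsupport _).isCompact.image_of_continuousOn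
    ((A.chart i).continuousOn.mono (A.subordinate i))

theorem suppSet_subset_target (A : NormData m M) (i : Fin A.N) :
    suppSet A i ⊆ (A.chart i).target := by
  rintro _ ⟨p, hp, rfl⟩
  exact (A.chart i).map_source (A.subordinate i hp)

theorem symm_mem_tsupport (A : NormData m M) (i : Fin A.N) {x : Euc m} (hx : x ∈ suppSet A i) :
    (A.chart i).symm x ∈ tsupport (A.χ i) := by
  obtain ⟨p, hp, rfl⟩ := hx
  rwa [(A.chart i).left_inv (A.subordinate i hp)]

theorem chi_symm_eq_zero (A : NormData m M) (i : Fin A.N) {x : Euc m}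
    (hx : x ∈ (A.chart i).target) (hxs : x ∉ suppSet A i) : A.χ i ((A.chart i).symm x) = 0 := by
  by_contra h
  exact hxs ⟨_, subset_tsupport _ h, (A.chart i).right_inv hx⟩

theorem localReal_eq_zero (A : NormData m M) (u : VField m M) (i : Fin A.N) (l : Fin m) {x : Euc m}
    (hxs : x ∉ suppSet A i) : localReal A u i l x = 0 := by
  rw [localReal]
  by_cases h : x ∈ (A.chart i).target
  · rw [indicator_of_mem h, chi_symm_eq_zero A i h hxs, zero_mul]
  · rw [indicator_of_notMem h]

theorem hsNorm_localRep_le_normH (A : NormData m M) (σ : ℝ) (u : VField m M) (i : Fin A.N)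
    (l : Fin m) : hsNorm σ (localRep A u i l) ≤ normH A σ u :=
  (Finset.single_le_sum (f := fun l ↦ hsNorm σ (localRep A u i l)) (fun _ _ ↦ zero_le)
    (Finset.mem_univ l)).trans
    (Finset.single_le_sum (f := fun i ↦ ∑ l, hsNorm σ (localRep A u i l)) (fun _ _ ↦ zero_le)
      (Finset.mem_univ i))

/-- The bounds for the localized components of a field of class `H^σ`, `σ ≥ 1`. The weak derivatives
are chosen to vanish off the support of the partition function everywhere, not only almost
everywhere, as the extension by zero in another chart requires. -/
theorem exists_localReal_bounds [CompactSpace M] (hm : m = 2 ∨ m = 3) (A : NormData m M) :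
    ∃ C : ℝ≥0, ∀ σ : ℝ, 1 ≤ σ → ∀ u : VField m M, MemH A σ u →
      normH A σ u < ⊤ ∧ ∀ i, ∃ d : Fin m → Fin m → Euc m → ℝ,
        (∀ k j, HasWeakPartial univ j (localReal A u i k) (d k j)) ∧
        (∀ k j, ∀ x, x ∉ suppSet A i → d k j x = 0) ∧
        (∀ k, eLpNorm (localReal A u i k) 6 volume ≤ C * normH A σ u) ∧
        (∀ k, eLpNorm (localReal A u i k) 2 volume ≤ C * normH A σ u) ∧
        ∀ k j, eLpNorm (d k j) 2 volume ≤ C * normH A σ u := by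
  obtain ⟨C, hC⟩ := exists_sobolev_bounds hm
  refine ⟨C, fun σ hσ u hu ↦ ?_⟩
  have h := fun i k ↦ hC σ hσ (localReal A u i k) (by rw [← localRep_eq]; exact hu i k)
  simp only [← localRep_eq] at h
  have hN : normH A σ u < ⊤ :=
    ENNReal.sum_lt_top.2 fun i _ ↦ ENNReal.sum_lt_top.2 fun l _ ↦ (h i l).1
  have hle : ∀ i k, C * hsNorm σ (localRep A u i k) ≤ C * normH A σ u := fun i k ↦
    mul_le_mul le_rfl (hsNorm_localRep_le_normH A σ u i k) zero_le zero_le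
  have hfin : C * normH A σ u < ⊤ := ENNReal.mul_lt_top ENNReal.coe_lt_top hN
  refine ⟨hN, fun i ↦ ?_⟩
  choose d hd using fun k ↦ (h i k).2.2.2.2
  have hKm := (isCompact_suppSet A i).measurableSet
  have hwp : ∀ k j, HasWeakPartial univ j (localReal A u i k) (d k j) := fun k j ↦
    ⟨(MemLp.locallyIntegrable ⟨(h i k).2.1, ((h i k).2.2.1.trans (hle i k)).trans_lt hfin⟩
        (by norm_num)).locallyIntegrableOn _,
      (MemLp.locallyIntegrable ⟨(hd k j).1, ((hd k j).2.1.trans (hle i k)).trans_lt hfin⟩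
        (by norm_num)).locallyIntegrableOn _,
      fun ψ hψ hc _ ↦ (hd k j).2.2 ψ hψ hc⟩
  -- off the support of the function, the weak derivatives vanish almost everywhere
  have hae : ∀ k j, ∀ᵐ x, x ∈ (suppSet A i)ᶜ → d k j x = 0 := fun k j ↦
    HasWeakPartial.ae_eq (isCompact_suppSet A i).isClosed.isOpen_compl
      ((hwp k j).mono (subset_univ _))
      (HasWeakPartial.zero.congr_ae (isCompact_suppSet A i).isClosed.isOpen_compl
        (ae_of_all _ fun x hx ↦ (localReal_eq_zero A u i k hx).symm) (ae_of_all _ fun _ _ ↦ rfl))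
  have hae' : ∀ k j, d k j =ᵐ[volume] (suppSet A i).indicator (d k j) := fun k j ↦ by
    filter_upwards [hae k j] with x hx
    by_cases hxs : x ∈ suppSet A i
    · rw [indicator_of_mem hxs]
    · rw [indicator_of_notMem hxs, hx hxs]
  refine ⟨fun k j ↦ (suppSet A i).indicator (d k j), fun k j ↦ ?_,
    fun k j x hx ↦ indicator_of_notMem hx _, fun k ↦ (h i k).2.2.2.1.trans (hle i k),
    fun k ↦ (h i k).2.2.1.trans (hle i k), fun k j ↦ ?_⟩
  · exact (hwp k j).congr_ae isOpen_univ (ae_of_all _ fun _ _ ↦ rfl)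
      ((hae' k j).mono fun x hx _ ↦ hx)
  · rw [← eLpNorm_congr_ae (hae' k j)]
    exact (hd k j).2.1.trans (hle i k)

/-- The support of the `i`-th function of the partition of unity, in the chart `φ`. -/
def suppIn (A : NormData m M) (φ : OpenPartialHomeomorph M (Euc m)) (i : Fin A.N) : Set (Euc m) :=
  φ.target ∩ φ.symm ⁻¹' tsupport (A.χ i)

theorem suppIn_subset_overlap (A : NormData m M) (φ : OpenPartialHomeomorph M (Euc m))
    (i : Fin A.N) : suppIn A φ i ⊆ overlap φ (A.chart i) :=
  inter_subset_inter_right _ (preimage_mono (A.subordinate i))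

theorem isCompact_inter_suppIn (A : NormData m M) (φ : OpenPartialHomeomorph M (Euc m))
    (i : Fin A.N) {K : Set (Euc m)} (hK : IsCompact K) (hKt : K ⊆ φ.target) :
    IsCompact (K ∩ suppIn A φ i) := by
  have : K ∩ suppIn A φ i = K ∩ φ.symm ⁻¹' tsupport (A.χ i) := by
    rw [suppIn, ← inter_assoc, inter_eq_left.2 hKt]
  rw [this]
  exact hK.of_isClosed_subset ((φ.continuousOn_symm.mono hKt).preimage_isClosed_of_isClosed
    hK.isClosed (isClosed_tsupport _)) inter_subset_left

theorem trans_notMem_suppSet (A : NormData m M) (φ : OpenPartialHomeomorph M (Euc m))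
    (i : Fin A.N) {x : Euc m} (hx : x ∈ overlap φ (A.chart i)) (hxs : x ∉ suppIn A φ i) :
    trans φ (A.chart i) x ∉ suppSet A i := fun h ↦ by
  have := symm_mem_tsupport A i h
  rw [trans, (A.chart i).left_inv hx.2] at this
  exact hxs ⟨hx.1, this⟩

/-- The entries of the Jacobian matrix of the change of coordinates from the `i`-th chart to `φ`. -/
def jac (A : NormData m M) (φ : OpenPartialHomeomorph M (Euc m)) (i : Fin A.N) (l k : Fin m)
    (x : Euc m) : ℝ :=
  (fderiv ℝ (trans (A.chart i) φ) (trans φ (A.chart i) x) (EuclideanSpace.single k 1)) l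

theorem contDiffOn_jac (A : NormData m M) {φ : OpenPartialHomeomorph M (Euc m)}
    (hφ : φ ∈ smoothCharts m M) (i : Fin A.N) (l k : Fin m) :
    ContDiffOn ℝ ∞ (jac A φ i l k) (overlap φ (A.chart i)) :=
  ((isDiffeoOn_trans (A.chart_mem i) hφ).contDiffOn_partial _ _).comp
    (isDiffeoOn_trans hφ (A.chart_mem i)).contDiffOn (isDiffeoOn_trans hφ (A.chart_mem i)).mapsTo

/-- A vector field is the sum of its localized parts. -/
theorem comp_eq_sum_localReal (A : NormData m M) {φ : OpenPartialHomeomorph M (Euc m)}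
    (hφ : φ ∈ smoothCharts m M) (u : VField m M) (l : Fin m) {x : Euc m} (hx : x ∈ φ.target) :
    comp φ u l x = ∑ i, (suppIn A φ i).indicator
      (fun x ↦ ∑ k, jac A φ i l k x * localReal A u i k (trans φ (A.chart i) x)) x := by
  have hterm : ∀ i, (suppIn A φ i).indicator
      (fun x ↦ ∑ k, jac A φ i l k x * localReal A u i k (trans φ (A.chart i) x)) x
      = A.χ i (φ.symm x) * comp φ u l x := by
    intro i
    by_cases hxs : x ∈ suppIn A φ i
    · have hxo := suppIn_subset_overlap A φ i hxs
      have H := isDiffeoOn_trans hφ (A.chart_mem i)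
      have hy := H.mapsTo hxo
      have hp : (A.chart i).symm (trans φ (A.chart i) x) = φ.symm x :=
        (A.chart i).left_inv hxo.2
      have h1 := compVec_trans (A.chart_mem i) hφ u hy
      rw [H.left_inv x hxo, map_eq_sum_smul_single (fderiv ℝ _ _)] at h1
      have h2 := congrArg (EuclideanSpace.proj (𝕜 := ℝ) l) h1
      simp only [map_sum, map_smul, PiLp.proj_apply, compVec_apply, smul_eq_mul] at h2
      rw [indicator_of_mem hxs, h2, Finset.mul_sum]
      refine Finset.sum_congr rfl fun k _ ↦ ?_
      rw [localReal, indicator_of_mem hy.1, hp, jac]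
      ring
    · rw [indicator_of_notMem hxs]
      have : A.χ i (φ.symm x) = 0 := by
        by_contra h
        exact hxs ⟨hx, subset_tsupport _ h⟩
      rw [this, zero_mul]
  simp only [hterm]
  rw [← Finset.sum_mul, ← finsum_eq_sum_of_fintype, A.χ.sum_eq_one (mem_univ _), one_mul]

/-- In any chart, the components of a vector field of class `H^σ`, `σ ≥ 1`, are weakly
differentiable; on compact sets there are bounds in `L⁶` and `L²` for the components and in `L²`
for the derivatives. -/
theorem exists_comp_bounds [CompactSpace M] (hm : m = 2 ∨ m = 3) (A : NormData m M)
    {φ : OpenPartialHomeomorph M (Euc m)} (hφ : φ ∈ smoothCharts m M) {K : Set (Euc m)}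
    (hKc : IsCompact K) (hK : K ⊆ φ.target) :
    ∃ C : ℝ≥0, ∀ σ : ℝ, 1 ≤ σ → ∀ u : VField m M, MemH A σ u →
      ∃ D : Fin m → Fin m → Euc m → ℝ,
        (∀ j l, HasWeakPartial φ.target j (comp φ u l) (D j l)) ∧
        (∀ l, eLpNorm (comp φ u l) 6 (volume.restrict K) ≤ C * normH A σ u) ∧
        (∀ l, eLpNorm (comp φ u l) 2 (volume.restrict K) ≤ C * normH A σ u) ∧
        ∀ j l, eLpNorm (D j l) 2 (volume.restrict K) ≤ C * normH A σ u := by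
  obtain ⟨C₀, hC₀⟩ := exists_localReal_bounds hm A
  choose C hC using fun (i : Fin A.N) (l : Fin m) ↦
    (isDiffeoOn_trans hφ (A.chart_mem i)).exists_weakPartial_pullback φ.open_target
      (suppIn_subset_overlap A φ i) (fun K hK hKt ↦ isCompact_inter_suppIn A φ i hK hKt)
      (contDiffOn_jac A hφ i l) hKc hK
  refine ⟨∑ l, ∑ i, C i l * C₀, fun σ hσ u hu ↦ ?_⟩
  obtain ⟨-, h⟩ := hC₀ σ hσ u hu
  choose d hd hd0 h6 h2 hd2 using h
  choose D hD hD6 hD2 hDd using fun (i : Fin A.N) (l : Fin m) ↦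
    hC i l (localReal A u i) (d i) (C₀ * normH A σ u) (hd i)
      (fun k x hx hxs ↦ localReal_eq_zero A u i k (trans_notMem_suppSet A φ i hx hxs))
      (fun k j x hx hxs ↦ hd0 i k j _ (trans_notMem_suppSet A φ i hx hxs)) (h6 i) (h2 i) (hd2 i)
  set F : Fin A.N → Fin m → Euc m → ℝ := fun i l ↦ (suppIn A φ i).indicator
      (fun x ↦ ∑ k, jac A φ i l k x * localReal A u i k (trans φ (A.chart i) x)) with hF
  have hae : ∀ l, comp φ u l =ᵐ[volume.restrict K] ∑ i, F i l := fun l ↦ by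
    filter_upwards [ae_restrict_mem hKc.measurableSet] with x hx
    rw [comp_eq_sum_localReal A hφ u l (hK hx), Finset.sum_apply]
  have bound : ∀ l, ∑ i, (C i l : ℝ≥0∞) * (C₀ * normH A σ u)
      ≤ (∑ l, ∑ i, C i l * C₀ : ℝ≥0) * normH A σ u := by
    intro l
    have h1 : (∑ i, C i l * C₀ : ℝ≥0) ≤ ∑ l, ∑ i, C i l * C₀ :=
      Finset.single_le_sum (f := fun l ↦ ∑ i, C i l * C₀) (fun _ _ ↦ zero_le) (Finset.mem_univ l)
    refine le_trans (le_of_eq ?_) (mul_le_mul (ENNReal.coe_le_coe.2 h1) le_rfl zero_le zero_le)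
    rw [ENNReal.ofNNReal_finsetSum, Finset.sum_mul]
    simp only [ENNReal.coe_mul, mul_assoc]
  -- the measurability of the components is read off from a weak derivative in some direction `j₀`
  rcases isEmpty_or_nonempty (Fin m) with hm0 | ⟨⟨j₀⟩⟩
  · exact ⟨fun _ _ _ ↦ 0, fun j ↦ hm0.elim j, fun j ↦ hm0.elim j, fun j ↦ hm0.elim j,
      fun j ↦ hm0.elim j⟩
  refine ⟨fun j l x ↦ ∑ i, D i l j x, fun j l ↦ ?_, fun l ↦ ?_, fun l ↦ ?_, fun j l ↦ ?_⟩
  · exact (HasWeakPartial.sum _ fun i _ ↦ hD i l j).congr_ae φ.open_target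
      (ae_of_all _ fun x hx ↦ (comp_eq_sum_localReal A hφ u l hx).symm) (ae_of_all _ fun _ _ ↦ rfl)
  · rw [eLpNorm_congr_ae (hae l)]
    refine (eLpNorm_sum_le (fun i _ ↦ ((hD i l j₀).1.integrableOn_compact_subset hK
      hKc).aestronglyMeasurable) (by norm_num)).trans ?_
    exact (Finset.sum_le_sum fun i _ ↦ hD6 i l).trans (bound l)
  · rw [eLpNorm_congr_ae (hae l)]
    refine (eLpNorm_sum_le (fun i _ ↦ ((hD i l j₀).1.integrableOn_compact_subset hK
      hKc).aestronglyMeasurable) (by norm_num)).trans ?_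
    exact (Finset.sum_le_sum fun i _ ↦ hD2 i l).trans (bound l)
  · have : (fun x ↦ ∑ i, D i l j x) = ∑ i, D i l j := by ext x; simp
    refine (congrArg (fun f ↦ eLpNorm f 2 (volume.restrict K)) this).trans_le ?_
    refine (eLpNorm_sum_le (fun i _ ↦ ((hD i l j).2.1.integrableOn_compact_subset hK
      hKc).aestronglyMeasurable) (by norm_num)).trans ?_
    exact (Finset.sum_le_sum fun i _ ↦ hDd i l j).trans (bound l)

end Components

/-! ### Existence of the covariant derivative -/

section CovariantDerivative
variable {m : ℕ} {M : Type*} [TopologicalSpace M]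

theorem IsDiffeoOn.restrict {T S : Euc m → Euc m} {W V W' : Set (Euc m)} (H : IsDiffeoOn T S W V)
    (hW' : IsOpen W') (h : W' ⊆ W) : IsDiffeoOn T S W' (V ∩ S ⁻¹' W') where
  isOpen_source := hW'
  isOpen_target := H.contDiffOn_symm.continuousOn.isOpen_inter_preimage H.isOpen_target hW'
  contDiffOn := H.contDiffOn.mono h
  contDiffOn_symm := H.contDiffOn_symm.mono inter_subset_left
  mapsTo x hx := ⟨H.mapsTo (h hx), by rwa [mem_preimage, H.left_inv x (h hx)]⟩
  mapsTo_symm _ hy := hy.2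
  left_inv x hx := H.left_inv x (h hx)
  right_inv y hy := H.right_inv y hy.1

/-- The part of the chart `φ` that lies in `Ω`, in coordinates. -/
def domIn (φ : OpenPartialHomeomorph M (Euc m)) (Ω : Set M) : Set (Euc m) :=
  φ.target ∩ φ.symm ⁻¹' Ω

theorem isOpen_domIn (φ : OpenPartialHomeomorph M (Euc m)) {Ω : Set M} (hΩ : IsOpen Ω) :
    IsOpen (domIn φ Ω) := φ.symm.isOpen_inter_preimage hΩ

variable [ChartedSpace (Euc m) M]

/-- The transformation law of the weak derivatives of a vector field: the chain rule and the product
rule compute the weak derivatives of `u' ∘ T = DT u`, where `T` is the transition map, in two ways.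
-/
theorem weakPartial_trans {φ φ' : OpenPartialHomeomorph M (Euc m)}
    (hφ : φ ∈ smoothCharts m M) (hφ' : φ' ∈ smoothCharts m M) {Ω : Set M} (hΩ : IsOpen Ω)
    {u : VField m M} {D D' : Fin m → Fin m → Euc m → ℝ}
    (hD : ∀ j l, HasWeakPartial (domIn φ Ω) j (comp φ u l) (D j l))
    (hD' : ∀ j l, HasWeakPartial (domIn φ' Ω) j (comp φ' u l) (D' j l)) :
    ∀ᵐ x, x ∈ overlap φ φ' ∩ φ.symm ⁻¹' Ω → ∀ j l,
      ∑ r, (fderiv ℝ (trans φ φ') x (EuclideanSpace.single j 1)) r * D' r l (trans φ φ' x)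
      = ∑ k, ((fderiv ℝ (trans φ φ') x (EuclideanSpace.single k 1)) l * D j k x
        + (fderiv ℝ (fderiv ℝ (trans φ φ')) x (EuclideanSpace.single j 1)
            (EuclideanSpace.single k 1)) l * comp φ u k x) := by
  set W : Set (Euc m) := overlap φ φ' ∩ φ.symm ⁻¹' Ω with hW
  have H₀ := isDiffeoOn_trans hφ hφ'
  have hWd : W ⊆ domIn φ Ω := fun x hx ↦ ⟨hx.1.1, hx.2⟩
  have hWo : IsOpen W := by
    have : W = overlap φ φ' ∩ domIn φ Ω :=
      Subset.antisymm (fun x hx ↦ ⟨hx.1, hWd hx⟩) fun x hx ↦ ⟨hx.1, hx.2.2⟩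
    rw [this]
    exact H₀.isOpen_source.inter (isOpen_domIn φ hΩ)
  have H := H₀.restrict hWo inter_subset_left
  have hV : overlap φ' φ ∩ trans φ' φ ⁻¹' W ⊆ domIn φ' Ω := fun y hy ↦ by
    have h2 : φ.symm (trans φ' φ y) ∈ Ω := hy.2.2
    rw [trans, φ.left_inv hy.1.2] at h2
    exact ⟨hy.1.1, h2⟩
  have key : ∀ j l, ∀ᵐ x, x ∈ W →
      ∑ r, (fderiv ℝ (trans φ φ') x (EuclideanSpace.single j 1)) r * D' r l (trans φ φ' x)
      = ∑ k, ((fderiv ℝ (trans φ φ') x (EuclideanSpace.single k 1)) l * D j k x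
        + (fderiv ℝ (fderiv ℝ (trans φ φ')) x (EuclideanSpace.single j 1)
            (EuclideanSpace.single k 1)) l * comp φ u k x) := by
    intro j l
    have h1 := HasWeakPartial.comp_diffeo H (fun r ↦ (hD' r l).mono hV) j
    have h2 := HasWeakPartial.sum Finset.univ fun k _ ↦
      ((hD j k).mono hWd).contDiffOn_mul hWo
        (H.contDiffOn_partial (EuclideanSpace.single k 1) l)
    refine HasWeakPartial.ae_eq hWo h1 (h2.congr_ae hWo (ae_of_all _ fun x hx ↦ ?_)
      (ae_of_all _ fun x hx ↦ Finset.sum_congr rfl fun k _ ↦ ?_))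
    · have h3 := compVec_trans hφ hφ' u hx.1
      rw [map_eq_sum_smul_single (fderiv ℝ _ _)] at h3
      have h4 := congrArg (EuclideanSpace.proj (𝕜 := ℝ) l) h3
      simp only [map_sum, map_smul, PiLp.proj_apply, compVec_apply, smul_eq_mul] at h4
      rw [h4]
      exact Finset.sum_congr rfl fun k _ ↦ mul_comm _ _
    · have hJ : HasFDerivAt (fderiv ℝ (trans φ φ')) (fderiv ℝ (fderiv ℝ (trans φ φ')) x) x :=
        ((H.contDiffOn_fderiv.contDiffAt (hWo.mem_nhds hx)).differentiableAt
          (by simp)).hasFDerivAt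
      have h3 := (EuclideanSpace.proj (𝕜 := ℝ) l).hasFDerivAt.comp x
        (hJ.clm_apply (hasFDerivAt_const (EuclideanSpace.single k (1 : ℝ)) x))
      have h4 : fderiv ℝ (fun y ↦ (fderiv ℝ (trans φ φ') y (EuclideanSpace.single k 1)) l) x = _ :=
        h3.fderiv
      rw [h4]
      simp
  have key' := ae_all_iff.2 fun j ↦ ae_all_iff.2 fun l ↦ key j l
  filter_upwards [key'] with x hx hxW j l
  exact hx j l hxW

variable [IsManifold 𝓘(ℝ, Euc m) ∞ M]

/-- The components of `∇_u u` in the chart `φ`, where `D` consists of the weak derivatives of the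
components of `u`. -/
def covVec (g : RMetric m M) (φ : OpenPartialHomeomorph M (Euc m)) (u : VField m M)
    (D : Fin m → Fin m → Euc m → ℝ) (x : Euc m) : Euc m :=
  WithLp.toLp 2 (fun l ↦ ∑ j, comp φ u j x * D j l x)
    + christoffelVec g φ x (compVec φ u x) (compVec φ u x)

/-- `∇_u u` transforms as a vector field. -/
theorem covVec_trans (g : RMetric m M) {φ φ' : OpenPartialHomeomorph M (Euc m)}
    (hφ : φ ∈ smoothCharts m M) (hφ' : φ' ∈ smoothCharts m M) {Ω : Set M} (hΩ : IsOpen Ω)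
    {u : VField m M} {D D' : Fin m → Fin m → Euc m → ℝ}
    (hD : ∀ j l, HasWeakPartial (domIn φ Ω) j (comp φ u l) (D j l))
    (hD' : ∀ j l, HasWeakPartial (domIn φ' Ω) j (comp φ' u l) (D' j l)) :
    ∀ᵐ x, x ∈ overlap φ φ' ∩ φ.symm ⁻¹' Ω →
      covVec g φ' u D' (trans φ φ' x) = fderiv ℝ (trans φ φ') x (covVec g φ u D x) := by
  filter_upwards [weakPartial_trans hφ hφ' hΩ hD hD'] with x hx hxW
  rw [covVec, covVec, map_add, christoffelVec_trans g hφ hφ' hxW.1, ← compVec_trans hφ hφ' u hxW.1,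
    add_comm (christoffelVec _ _ _ _ _), ← add_assoc]
  congr 1
  ext l
  have hproj : ∀ z : Euc m, z l = EuclideanSpace.proj (𝕜 := ℝ) l z := fun z ↦ rfl
  have e1 : ∀ r, comp φ' u r (trans φ φ' x)
      = ∑ j, comp φ u j x * (fderiv ℝ (trans φ φ') x (EuclideanSpace.single j 1)) r := by
    intro r
    have h3 := compVec_trans hφ hφ' u hxW.1
    rw [map_eq_sum_smul_single (fderiv ℝ _ _)] at h3
    have h4 := congrArg (EuclideanSpace.proj (𝕜 := ℝ) r) h3
    simpa only [map_sum, map_smul, PiLp.proj_apply, compVec_apply, smul_eq_mul] using h4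
  have e2 : (fderiv ℝ (fderiv ℝ (trans φ φ')) x (compVec φ u x) (compVec φ u x)) l
      = ∑ j, comp φ u j x * ∑ k, (fderiv ℝ (fderiv ℝ (trans φ φ')) x (EuclideanSpace.single j 1)
            (EuclideanSpace.single k 1)) l * comp φ u k x := by
    rw [map_eq_sum_smul_single (fderiv ℝ (fderiv ℝ _) _), sum_apply, hproj, map_sum]
    refine Finset.sum_congr rfl fun j _ ↦ ?_
    rw [smul_apply, map_smul, map_eq_sum_smul_single (fderiv ℝ (fderiv ℝ _) _ _), map_sum,
      smul_eq_mul, compVec_apply]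
    refine congrArg _ (Finset.sum_congr rfl fun k _ ↦ ?_)
    rw [map_smul, smul_eq_mul, mul_comm]
    rfl
  have e3 : (fderiv ℝ (trans φ φ') x (WithLp.toLp 2 fun l ↦ ∑ j, comp φ u j x * D j l x)) l
      = ∑ j, comp φ u j x * ∑ k,
        (fderiv ℝ (trans φ φ') x (EuclideanSpace.single k 1)) l * D j k x := by
    rw [map_eq_sum_smul_single (fderiv ℝ _ _), hproj, map_sum]
    simp only [map_smul, smul_eq_mul, Finset.sum_mul, Finset.mul_sum, PiLp.proj_apply]
    rw [Finset.sum_comm]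
    exact Finset.sum_congr rfl fun j _ ↦ Finset.sum_congr rfl fun k _ ↦ by ring
  rw [PiLp.add_apply, e2, e3, ← Finset.sum_add_distrib]
  simp only [← mul_add, ← Finset.sum_add_distrib]
  simp only [e1, Finset.sum_mul]
  rw [Finset.sum_comm]
  refine Finset.sum_congr rfl fun j _ ↦ ?_
  rw [← hx hxW j l, Finset.mul_sum]
  exact Finset.sum_congr rfl fun r _ ↦ by ring

/-- A vector field with weak derivatives has a covariant derivative. It is defined at each point by
the coordinate expression in some chart of the finite atlas; almost everywhere this does not depend
on the chart. -/
theorem exists_isCovDeriv (g : RMetric m M) (A : NormData m M) {Ω : Set M} (hΩ : IsOpen Ω)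
    {u : VField m M} (hu : ∀ φ ∈ smoothCharts m M, ∃ D : Fin m → Fin m → Euc m → ℝ,
      ∀ j l, HasWeakPartial (domIn φ Ω) j (comp φ u l) (D j l)) :
    ∃ F : VField m M, IsCovDeriv g Ω u u F := by
  choose! D hD using hu
  have hcov : ∀ p : M, ∃ i, p ∈ (A.chart i).source := fun p ↦ by
    obtain ⟨i, hi⟩ := A.χ.exists_pos_of_mem (mem_univ p)
    exact ⟨i, A.subordinate i (subset_tsupport _ hi.ne')⟩
  choose idx hidx using hcov
  set F : VField m M := fun p ↦ (mfderiv 𝓘(ℝ, Euc m) 𝓘(ℝ, Euc m) (A.chart (idx p)).symm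
    (A.chart (idx p) p) (covVec g (A.chart (idx p)) u (D (A.chart (idx p)))
      (A.chart (idx p) p)) : Euc m) with hF
  refine ⟨F, fun φ hφ ↦ ⟨D φ, hD φ hφ, ?_⟩⟩
  have h := ae_all_iff.2 fun i ↦ covVec_trans g hφ (A.chart_mem i) hΩ (hD φ hφ)
    (hD _ (A.chart_mem i))
  filter_upwards [h] with x hx hxW l
  have hxo : x ∈ overlap φ (A.chart (idx (φ.symm x))) := ⟨hxW.1, hidx _⟩
  have h1 := hx (idx (φ.symm x)) ⟨hxo, hxW.2⟩
  set φ' := A.chart (idx (φ.symm x)) with hφ'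
  have H := isDiffeoOn_trans hφ (A.chart_mem (idx (φ.symm x)))
  have h2 : compVec φ F x = covVec g φ u (D φ) x := by
    have h3 := mfderiv_mfderiv_symm_trans (A.chart_mem (idx (φ.symm x))) hφ (H.mapsTo hxo)
      (covVec g φ' u (D φ') (trans φ φ' x))
    have h4 : ∀ q : M, q = φ.symm x → ∀ a : Euc m,
        (mfderiv 𝓘(ℝ, Euc m) 𝓘(ℝ, Euc m) φ q a : Euc m)
        = (mfderiv 𝓘(ℝ, Euc m) 𝓘(ℝ, Euc m) φ (φ.symm x) a : Euc m) := by
      rintro _ rfl a; rfl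
    have h5 := (h4 _ (φ'.left_inv hxo.2) _).symm.trans h3
    refine Eq.trans h5 ?_
    rw [h1]
    exact congrArg (fun B : Euc m →L[ℝ] Euc m ↦ B (covVec g φ u (D φ) x))
      (H.fderiv_comp_fderiv hxo)
  rw [← compVec_apply, h2]
  rfl

end CovariantDerivative

/-! ### The nonlinearity in a chart -/

section Nonlinearity

theorem exists_common_bound {α ι : Type*} [TopologicalSpace α] [Fintype ι] {K : Set α}
    (hK : IsCompact K) {f : ι → α → ℝ} (hf : ∀ i, ContinuousOn (f i) K) :
    ∃ C : ℝ, 0 ≤ C ∧ ∀ i, ∀ x ∈ K, |f i x| ≤ C := by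
  choose B hB using fun i ↦ hK.exists_bound_of_continuousOn (hf i)
  refine ⟨∑ i, |B i|, Finset.sum_nonneg fun i _ ↦ abs_nonneg _, fun i x hx ↦ ?_⟩
  exact (hB i x hx).trans <| (le_abs_self _).trans <|
    Finset.single_le_sum (f := fun i ↦ |B i|) (fun _ _ ↦ abs_nonneg _) (Finset.mem_univ i)

/-- The triangle inequality for the seminorm of a positive semidefinite form. -/
theorem abs_sqrt_form_sub_sqrt_form_le {m : ℕ} (B : Euc m →L[ℝ] Euc m →L[ℝ] ℝ)
    (hs : ∀ a b, B a b = B b a) (hp : ∀ a, 0 ≤ B a a) (a b : Euc m) :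
    |√(B a a) - √(B b b)| ≤ √(B (a - b) (a - b)) := by
  have cs : ∀ a b, B a b ≤ √(B a a) * √(B b b) := by
    intro a b
    have h := LinearMap.BilinForm.apply_mul_apply_le_of_forall_zero_le
      (ContinuousLinearMap.toBilinForm B) hp a b
    have h' : B a b * B b a ≤ B a a * B b b := h
    rw [hs b a, ← sq] at h'
    rw [← Real.sqrt_mul (hp a)]
    exact Real.le_sqrt_of_sq_le h'
  have tri : ∀ a b, √(B (a + b) (a + b)) ≤ √(B a a) + √(B b b) := by
    intro a b
    rw [Real.sqrt_le_left (by positivity)]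
    have e : B (a + b) (a + b) = B a a + 2 * B a b + B b b := by
      simp only [map_add, add_apply, hs b a]; ring
    have h1 := Real.sq_sqrt (hp a)
    have h2 := Real.sq_sqrt (hp b)
    nlinarith [cs a b]
  have hneg : √(B (b - a) (b - a)) = √(B (a - b) (a - b)) := by
    rw [← neg_sub a b, map_neg, map_neg, neg_apply, neg_neg]
  rw [abs_sub_le_iff]
  constructor
  · have := tri (a - b) b
    rw [sub_add_cancel] at this
    linarith
  · have := tri (b - a) a
    rw [sub_add_cancel, hneg] at this
    linarith

variable {m : ℕ} {M : Type*} [TopologicalSpace M] [ChartedSpace (Euc m) M]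
  [IsManifold 𝓘(ℝ, Euc m) ∞ M]

/-- The components of `k |a| a + β ∇_a a` at a point with coordinates `x`, as a function of the
components of `a` and of their derivatives `D`. -/
def nonlin (g : RMetric m M) (k β : ℝ) (φ : OpenPartialHomeomorph M (Euc m)) (x a : Euc m)
    (D : Fin m → Fin m → ℝ) (l : Fin m) : ℝ :=
  k * √(metricForm g φ x a a) * a l
    + β * (∑ j, a j * D j l + ∑ r, ∑ j, christoffel g φ l r j x * a r * a j)

theorem metricForm_eq_sum (g : RMetric m M) (φ : OpenPartialHomeomorph M (Euc m)) (x a b : Euc m) :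
    metricForm g φ x a b = ∑ j, ∑ k, gMat g φ x j k * a j * b k := by
  rw [map_eq_sum_smul_single (metricForm g φ x) a, sum_apply]
  refine Finset.sum_congr rfl fun j _ ↦ ?_
  rw [smul_apply, map_eq_sum_smul_single (metricForm g φ x _) b, smul_eq_mul, Finset.mul_sum]
  refine Finset.sum_congr rfl fun k _ ↦ ?_
  rw [gMat_apply, smul_eq_mul]; ring

theorem exists_sqrt_metricForm_le (g : RMetric m M) {φ : OpenPartialHomeomorph M (Euc m)}
    (hφ : φ ∈ smoothCharts m M) {K : Set (Euc m)} (hKc : IsCompact K) (hK : K ⊆ φ.target) :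
    ∃ C : ℝ, 0 ≤ C ∧ ∀ x ∈ K, ∀ a, √(metricForm g φ x a a) ≤ C * ∑ j, |a j| := by
  obtain ⟨C, hC0, hC⟩ := exists_common_bound hKc
    fun i : Fin m × Fin m ↦ (continuousOn_gMat g hφ i.1 i.2).mono hK
  refine ⟨√C, Real.sqrt_nonneg _, fun x hx a ↦ ?_⟩
  rw [← Real.sqrt_sq (Finset.sum_nonneg fun j _ ↦ abs_nonneg (a j)), ← Real.sqrt_mul hC0]
  refine Real.sqrt_le_sqrt ?_
  rw [metricForm_eq_sum, sq, Finset.sum_mul_sum, Finset.mul_sum]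
  refine Finset.sum_le_sum fun j _ ↦ ?_
  rw [Finset.mul_sum]
  refine Finset.sum_le_sum fun k _ ↦ (le_abs_self _).trans ?_
  rw [abs_mul, abs_mul, mul_assoc]
  exact mul_le_mul_of_nonneg_right (hC (j, k) x hx) (by positivity)

/-- The pointwise Lipschitz estimate of the nonlinearity; each term contains at most one
derivative. -/
theorem exists_abs_nonlin_sub_le (g : RMetric m M) (k β : ℝ)
    {φ : OpenPartialHomeomorph M (Euc m)} (hφ : φ ∈ smoothCharts m M) {K : Set (Euc m)}
    (hKc : IsCompact K) (hK : K ⊆ φ.target) :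
    ∃ C : ℝ, 0 ≤ C ∧ ∀ x ∈ K, ∀ (a b : Euc m) (D E : Fin m → Fin m → ℝ) (l : Fin m),
      |nonlin g k β φ x a D l - nonlin g k β φ x b E l|
        ≤ C * ((∑ j, |a j| + ∑ j, |b j|) * ∑ j, |a j - b j|
          + (∑ j, |a j|) * (∑ j, ∑ l, |D j l - E j l|)
          + (∑ j, |a j - b j|) * ∑ j, ∑ l, |E j l|) := by
  obtain ⟨C₁, hC₁0, hC₁⟩ := exists_sqrt_metricForm_le g hφ hKc hK
  obtain ⟨G, hG0, hG⟩ := exists_common_bound hKc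
    fun i : Fin m × Fin m × Fin m ↦ (continuousOn_christoffel g hφ i.1 i.2.1 i.2.2).mono hK
  have hΓ : ∀ l r j, ∀ x ∈ K, |christoffel g φ l r j x| ≤ G := fun l r j ↦ hG (l, r, j)
  refine ⟨|k| * C₁ + |β| * (1 + G), by positivity, fun x hx a b D E l ↦ ?_⟩
  have hbil : ∀ a b : Fin m → ℝ, |∑ r, ∑ j, christoffel g φ l r j x * a r * b j|
      ≤ G * ((∑ j, |a j|) * ∑ j, |b j|) := by
    intro a b
    rw [Finset.sum_mul_sum, Finset.mul_sum]
    refine (Finset.abs_sum_le_sum_abs _ _).trans (Finset.sum_le_sum fun r _ ↦ ?_)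
    rw [Finset.mul_sum]
    refine (Finset.abs_sum_le_sum_abs _ _).trans (Finset.sum_le_sum fun j _ ↦ ?_)
    rw [abs_mul, abs_mul, mul_assoc]
    exact mul_le_mul_of_nonneg_right (hΓ l r j x hx) (by positivity)
  have hlin : ∀ (a : Fin m → ℝ) (D : Fin m → Fin m → ℝ), |∑ j, a j * D j l|
      ≤ (∑ j, |a j|) * ∑ j, ∑ l, |D j l| := by
    intro a D
    rw [Finset.sum_mul]
    refine (Finset.abs_sum_le_sum_abs _ _).trans (Finset.sum_le_sum fun j _ ↦ ?_)
    rw [abs_mul]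
    refine mul_le_mul_of_nonneg_left ?_ (abs_nonneg _)
    exact (Finset.single_le_sum (f := fun l ↦ |D j l|) (fun _ _ ↦ by positivity)
        (Finset.mem_univ l)).trans
      (Finset.single_le_sum (f := fun j ↦ ∑ l, |D j l|) (fun _ _ ↦ by positivity)
        (Finset.mem_univ j))
  have hcoord : ∀ a : Fin m → ℝ, |a l| ≤ ∑ j, |a j| := fun a ↦
    Finset.single_le_sum (f := fun j ↦ |a j|) (fun _ _ ↦ by positivity) (Finset.mem_univ l)
  have hpos : ∀ a, 0 ≤ metricForm g φ x a a := fun a ↦ by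
    rcases eq_or_ne a 0 with rfl | ha
    · simp
    · exact (metricForm_pos g hφ (hK hx) ha).le
  have hd : nonlin g k β φ x a D l - nonlin g k β φ x b E l
      = k * ((√(metricForm g φ x a a) - √(metricForm g φ x b b)) * b l
          + √(metricForm g φ x a a) * (a l - b l))
        + β * ((∑ j, a j * (D j l - E j l) + ∑ j, (a j - b j) * E j l)
          + (∑ r, ∑ j, christoffel g φ l r j x * a r * (a j - b j)
            + ∑ r, ∑ j, christoffel g φ l r j x * (a r - b r) * b j)) := by
    have e1 : ∑ j, a j * (D j l - E j l) + ∑ j, (a j - b j) * E j l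
        = ∑ j, a j * D j l - ∑ j, b j * E j l := by
      rw [← Finset.sum_add_distrib, ← Finset.sum_sub_distrib]
      exact Finset.sum_congr rfl fun j _ ↦ by ring
    have e2 : ∑ r, ∑ j, christoffel g φ l r j x * a r * (a j - b j)
            + ∑ r, ∑ j, christoffel g φ l r j x * (a r - b r) * b j
        = ∑ r, ∑ j, christoffel g φ l r j x * a r * a j
          - ∑ r, ∑ j, christoffel g φ l r j x * b r * b j := by
      simp only [← Finset.sum_add_distrib, ← Finset.sum_sub_distrib]
      exact Finset.sum_congr rfl fun r _ ↦ Finset.sum_congr rfl fun j _ ↦ by ring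
    rw [e1, e2, nonlin, nonlin]; ring
  have i1 : |(√(metricForm g φ x a a) - √(metricForm g φ x b b)) * b l|
      ≤ C₁ * (∑ j, |a j - b j|) * ∑ j, |b j| := by
    rw [abs_mul]
    exact mul_le_mul ((abs_sqrt_form_sub_sqrt_form_le _ (metricForm_symm g φ x) hpos a b).trans
      (hC₁ x hx (a - b))) (hcoord b) (abs_nonneg _) (by positivity)
  have i2 : |√(metricForm g φ x a a) * (a l - b l)| ≤ C₁ * (∑ j, |a j|) * ∑ j, |a j - b j| := by
    rw [abs_mul, abs_of_nonneg (Real.sqrt_nonneg _)]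
    exact mul_le_mul (hC₁ x hx a) (hcoord fun j ↦ a j - b j) (abs_nonneg _) (by positivity)
  have i3 := hlin a (fun j l ↦ D j l - E j l)
  have i4 := hlin (fun j ↦ a j - b j) E
  have i5 := hbil a (fun j ↦ a j - b j)
  have i6 := hbil (fun j ↦ a j - b j) b
  rw [hd]
  set s := ∑ j, |a j|
  set t := ∑ j, |b j|
  set c := ∑ j, |a j - b j|
  set p := ∑ j, ∑ l, |D j l - E j l|
  set q := ∑ j, ∑ l, |E j l|
  have s0 : 0 ≤ s := by positivity
  have t0 : 0 ≤ t := by positivity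
  have c0 : 0 ≤ c := by positivity
  have p0 : 0 ≤ p := by positivity
  have q0 : 0 ≤ q := by positivity
  clear_value s t c p q
  calc _ ≤ |k| * (C₁ * c * t + C₁ * s * c) + |β| * ((s * p + c * q) + (G * (s * c) + G * (c * t))) := by
        refine (abs_add_le _ _).trans (add_le_add ?_ ?_)
        · rw [abs_mul]
          exact mul_le_mul_of_nonneg_left ((abs_add_le _ _).trans (add_le_add i1 i2)) (abs_nonneg _)
        · rw [abs_mul]
          exact mul_le_mul_of_nonneg_left ((abs_add_le _ _).trans (add_le_add
            ((abs_add_le _ _).trans (add_le_add i3 i4))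
            ((abs_add_le _ _).trans (add_le_add i5 i6)))) (abs_nonneg _)
    _ = (|k| * C₁ + |β| * G) * ((s + t) * c) + |β| * (s * p + c * q) := by ring
    _ ≤ (|k| * C₁ + |β| * (1 + G)) * ((s + t) * c)
        + (|k| * C₁ + |β| * (1 + G)) * (s * p + c * q) := by
        have n1 : 0 ≤ |β| := abs_nonneg β
        have n2 : 0 ≤ |k| * C₁ := by positivity
        have n3 : 0 ≤ |β| * G := by positivity
        refine add_le_add (mul_le_mul_of_nonneg_right ?_ (by positivity))
          (mul_le_mul_of_nonneg_right ?_ (by positivity)) <;> linarith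
    _ = _ := by ring

theorem aestronglyMeasurable_nonlin (g : RMetric m M) (k β : ℝ)
    {φ : OpenPartialHomeomorph M (Euc m)} (hφ : φ ∈ smoothCharts m M) {K : Set (Euc m)}
    (hKc : IsCompact K) (hK : K ⊆ φ.target) {a : Euc m → Euc m} {D : Fin m → Fin m → Euc m → ℝ}
    (ha : ∀ j, AEStronglyMeasurable (fun x ↦ a x j) (volume.restrict K))
    (hD : ∀ j l, AEStronglyMeasurable (D j l) (volume.restrict K)) (l : Fin m) :
    AEStronglyMeasurable (fun x ↦ nonlin g k β φ x (a x) (fun j l ↦ D j l x) l)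
      (volume.restrict K) := by
  have hg : ∀ j k, AEStronglyMeasurable (fun x ↦ gMat g φ x j k) (volume.restrict K) := fun j k ↦
    ((continuousOn_gMat g hφ j k).mono hK).aestronglyMeasurable hKc.measurableSet
  have hΓ : ∀ r j, AEStronglyMeasurable (christoffel g φ l r j) (volume.restrict K) := fun r j ↦
    ((continuousOn_christoffel g hφ l r j).mono hK).aestronglyMeasurable hKc.measurableSet
  simp only [nonlin, metricForm_eq_sum]
  refine ((aestronglyMeasurable_const.mul
    (Real.continuous_sqrt.comp_aestronglyMeasurable ?_)).mul (ha l)).add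
    (aestronglyMeasurable_const.mul (.add ?_ ?_))
  · exact Finset.aestronglyMeasurable_fun_sum _ fun j _ ↦
      Finset.aestronglyMeasurable_fun_sum _ fun k _ ↦ ((hg j k).mul (ha j)).mul (ha k)
  · exact Finset.aestronglyMeasurable_fun_sum _ fun j _ ↦ (ha j).mul (hD j l)
  · exact Finset.aestronglyMeasurable_fun_sum _ fun r _ ↦
      Finset.aestronglyMeasurable_fun_sum _ fun j _ ↦ ((hΓ r j).mul (ha r)).mul (ha j)

/-- The coordinate expression of the nonlinear operator. -/
theorem IsNonlinearOp.exists_comp_eq {g : RMetric m M} {k β : ℝ} {Ω : Set M} {v Y : VField m M}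
    (h : IsNonlinearOp g k β Ω v Y) {φ : OpenPartialHomeomorph M (Euc m)}
    (hφ : φ ∈ smoothCharts m M) :
    ∃ D : Fin m → Fin m → Euc m → ℝ,
      (∀ j l, HasWeakPartial (domIn φ Ω) j (comp φ v l) (D j l)) ∧
      (∀ᵐ x, x ∈ domIn φ Ω → ∀ l,
        comp φ Y l x = nonlin g k β φ x (compVec φ v x) (fun j l ↦ D j l x) l) ∧
      ∀ x, φ.symm x ∉ Ω → ∀ l, comp φ Y l x = 0 := by
  obtain ⟨F, hF, rfl⟩ := h
  obtain ⟨D, hD, hF⟩ := hF φ hφ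
  refine ⟨D, hD, ?_, fun x hx l ↦ ?_⟩
  · filter_upwards [hF] with x hx hxW l
    have hY : compVec φ (zeroExt Ω fun p ↦ (k * len g v p) • v p + β • F p) x
        = (k * len g v (φ.symm x)) • compVec φ v x + β • compVec φ F x := by
      have h1 : zeroExt Ω (fun p ↦ (k * len g v p) • v p + β • F p) (φ.symm x)
          = (k * len g v (φ.symm x)) • v (φ.symm x) + β • F (φ.symm x) := by
        exact if_pos (show φ.symm x ∈ Ω from hxW.2)
      rw [compVec, h1, map_add, map_smul, map_smul]
      rfl
    rw [← compVec_apply, hY, PiLp.add_apply, PiLp.smul_apply, PiLp.smul_apply, smul_eq_mul,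
      smul_eq_mul, compVec_apply φ F, hx hxW l, len, inner_eq_metricForm g hφ v v hxW.1]
    rfl
  · have h1 : zeroExt Ω (fun p ↦ (k * len g v p) • v p + β • F p) (φ.symm x) = 0 := by
      exact if_neg hx
    rw [← compVec_apply, compVec, h1, map_zero]
    rfl

end Nonlinearity

/-! ### The estimate in one chart -/

section Estimate

theorem eLpNorm_sum_abs_le {α ι : Type*} [MeasurableSpace α] {μ : Measure α} [Fintype ι]
    {f : ι → α → ℝ} {p : ℝ≥0∞} (hp : 1 ≤ p) (hf : ∀ i, AEStronglyMeasurable (f i) μ) :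
    eLpNorm (fun x ↦ ∑ i, |f i x|) p μ ≤ ∑ i, eLpNorm (f i) p μ := by
  have : (fun x ↦ ∑ i, |f i x|) = ∑ i, fun x ↦ ‖f i x‖ := by
    ext x; simp
  rw [this]
  refine (eLpNorm_sum_le (fun i _ ↦ (hf i).norm) hp).trans (Finset.sum_le_sum fun i _ ↦ ?_)
  rw [eLpNorm_norm]

theorem aestronglyMeasurable_sum_abs {α ι : Type*} [MeasurableSpace α] {μ : Measure α} [Fintype ι]
    {f : ι → α → ℝ} (hf : ∀ i, AEStronglyMeasurable (f i) μ) :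
    AEStronglyMeasurable (fun x ↦ ∑ i, |f i x|) μ :=
  Finset.aestronglyMeasurable_fun_sum _ fun i _ ↦ (hf i).norm

/-- Hölder's inequality `L⁶ · L² ⊆ L^{3/2}`. -/
theorem eLpNorm_mul_le_six_two {α : Type*} [MeasurableSpace α] {μ : Measure α} {f g : α → ℝ}
    (hf : AEStronglyMeasurable f μ) (hg : AEStronglyMeasurable g μ) :
    eLpNorm (fun x ↦ f x * g x) (ENNReal.ofReal (3 / 2)) μ ≤ eLpNorm f 6 μ * eLpNorm g 2 μ := by
  have : ENNReal.HolderTriple 6 2 (ENNReal.ofReal (3 / 2)) := ⟨by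
    rw [← ENNReal.ofReal_ofNat 6, ← ENNReal.ofReal_ofNat 2,
      ← ENNReal.ofReal_inv_of_pos (by norm_num), ← ENNReal.ofReal_inv_of_pos (by norm_num),
      ← ENNReal.ofReal_inv_of_pos (by norm_num), ← ENNReal.ofReal_add (by norm_num) (by norm_num)]
    norm_num⟩
  have h := eLpNorm_le_eLpNorm_mul_eLpNorm'_of_norm (p := 6) (q := 2)
    (r := ENNReal.ofReal (3 / 2)) hf hg (fun a b : ℝ ↦ a * b) 1
    (ae_of_all _ fun x ↦ by rw [NNReal.coe_one, one_mul, norm_mul])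
  rwa [ENNReal.coe_one, one_mul] at h

variable {m : ℕ} {M : Type*} [TopologicalSpace M] [ChartedSpace (Euc m) M]

theorem AEOn.compVec_eq {Ω : Set M} {V v : VField m M} (h : AEOn m Ω fun p ↦ V p = v p)
    {φ : OpenPartialHomeomorph M (Euc m)} (hφ : φ ∈ smoothCharts m M) :
    ∀ᵐ x, x ∈ domIn φ Ω → compVec φ V x = compVec φ v x := by
  filter_upwards [h φ hφ] with x hx hxW
  rw [compVec, hx hxW.1 hxW.2]
  rfl

/-- Extensions of a vector field have the same weak derivatives in `Ω`. -/
theorem AEOn.weakPartial_eq {Ω : Set M} (hΩ : IsOpen Ω) {V v : VField m M}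
    (h : AEOn m Ω fun p ↦ V p = v p) {φ : OpenPartialHomeomorph M (Euc m)}
    (hφ : φ ∈ smoothCharts m M) {D E : Fin m → Fin m → Euc m → ℝ}
    (hD : ∀ j l, HasWeakPartial φ.target j (comp φ V l) (D j l))
    (hE : ∀ j l, HasWeakPartial (domIn φ Ω) j (comp φ v l) (E j l)) :
    ∀ᵐ x, x ∈ domIn φ Ω → ∀ j l, D j l x = E j l x := by
  have h1 : ∀ j l, ∀ᵐ x, x ∈ domIn φ Ω → D j l x = E j l x := fun j l ↦
    HasWeakPartial.ae_eq (isOpen_domIn φ hΩ) (((hD j l).mono inter_subset_left).congr_ae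
      (isOpen_domIn φ hΩ) ((h.compVec_eq hφ).mono fun x hx hxW ↦ by
        rw [← compVec_apply, hx hxW, compVec_apply]) (ae_of_all _ fun _ _ ↦ rfl)) (hE j l)
  filter_upwards [ae_all_iff.2 fun j ↦ ae_all_iff.2 fun l ↦ h1 j l] with x hx hxW j l
  exact hx j l hxW

theorem compVec_sub (φ : OpenPartialHomeomorph M (Euc m)) (u v : VField m M) (x : Euc m) :
    compVec φ (u - v) x = compVec φ u x - compVec φ v x := by
  simp only [compVec, Pi.sub_apply, map_sub]
  rfl

theorem abs_chi_le_one (A : NormData m M) (i : Fin A.N) (p : M) : |A.χ i p| ≤ 1 := by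
  rw [abs_of_nonneg (A.χ.nonneg i p)]
  exact A.χ.le_one i p

variable [IsManifold 𝓘(ℝ, Euc m) ∞ M]

/-- The estimate of the nonlinear operator in one chart. -/
theorem exists_hsNorm_localRep_sub_le [CompactSpace M] (hm : m = 2 ∨ m = 3) (g : RMetric m M)
    (A : NormData m M) {Ω : Set M} (hΩ : IsOpen Ω) (k β : ℝ) (i : Fin A.N) :
    ∃ C : ℝ≥0, ∀ σ : ℝ, 1 ≤ σ → ∀ τ : ℝ, τ ≤ -1 / 2 → ∀ v w Y Z V W U : VField m M,
      IsNonlinearOp g k β Ω v Y → IsNonlinearOp g k β Ω w Z →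
      MemH A σ V → (AEOn m Ω fun p ↦ V p = v p) → MemH A σ W → (AEOn m Ω fun p ↦ W p = w p) →
      MemH A σ U → (AEOn m Ω fun p ↦ U p = (v - w) p) → ∀ l,
        MemHs τ (localRep A (Y - Z) i l) ∧ hsNorm τ (localRep A (Y - Z) i l)
          ≤ C * ((normH A σ V + normH A σ W) * normH A σ U) := by
  set φ := A.chart i with hφdef
  have hφ : φ ∈ smoothCharts m M := A.chart_mem i
  set K := suppSet A i with hKdef
  have hKc : IsCompact K := isCompact_suppSet A i
  have hK : K ⊆ φ.target := suppSet_subset_target A i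
  obtain ⟨C₁, hC₁⟩ := exists_comp_bounds hm A hφ hKc hK
  obtain ⟨C₂, hC₂0, hC₂⟩ := exists_abs_nonlin_sub_le g k β hφ hKc hK
  obtain ⟨C₃, hC₃⟩ := exists_hsNorm_le_eLpNorm hm
  obtain ⟨C₄, hC₄⟩ := exists_localReal_bounds hm A
  refine ⟨C₃ * (C₂.toNNReal * (m * C₁ * (m * C₁) + m * C₁ * ((m * m : ℕ) * C₁))), ?_⟩
  intro σ hσ τ hτ v w Y Z V W U hY hZ hV hVv hW hWw hU hUvw l
  obtain ⟨DV, hDV, hV6, hV2, hDV2⟩ := hC₁ σ hσ V hV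
  obtain ⟨DW, hDW, hW6, hW2, hDW2⟩ := hC₁ σ hσ W hW
  obtain ⟨DU, hDU, hU6, hU2, hDU2⟩ := hC₁ σ hσ U hU
  obtain ⟨Dv, hDv, hYe, hY0⟩ := hY.exists_comp_eq hφ
  obtain ⟨Dw, hDw, hZe, hZ0⟩ := hZ.exists_comp_eq hφ
  set NV := normH A σ V with hNV
  set NW := normH A σ W with hNW
  set NU := normH A σ U with hNU
  set μ := (volume : Measure (Euc m)).restrict K with hμ
  have : IsFiniteMeasure μ := ⟨by rw [hμ, Measure.restrict_apply_univ]; exact hKc.measure_lt_top⟩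
  have mcomp : ∀ {X : VField m M} {D : Fin m → Fin m → Euc m → ℝ},
      (∀ j l, HasWeakPartial φ.target j (comp φ X l) (D j l)) →
      (∀ j, AEStronglyMeasurable (comp φ X j) μ) ∧ ∀ j l, AEStronglyMeasurable (D j l) μ :=
    fun hD ↦ ⟨fun j ↦ ((hD j j).1.integrableOn_compact_subset hK hKc).aestronglyMeasurable,
      fun j l ↦ ((hD j l).2.1.integrableOn_compact_subset hK hKc).aestronglyMeasurable⟩
  obtain ⟨mV, mDV⟩ := mcomp hDV
  obtain ⟨mW, mDW⟩ := mcomp hDW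
  obtain ⟨mU, mDU⟩ := mcomp hDU
  -- on the part of the chart in `Ω`, everything can be expressed by means of the extensions
  set N : Euc m → ℝ := fun x ↦ nonlin g k β φ x (compVec φ V x) (fun j l ↦ DV j l x) l
    - nonlin g k β φ x (compVec φ W x) (fun j l ↦ DW j l x) l with hN
  have hdiff : ∀ j l, HasWeakPartial (domIn φ Ω) j (comp φ (v - w) l)
      (fun x ↦ Dv j l x - Dw j l x) := fun j l ↦
    ((hDv j l).sub (hDw j l)).congr_ae (isOpen_domIn φ hΩ) (ae_of_all _ fun x _ ↦ by
      simp only [← compVec_apply, compVec_sub]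
      rfl) (ae_of_all _ fun _ _ ↦ rfl)
  have hmain : ∀ᵐ x, x ∈ domIn φ Ω → comp φ (Y - Z) l x = N x ∧
      (∀ j, comp φ V j x - comp φ W j x = comp φ U j x) ∧
      ∀ j l, DV j l x - DW j l x = DU j l x := by
    filter_upwards [hYe, hZe, hVv.compVec_eq hφ, hWw.compVec_eq hφ, hUvw.compVec_eq hφ,
      hVv.weakPartial_eq hΩ hφ hDV hDv, hWw.weakPartial_eq hΩ hφ hDW hDw,
      hUvw.weakPartial_eq hΩ hφ hDU hdiff] with x h1 h2 h3 h4 h5 h6 h7 h8 hx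
    refine ⟨?_, fun j ↦ ?_, fun j l ↦ ?_⟩
    · rw [← compVec_apply, compVec_sub, PiLp.sub_apply, compVec_apply, compVec_apply, h1 hx, h2 hx]
      simp only [hN, h3 hx, h4 hx, h6 hx, h7 hx]
    · simp only [← compVec_apply, h3 hx, h4 hx, h5 hx, compVec_sub]
      rfl
    · rw [h6 hx, h7 hx, h8 hx]
  have hYZ0 : ∀ x, φ.symm x ∉ Ω → comp φ (Y - Z) l x = 0 := by
    intro x hx
    rw [← compVec_apply, compVec_sub, PiLp.sub_apply, compVec_apply, compVec_apply, hY0 x hx, hZ0 x hx,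
      sub_zero]
  set f : Euc m → ℝ := localReal A (Y - Z) i l with hf
  have hf0 : ∀ x, x ∉ K → f x = 0 := fun x hx ↦ localReal_eq_zero A _ i l hx
  have hfK : ∀ x ∈ K, f x = A.χ i (φ.symm x) * comp φ (Y - Z) l x := fun x hx ↦
    indicator_of_mem (hK hx) _
  -- measurability
  have hmN : AEStronglyMeasurable N μ :=
    (aestronglyMeasurable_nonlin g k β hφ hKc hK mV mDV l).sub
      (aestronglyMeasurable_nonlin g k β hφ hKc hK mW mDW l)
  have hmχ : AEStronglyMeasurable (fun x ↦ A.χ i (φ.symm x)) μ :=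
    ((A.χ i).contMDiff.continuous.comp_continuousOn
      (φ.continuousOn_symm.mono hK)).aestronglyMeasurable hKc.measurableSet
  have hmf : AEStronglyMeasurable f μ := by
    refine AEStronglyMeasurable.congr
      ((hmχ.mul hmN).indicator (isOpen_domIn φ hΩ).measurableSet) ?_
    filter_upwards [ae_restrict_of_ae hmain, ae_restrict_mem hKc.measurableSet] with x hx hxK
    by_cases hxW : x ∈ domIn φ Ω
    · rw [indicator_of_mem hxW, hfK x hxK, (hx hxW).1]
      rfl
    · rw [indicator_of_notMem hxW, hfK x hxK, hYZ0 x fun h ↦ hxW ⟨hK hxK, h⟩, mul_zero]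
  -- the pointwise bound
  set a : Euc m → ℝ := fun x ↦ ∑ j, |comp φ V j x| with ha
  set b : Euc m → ℝ := fun x ↦ ∑ j, |comp φ W j x| with hb
  set c : Euc m → ℝ := fun x ↦ ∑ j, |comp φ U j x| with hc
  set p : Euc m → ℝ := fun x ↦ ∑ i : Fin m × Fin m, |DU i.1 i.2 x| with hp
  set q : Euc m → ℝ := fun x ↦ ∑ i : Fin m × Fin m, |DW i.1 i.2 x| with hq
  have hpt : ∀ᵐ x ∂μ, ‖f x‖ ≤ C₂ * ((a x + b x) * c x + a x * p x + c x * q x) := by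
    filter_upwards [ae_restrict_of_ae hmain, ae_restrict_mem hKc.measurableSet] with x hx hxK
    by_cases hxW : x ∈ domIn φ Ω
    · obtain ⟨h1, h2, h3⟩ := hx hxW
      have h4 := hC₂ x hxK (compVec φ V x) (compVec φ W x) (fun j l ↦ DV j l x)
        (fun j l ↦ DW j l x) l
      simp only [compVec_apply, h2, h3] at h4
      simp only [ha, hb, hc, hp, hq, Fintype.sum_prod_type]
      refine le_trans ?_ h4
      rw [hfK x hxK, h1, norm_mul, Real.norm_eq_abs, Real.norm_eq_abs]
      exact mul_le_of_le_one_left (abs_nonneg _) (abs_chi_le_one A i _)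
    · rw [hfK x hxK, hYZ0 x fun h ↦ hxW ⟨hK hxK, h⟩, mul_zero, norm_zero]
      simp only [ha, hb, hc, hp, hq]
      positivity
  -- the bound in `L^{3/2}`
  have hma : AEStronglyMeasurable a μ := aestronglyMeasurable_sum_abs mV
  have hmb : AEStronglyMeasurable b μ := aestronglyMeasurable_sum_abs mW
  have hmc : AEStronglyMeasurable c μ := aestronglyMeasurable_sum_abs mU
  have hmp : AEStronglyMeasurable p μ :=
    aestronglyMeasurable_sum_abs (f := fun i : Fin m × Fin m ↦ DU i.1 i.2) fun i ↦ mDU _ _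
  have hmq : AEStronglyMeasurable q μ :=
    aestronglyMeasurable_sum_abs (f := fun i : Fin m × Fin m ↦ DW i.1 i.2) fun i ↦ mDW _ _
  have one : ∀ {X : VField m M} {r : ℝ≥0∞}, 1 ≤ r → (∀ j, AEStronglyMeasurable (comp φ X j) μ) →
      (∀ j, eLpNorm (comp φ X j) r μ ≤ C₁ * normH A σ X) →
      eLpNorm (fun x ↦ ∑ j, |comp φ X j x|) r μ ≤ (m * C₁ : ℝ≥0) * normH A σ X := by
    intro X r hr hX hle
    refine (eLpNorm_sum_abs_le hr hX).trans ((Finset.sum_le_sum fun j _ ↦ hle j).trans ?_)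
    rw [Finset.sum_const, Finset.card_univ, Fintype.card_fin, nsmul_eq_mul, ENNReal.coe_mul,
      ENNReal.coe_natCast, mul_assoc]
  have two : ∀ {X : VField m M} {D : Fin m → Fin m → Euc m → ℝ},
      (∀ j l, AEStronglyMeasurable (D j l) μ) →
      (∀ j l, eLpNorm (D j l) 2 μ ≤ C₁ * normH A σ X) →
      eLpNorm (fun x ↦ ∑ i : Fin m × Fin m, |D i.1 i.2 x|) 2 μ
        ≤ ((m * m : ℕ) * C₁ : ℝ≥0) * normH A σ X := by
    intro X D hX hle
    refine (eLpNorm_sum_abs_le (f := fun i : Fin m × Fin m ↦ D i.1 i.2) (by norm_num)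
      fun i ↦ hX _ _).trans ((Finset.sum_le_sum fun i _ ↦ hle i.1 i.2).trans ?_)
    rw [Finset.sum_const, Finset.card_univ, Fintype.card_prod, Fintype.card_fin, nsmul_eq_mul,
      ENNReal.coe_mul, ENNReal.coe_natCast, mul_assoc]
  have h1le : (1 : ℝ≥0∞) ≤ ENNReal.ofReal (3 / 2) := by
    rw [← ENNReal.ofReal_one]; exact ENNReal.ofReal_le_ofReal (by norm_num)
  have hL : eLpNorm f (ENNReal.ofReal (3 / 2)) μ ≤ C₂.toNNReal *
      ((m * C₁ * (m * C₁) + m * C₁ * ((m * m : ℕ) * C₁) : ℝ≥0) * ((NV + NW) * NU)) := by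
    have e1 : eLpNorm (fun x ↦ (a x + b x) * c x) (ENNReal.ofReal (3 / 2)) μ
        ≤ ((m * C₁ : ℝ≥0) * NV + (m * C₁ : ℝ≥0) * NW) * ((m * C₁ : ℝ≥0) * NU) :=
      (eLpNorm_mul_le_six_two (hma.add hmb) hmc).trans (mul_le_mul
        ((eLpNorm_add_le hma hmb (by norm_num)).trans (add_le_add
          (one (by norm_num) mV hV6) (one (by norm_num) mW hW6)))
        (one (by norm_num) mU hU2) zero_le zero_le)
    have e2 : eLpNorm (fun x ↦ a x * p x) (ENNReal.ofReal (3 / 2)) μ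
        ≤ ((m * C₁ : ℝ≥0) * NV) * (((m * m : ℕ) * C₁ : ℝ≥0) * NU) :=
      (eLpNorm_mul_le_six_two hma hmp).trans (mul_le_mul
        (one (by norm_num) mV hV6) (two mDU hDU2) zero_le zero_le)
    have e3 : eLpNorm (fun x ↦ c x * q x) (ENNReal.ofReal (3 / 2)) μ
        ≤ ((m * C₁ : ℝ≥0) * NU) * (((m * m : ℕ) * C₁ : ℝ≥0) * NW) :=
      (eLpNorm_mul_le_six_two hmc hmq).trans (mul_le_mul
        (one (by norm_num) mU hU6) (two mDW hDW2) zero_le zero_le)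
    have e0 : eLpNorm f (ENNReal.ofReal (3 / 2)) μ ≤ ENNReal.ofReal C₂ * eLpNorm
        (fun x ↦ (a x + b x) * c x + a x * p x + c x * q x) (ENNReal.ofReal (3 / 2)) μ := by
      refine eLpNorm_le_mul_eLpNorm_of_ae_le_mul ?_ _
      filter_upwards [hpt] with x hx
      exact hx.trans (mul_le_mul_of_nonneg_left (Real.le_norm_self _) hC₂0)
    refine e0.trans (mul_le_mul le_rfl ?_ zero_le zero_le)
    refine (eLpNorm_add_le (((hma.add hmb).mul hmc).add (hma.mul hmp)) (hmc.mul hmq) h1le).trans ?_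
    refine (add_le_add (eLpNorm_add_le ((hma.add hmb).mul hmc) (hma.mul hmp) h1le) le_rfl).trans ?_
    refine (add_le_add (add_le_add e1 e2) e3).trans (le_of_eq ?_)
    push_cast
    ring
  have hfin : ∀ {X}, MemH A σ X → normH A σ X < ⊤ := fun hX ↦ (hC₄ σ hσ _ hX).1
  have hLfin : eLpNorm f (ENNReal.ofReal (3 / 2)) μ < ⊤ := hL.trans_lt
    (ENNReal.mul_lt_top ENNReal.coe_lt_top (ENNReal.mul_lt_top ENNReal.coe_lt_top
      (ENNReal.mul_lt_top (ENNReal.add_lt_top.2 ⟨hfin hV, hfin hW⟩) (hfin hU))))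
  have hfind : K.indicator f = f := by
    rw [indicator_eq_self]
    intro x hx
    by_contra h
    exact hx (hf0 x h)
  have hmemK : MemLp f (ENNReal.ofReal (3 / 2)) μ := ⟨hmf, hLfin⟩
  have hmem : MemLp f (ENNReal.ofReal (3 / 2)) volume := by
    rw [← hfind, memLp_indicator_iff_restrict hKc.measurableSet]
    exact hmemK
  have hint : Integrable f volume := by
    rw [← hfind, integrable_indicator_iff hKc.measurableSet]
    exact hmemK.integrable h1le
  have hnorm : eLpNorm f (ENNReal.ofReal (3 / 2)) volume = eLpNorm f (ENNReal.ofReal (3 / 2)) μ := by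
    rw [hμ, ← eLpNorm_indicator_eq_eLpNorm_restrict hKc.measurableSet, hfind]
  have hC : eLpNorm (localRep A (Y - Z) i l) (ENNReal.ofReal (3 / 2)) volume
      = eLpNorm f (ENNReal.ofReal (3 / 2)) volume := by
    rw [localRep_eq]
    exact eLpNorm_congr_norm_ae (ae_of_all _ fun x ↦ Complex.norm_real _)
  obtain ⟨r1, r2⟩ := hC₃ τ hτ (localRep A (Y - Z) i l) (by rw [localRep_eq]; exact hint.ofReal)
    (by rw [localRep_eq]; exact hmem.ofReal)
  refine ⟨r1, r2.trans ?_⟩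
  rw [hC, hnorm, ENNReal.coe_mul, ENNReal.coe_mul, mul_assoc, mul_assoc]
  exact mul_le_mul le_rfl hL zero_le zero_le

end Estimate

/-! ### Quotient norms -/

section Conclusion

theorem memHs_zero_and_hsNorm_zero {m : ℕ} (σ : ℝ) :
    MemHs σ (fun _ : Euc m ↦ (0 : ℂ)) ∧ hsNorm σ (fun _ : Euc m ↦ (0 : ℂ)) = 0 := by
  have hint : Integrable (fun _ : Euc m ↦ (0 : ℂ)) := integrable_zero _ _ _
  have h0 : regularDist hint = 0 := by
    ext φ
    rw [regularDist_apply]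
    simp
  have h1 : ((0 : Lp ℂ 2 (volume : Measure (Euc m))) : 𝓢'(Euc m, ℂ)) = 0 :=
    map_zero (Lp.toTemperedDistributionCLM ℂ (volume : Measure (Euc m)) 2)
  have h2 : besselPotential (Euc m) ℂ σ (regularDist hint)
      = (0 : Lp ℂ 2 (volume : Measure (Euc m))) := by rw [h0, map_zero, h1]
  exact ⟨⟨hint, 0, h2⟩, by rw [hsNorm_eq_of_besselPotential_eq hint h2, enorm_zero]⟩

variable {m : ℕ} {M : Type*} [TopologicalSpace M] [ChartedSpace (Euc m) M]

theorem compVec_zero (φ : OpenPartialHomeomorph M (Euc m)) (x : Euc m) :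
    compVec φ (0 : VField m M) x = 0 := by
  simp only [compVec, Pi.zero_apply, map_zero]
  rfl

theorem memH_zero_and_normH_zero (A : NormData m M) (σ : ℝ) :
    MemH A σ (0 : VField m M) ∧ normH A σ (0 : VField m M) = 0 := by
  have h : ∀ i l, localRep A (0 : VField m M) i l = fun _ ↦ 0 := by
    intro i l
    ext x
    have : comp (A.chart i) (0 : VField m M) l x = 0 := by
      rw [← compVec_apply, compVec_zero]
      rfl
    rw [localRep, this]
    simp
  simp only [MemH, normH, h, (memHs_zero_and_hsNorm_zero σ).2, Finset.sum_const_zero, and_true]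
  exact fun _ _ ↦ (memHs_zero_and_hsNorm_zero σ).1

theorem MemHs.sub {σ : ℝ} {f f' : Euc m → ℂ} (hf : MemHs σ f) (hf' : MemHs σ f') :
    MemHs σ (fun x ↦ f x - f' x) := by
  obtain ⟨h1, h2⟩ := hf
  obtain ⟨h1', h2'⟩ := hf'
  refine ⟨h1.sub h1', ?_⟩
  have : regularDist (h1.sub h1') = regularDist h1 - regularDist h1' := by
    rw [regularDist, Integrable.toL1_sub]
    exact map_sub (Lp.toTemperedDistributionCLM ℂ (volume : Measure (Euc m)) 1) _ _
  exact (congrArg (MemSobolev σ 2) this).mpr (h2.sub h2')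

/-- `H^σ(Ω)` is closed under subtraction. -/
theorem memHDom_sub (A : NormData m M) {σ : ℝ} {Ω : Set M} {v w : VField m M}
    (hv : MemHDom A σ Ω v) (hw : MemHDom A σ Ω w) : MemHDom A σ Ω (v - w) := by
  obtain ⟨V, hV, hVv⟩ := hv
  obtain ⟨W, hW, hWw⟩ := hw
  refine ⟨V - W, fun i l ↦ ?_, fun φ hφ ↦ ?_⟩
  · have : localRep A (V - W) i l = fun x ↦ localRep A V i l x - localRep A W i l x := by
      ext x
      have : comp (A.chart i) (V - W) l x
          = comp (A.chart i) V l x - comp (A.chart i) W l x := by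
        simp only [← compVec_apply, compVec_sub]
        rfl
      simp only [localRep, this]
      split_ifs
      · push_cast; ring
      · rw [sub_zero]
    rw [this]
    exact (hV i l).sub (hW i l)
  · filter_upwards [hVv φ hφ, hWw φ hφ] with x h1 h2 hx hxΩ
    rw [Pi.sub_apply, Pi.sub_apply, h1 hx hxΩ, h2 hx hxΩ]

/-- An estimate passes to the infima of its factors. Finiteness is needed because the multiplication
of `ℝ≥0∞` does not commute with infima in the presence of `0 * ⊤`. -/
theorem le_mul_add_iInf_mul_iInf {ι κ ν : Type*} [Nonempty ι] [Nonempty κ] [Nonempty ν]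
    {X : ℝ≥0∞} {C : ℝ≥0} {a : ι → ℝ≥0∞} {b : κ → ℝ≥0∞} {c : ν → ℝ≥0∞}
    (ha : ∀ i, a i < ⊤) (hb : ∀ i, b i < ⊤) (hc : ∀ i, c i < ⊤)
    (h : ∀ i j k, X ≤ C * ((a i + b j) * c k)) :
    X ≤ C * (((⨅ i, a i) + ⨅ j, b j) * ⨅ k, c k) := by
  have hC : (C : ℝ≥0∞) ≠ ⊤ := ENNReal.coe_ne_top
  have hct : (⨅ k, c k) ≠ ⊤ := ((iInf_le c (Classical.arbitrary ν)).trans_lt (hc _)).ne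
  rw [ENNReal.iInf_add, ENNReal.iInf_mul fun h ↦ absurd h hct, ENNReal.mul_iInf fun h ↦ absurd h hC]
  refine le_iInf fun i ↦ ?_
  rw [ENNReal.add_iInf, ENNReal.iInf_mul fun h ↦ absurd h hct, ENNReal.mul_iInf fun h ↦ absurd h hC]
  refine le_iInf fun j ↦ ?_
  rw [ENNReal.mul_iInf fun h ↦ absurd h (ENNReal.add_lt_top.2 ⟨ha i, hb j⟩).ne,
    ENNReal.mul_iInf fun h ↦ absurd h hC]
  exact le_iInf fun k ↦ h i j k

theorem normHDom_eq_iInf (A : NormData m M) (σ : ℝ) (Ω : Set M) (u : VField m M) :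
    normHDom A σ Ω u
      = ⨅ U : {U : VField m M // MemH A σ U ∧ AEOn m Ω fun p ↦ U p = u p}, normH A σ U.1 :=
  iInf_subtype'

variable [IsManifold 𝓘(ℝ, Euc m) ∞ M]

theorem isNonlinearOp_zero (g : RMetric m M) (k β : ℝ) (Ω : Set M) :
    IsNonlinearOp g k β Ω (0 : VField m M) 0 := by
  have h0 : ∀ (φ : OpenPartialHomeomorph M (Euc m)) (l : Fin m) (x : Euc m),
      comp φ (0 : VField m M) l x = 0 := by
    intro φ l x
    rw [← compVec_apply, compVec_zero]
    rfl
  refine ⟨0, fun φ hφ ↦ ⟨fun _ _ _ ↦ 0, fun j l ↦ ?_, ae_of_all _ fun x _ l ↦ by simp [h0]⟩, ?_⟩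
  · rw [show comp φ (0 : VField m M) l = fun _ ↦ 0 from funext fun x ↦ h0 φ l x]
    exact HasWeakPartial.zero
  · funext p
    simp only [zeroExt, Pi.zero_apply, smul_zero, add_zero, ite_self]

/-- The Lipschitz estimate in terms of extensions `V`, `W`, `U` of `v`, `w`, `v - w`, which are
independent of each other. -/
theorem exists_normH_sub_le [CompactSpace M] (hm : m = 2 ∨ m = 3) (g : RMetric m M)
    (A : NormData m M) {Ω : Set M} (hΩ : IsOpen Ω) (k β : ℝ) :
    ∃ C : ℝ≥0, ∀ σ : ℝ, 1 ≤ σ → ∀ τ : ℝ, τ ≤ -1 / 2 → ∀ v w Y Z V W U : VField m M,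
      IsNonlinearOp g k β Ω v Y → IsNonlinearOp g k β Ω w Z →
      MemH A σ V → (AEOn m Ω fun p ↦ V p = v p) → MemH A σ W → (AEOn m Ω fun p ↦ W p = w p) →
      MemH A σ U → (AEOn m Ω fun p ↦ U p = (v - w) p) →
        MemH A τ (Y - Z) ∧ normH A τ (Y - Z)
          ≤ C * ((normH A σ V + normH A σ W) * normH A σ U) := by
  choose C hC using exists_hsNorm_localRep_sub_le hm g A hΩ k β
  refine ⟨∑ i, ∑ _l : Fin m, C i, ?_⟩
  intro σ hσ τ hτ v w Y Z V W U hY hZ hV hVv hW hWw hU hUvw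
  have h := fun i ↦ hC i σ hσ τ hτ v w Y Z V W U hY hZ hV hVv hW hWw hU hUvw
  refine ⟨fun i l ↦ (h i l).1, ?_⟩
  rw [ENNReal.ofNNReal_finsetSum, Finset.sum_mul]
  refine Finset.sum_le_sum fun i _ ↦ ?_
  rw [ENNReal.ofNNReal_finsetSum, Finset.sum_mul]
  exact Finset.sum_le_sum fun l _ ↦ (h i l).2

/-- The Lipschitz estimate, in the quotient norms. -/
theorem exists_normH_sub_le_normHDom [CompactSpace M] (hm : m = 2 ∨ m = 3) (g : RMetric m M)
    (A : NormData m M) {Ω : Set M} (hΩ : IsOpen Ω) (k β : ℝ) :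
    ∃ C : ℝ≥0, ∀ σ : ℝ, 1 ≤ σ → ∀ τ : ℝ, τ ≤ -1 / 2 → ∀ v w : VField m M,
      MemHDom A σ Ω v → MemHDom A σ Ω w → ∀ Y Z : VField m M,
      IsNonlinearOp g k β Ω v Y → IsNonlinearOp g k β Ω w Z →
        MemH A τ (Y - Z) ∧ normH A τ (Y - Z)
          ≤ C * ((normHDom A σ Ω v + normHDom A σ Ω w) * normHDom A σ Ω (v - w)) := by
  obtain ⟨C, hC⟩ := exists_normH_sub_le hm g A hΩ k β
  obtain ⟨_, hfin⟩ := exists_localReal_bounds hm A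
  refine ⟨C, fun σ hσ τ hτ v w hv hw Y Z hY hZ ↦ ?_⟩
  have hvw := memHDom_sub A hv hw
  have ne : ∀ {u : VField m M}, MemHDom A σ Ω u →
      Nonempty {U : VField m M // MemH A σ U ∧ AEOn m Ω fun p ↦ U p = u p} :=
    fun ⟨U, hU⟩ ↦ ⟨⟨U, hU⟩⟩
  have := ne hv
  have := ne hw
  have := ne hvw
  constructor
  · obtain ⟨V, hV, hVv⟩ := hv
    obtain ⟨W, hW, hWw⟩ := hw
    obtain ⟨U, hU, hUvw⟩ := hvw
    exact (hC σ hσ τ hτ v w Y Z V W U hY hZ hV hVv hW hWw hU hUvw).1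
  · rw [normHDom_eq_iInf, normHDom_eq_iInf, normHDom_eq_iInf]
    exact le_mul_add_iInf_mul_iInf (fun V ↦ (hfin σ hσ _ V.2.1).1)
      (fun W ↦ (hfin σ hσ _ W.2.1).1) (fun U ↦ (hfin σ hσ _ U.2.1).1) fun V W U ↦
      (hC σ hσ τ hτ v w Y Z V W U hY hZ V.2.1 V.2.2 W.2.1 W.2.2 U.2.1 U.2.2).2

end Conclusion

end SobolevField

end

theorem lemmaB1 {m : ℕ} (hm : m = 2 ∨ m = 3)
    {M : Type*} [TopologicalSpace M] [T2Space M] [CompactSpace M]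
    [ChartedSpace (Euc m) M] [IsManifold 𝓘(ℝ, Euc m) ∞ M]
    (g : RMetric m M) (A : NormData m M)
    (Ω : Set M) (hΩ : IsLipschitzDomain m Ω) (k β : ℝ) :
    ∃ C₁' C₁ : ℝ≥0, 0 < C₁' ∧ 0 < C₁ ∧ ∀ s : ℝ, 1 / 2 ≤ s → s < 1 →
      -- the operator is defined on the whole space
      (∀ u : VField m M, MemHDom A (s + 1 / 2) Ω u →
        ∃ Y : VField m M, IsNonlinearOp g k β Ω u Y) ∧
      -- it maps into the space of negative order, with a quadratic bound
      (∀ u : VField m M, MemHDom A (s + 1 / 2) Ω u →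
        ∀ Y : VField m M, IsNonlinearOp g k β Ω u Y →
          MemHTilde A (s - 3 / 2) Ω Y ∧
          normH A (s - 3 / 2) Y ≤ C₁' * normHDom A (s + 1 / 2) Ω u ^ 2) ∧
      -- it is locally Lipschitz
      (∀ v w : VField m M, MemHDom A (s + 1 / 2) Ω v → MemHDom A (s + 1 / 2) Ω w →
        ∀ Y Z : VField m M, IsNonlinearOp g k β Ω v Y → IsNonlinearOp g k β Ω w Z →
          normH A (s - 3 / 2) (Y - Z) ≤
            C₁ * (normHDom A (s + 1 / 2) Ω v + normHDom A (s + 1 / 2) Ω w)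
              * normHDom A (s + 1 / 2) Ω (v - w)) := by
  have hΩo : IsOpen Ω := hΩ.1
  obtain ⟨C, hC⟩ := exists_normH_sub_le_normHDom hm g A hΩo k β
  have hCle : (C : ℝ≥0∞) ≤ (C + 1 : ℝ≥0) := ENNReal.coe_le_coe.2 le_self_add
  -- `C + 1` rather than `C`, for positive constants
  refine ⟨C + 1, C + 1, by positivity, by positivity, fun s hs hs1 ↦ ?_⟩
  have hσ : 1 ≤ s + 1 / 2 := by linarith
  have hτ : s - 3 / 2 ≤ -1 / 2 := by linarith
  refine ⟨fun u hu ↦ ?_, fun u hu Y hY ↦ ?_, fun v w hv hw Y Z hY hZ ↦ ?_⟩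
  -- restricted to `Ω`, the weak derivatives of an extension are those of `u`
  · obtain ⟨U, hU, hUu⟩ := hu
    obtain ⟨F, hF⟩ := exists_isCovDeriv g A hΩo (u := u) fun φ hφ ↦ by
      obtain ⟨_, h⟩ := exists_comp_bounds hm A hφ isCompact_empty (Set.empty_subset _)
      obtain ⟨D, hD, -⟩ := h _ hσ U hU
      exact ⟨D, fun j l ↦ ((hD j l).mono Set.inter_subset_left).congr_ae (isOpen_domIn φ hΩo)
        ((hUu.compVec_eq hφ).mono fun x hx hxW ↦ by
          rw [← compVec_apply, hx hxW, compVec_apply]) (ae_of_all _ fun _ _ ↦ rfl)⟩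
    exact ⟨_, F, hF, rfl⟩
  -- the Lipschitz bound with `w = 0`
  · have h0 : MemHDom A (s + 1 / 2) Ω (0 : VField m M) :=
      ⟨0, (memH_zero_and_normH_zero A _).1, fun φ _ ↦ ae_of_all _ fun x _ _ ↦ rfl⟩
    have hn0 : normHDom A (s + 1 / 2) Ω (0 : VField m M) = 0 :=
      le_antisymm ((iInf₂_le 0 ⟨(memH_zero_and_normH_zero A _).1,
        fun φ _ ↦ ae_of_all _ fun x _ _ ↦ rfl⟩).trans (memH_zero_and_normH_zero A _).2.le) zero_le
    obtain ⟨h1, h2⟩ := hC _ hσ _ hτ u 0 hu h0 Y 0 hY (isNonlinearOp_zero g k β Ω)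
    rw [sub_zero] at h1 h2
    rw [sub_zero, hn0, add_zero, ← sq] at h2
    refine ⟨⟨h1, fun φ _ ↦ ae_of_all _ fun x _ hx ↦ ?_⟩, h2.trans (mul_le_mul hCle le_rfl
      zero_le zero_le)⟩
    obtain ⟨F, -, rfl⟩ := hY
    exact if_neg fun h ↦ hx (subset_closure h)
  · rw [mul_assoc]
    exact (hC _ hσ _ hτ v w hv hw Y Z hY hZ).2.trans (mul_le_mul hCle le_rfl zero_le zero_le)
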